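/- Let $1\le d\le n$ be integers and let $\lambda,\mu,\nu\in\mathcal P_{d,n}$, i.e. $n-d\ge\lambda_1\ge\dots\ge\lambda_d\ge 0$ and likewise for $\mu,\nu$. **Tableaux.** The skew diagram $\lambda*\mu$ consists of the Young diagram of $\lambda$ placed above and to the right of the reverse (right and bottom justified) Young diagram of $\mu$, whose rows have lengths $\mu_1,\dots,\mu_d$ from bottom to top; rows of $\mu$ are numbered from bottom to top and columns from right to left. A skew barred tableau $L$ fills the boxes of $\lambda$ with elements of $\{1,\dots,d\}$ and the boxes of $\mu$ with elements of $\{1,\dots,d\}\cup\{\overline 1,\dots,\overline d\}$ so that the values (bars ignored) weakly increase along rows from left to right and strictly increase down columns. Its unbarred column word $L^u$ is read from the rightmost column to the leftmost, each column from top to bottom, skipping barred entries. $\mathcal{LR}_{\lambda,\mu}^{\nu}$ is the set of those $L$ for which every initial part of $L^u$ contains at least as many $k$'s as $(k+1)$'s for all $k$, and $L^u$ contains exactly $\nu_k$ letters $k$ for all $k$. For a barred entry $a$ of value $|a|$ in row $r(a)$ and column $c(a)$ of $\mu$, put $e_a=d+1-|a|+\omega_a$ and $f_a=d+1-|a|+c(a)-r(a)$,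 where $\omega_a$ is the number of letters $|a|$ of $L^u$ read before $a$. Put $c_L=\prod_a(y_{e_a}-y_{f_a})$ and $C_L=\prod_a(Y_{n+1-f_a}-Y_{n+1-e_a})$, the products being over the barred entries $a$. $\mathcal{LR}_{\lambda,\mu}^{\nu\,+}$ is the set of $L\in\mathcal{LR}_{\lambda,\mu}^{\nu}$ with $e_a>f_a$ for all barred $a$. **Puzzles.** The puzzle pieces (not to be rotated; all edges of length 1, and edges of the directions $-$, $/$, $\backslash$) are: the unit triangles pointing up or down with all labels 0 or all labels 1 (0-triangles and 1-triangles); the rhombus with $-$ edges labelled 1 and $/$ edges labelled 0; the rhombus with $\backslash$ edges labelled 1 and $-$ edges labelled 0; the rhombus with $/$ edges labelled 1 and $\backslash$ edges labelled 0; and the equivariant piece, the rhombus with $\backslash$ edges labelled 1 and $/$ edges labelled 0. In a partitioning into puzzle pieces, pieces sharing an edge have the same label on it. A binary word corresponds to $\eta$ if $\eta_j$ is the number of zeros to the right of the $j$-th one. A puzzle is a partitioning into puzzle pieces of the upward pointing equilateral triangle of side $n$; $\mathcal{LP}_{\lambda,\mu}^{\nu\,+}$ is the set of puzzles whose words on the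 NE side (read from top to bottom), the NW side (bottom to top) and the S side (left to right) correspond to $\lambda,\mu,\nu$. Let $T$ be the isosceles trapezoid formed by this triangle on top of a rhombus of side $n$ whose E and W sides have direction $/$, and let $D$ be the south side of the triangle. A trapezoid puzzle is a partitioning of $T$ into puzzle pieces with all labels on the E and W sides of the rhombus equal to 0; $\mathcal{LP}_{\lambda,\mu}^{\nu}$ is the set of trapezoid puzzles whose words on the NE and NW sides of the triangle and on the S side of $T$ correspond to $\lambda,\mu,\nu$. For an equivariant piece, the lines through its center in the directions $/$ and $\backslash$ cross $D$ at distances $e-\frac12$ and $f-\frac12$ from its right endpoint; $c_P$ and $C_P$ are the products of the $y_e-y_f$ and of the $Y_{n+1-f}-Y_{n+1-e}$, respectively, over all equivariant pieces of $P$. A puzzle is viewed as a trapezoid puzzle by placing below each 1-edge of its S side a column of $n$ rhombi with $-$ edges labelled 1, and 0-triangles below each 0-edge; thus $\mathcal{LP}_{\lambda,\mu}^{\nu\,+}\subset\mathcal{LP}_{\lambda,\mu}^{\nu}$. **The map $\Phi$.** Let $P$ be a puzzle or trapezoid puzzle as above. For $i=1,\dots,d$ let $P_i$ be the path of 1-triangles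 and rhombi that starts at the $i$-th 1-edge from the top on the NE side, moves only west or southwest, leaving each piece through its other 1-edge of direction $-$ or $\backslash$, and ends on the S side. Let $P_{i,k}$ ($k\ge1$) be the sequence of the equivariant pieces and the rhombi with $-$ edges labelled 0 which lie on $P_i$ after exactly $k-1$ upward pointing 1-triangles. Then $\Phi(P)$ is the skew barred tableau of shape $\lambda*\mu$ in which the $i$-th row of $\lambda$ consists of unbarred $i$'s, and the $t$-th row from the top of the diagram of $\mu$ (all $d$ rows being counted, including empty ones) consists of the segments $P_{1,t},P_{2,t-1},\dots,P_{t,1}$ from left to right, each piece of $P_{i,k}$ giving a box with entry $\overline i$ if it is equivariant and $i$ otherwise. **Proposition.** $\Phi$ is a bijection $\mathcal{LP}_{\lambda,\mu}^{\nu\,+}\to\mathcal{LR}_{\lambda,\mu}^{\nu\,+}$, and it extends to a bijection $\Phi:\mathcal{LP}_{\lambda,\mu}^{\nu}\to\mathcal{LR}_{\lambda,\mu}^{\nu}$ onto all equivariant Littlewood–Richardson skew tableaux, including those with $c_L=0$. Both are weight preserving: $c_P$ and $c_{\Phi(P)}$ are equal and moreover identical expressions (products of the same factors with the same multiplicities,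 all indices lying in $\{1,\dots,n\}$), and similarly for $C_P$ and $C_{\Phi(P)}$. -/

import Mathlib

/-! ### Partitions -/

/-- The set of partitions with `d` parts (weakly decreasing, zeros allowed) whose parts are at
most `n - d`.  Only used for `d ≤ n`. -/
def IsBoxPartition (d n : ℕ) (lam : Fin d → ℕ) : Prop :=
  Antitone lam ∧ ∀ i, lam i ≤ n - d

/-! ### Equivariant Littlewood-Richardson skew tableaux

All indices start from `0`: the element `k : Fin d` stands for the entry `k + 1`. -/

/-- Boxes of the skew diagram `λ * μ`.
* `top i j` is the box of the Young diagram `λ` in row `i` (rows numbered from top to bottom) and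
  column `j` (columns numbered from left to right).
* `bot r c` is the box of the reverse Young diagram `μ` in row `r` (rows numbered from bottom to
  top, row `r` having length `μ r`) and column `c` (columns numbered from right to left). -/
inductive Box {d : ℕ} (lam mu : Fin d → ℕ) : Type
  | top (i : Fin d) (j : Fin (lam i)) : Box lam mu
  | bot (r : Fin d) (c : Fin (mu r)) : Box lam mu
  deriving DecidableEq, Fintype

/-- `a.Before b`: the box `a` is read before the box `b` when the boxes are read column by column,
from the rightmost column of `λ * μ` to the leftmost one, each column from top to bottom
(the columns of `λ` are all to the right of those of `μ`). -/
def Box.Before {d : ℕ} {lam mu : Fin d → ℕ} : Box lam mu → Box lam mu → Prop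
  | .top i j, .top i' j' => (j' : ℕ) < j ∨ ((j : ℕ) = j' ∧ i < i')
  | .top _ _, .bot _ _ => True
  | .bot _ _, .top _ _ => False
  | .bot r c, .bot r' c' => (c : ℕ) < c' ∨ ((c : ℕ) = c' ∧ r' < r)

/-- A skew barred tableau of shape `λ * μ`: the boxes of `λ` carry values, the boxes of `μ` carry
values that may be barred (`(k, true)` is a barred entry of value `k`, `(k, false)` an unbarred
one).  Values weakly increase along rows from left to right and strictly increase down columns. -/
@[ext] structure SkewBarredTableau {d : ℕ} (lam mu : Fin d → ℕ) where
  top : (i : Fin d) → Fin (lam i) → Fin d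
  bot : (r : Fin d) → Fin (mu r) → Fin d × Bool
  top_row : ∀ i (j j' : Fin (lam i)), j ≤ j' → top i j ≤ top i j'
  top_col : ∀ i i' (j : Fin (lam i)) (j' : Fin (lam i')),
    (j : ℕ) = j' → i < i' → top i j < top i' j'
  bot_row : ∀ r (c c' : Fin (mu r)), c ≤ c' → (bot r c').1 ≤ (bot r c).1
  bot_col : ∀ r r' (c : Fin (mu r)) (c' : Fin (mu r')),
    (c : ℕ) = c' → r < r' → (bot r' c').1 < (bot r c).1

namespace SkewBarredTableau

variable {d : ℕ} {lam mu : Fin d → ℕ}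

/-- The entry in a box: its value, and whether it is barred. -/
def entry (L : SkewBarredTableau lam mu) : Box lam mu → Fin d × Bool
  | .top i j => (L.top i j, false)
  | .bot r c => L.bot r c

open scoped Classical in
/-- `ω(L^u)_k`: the number of unbarred entries of value `k`. -/
noncomputable def content (L : SkewBarredTableau lam mu) (k : Fin d) : ℕ :=
  (Finset.univ.filter fun b : Box lam mu => L.entry b = (k, false)).card

open scoped Classical in
/-- `ω(L^u_{<a})_k`: the number of letters `k` in the portion of the unbarred column word
that comes before the box `a` is reached. -/
noncomputable def contentBefore (L : SkewBarredTableau lam mu) (a : Box lam mu) (k : Fin d) : ℕ :=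
  (Finset.univ.filter fun b : Box lam mu => b.Before a ∧ L.entry b = (k, false)).card

open scoped Classical in
/-- `ω(L^u_{≤a})_k`: the number of letters `k` in the portion of the unbarred column word
that comes before or at the box `a`. -/
noncomputable def contentUpTo (L : SkewBarredTableau lam mu) (a : Box lam mu) (k : Fin d) : ℕ :=
  (Finset.univ.filter fun b : Box lam mu =>
    (b.Before a ∨ b = a) ∧ L.entry b = (k, false)).card

/-- The unbarred column word is Yamanouchi: stopping at any point, one has written at least as
many letters `k` as letters `k + 1`. -/
def IsYamanouchi (L : SkewBarredTableau lam mu) : Prop :=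
  ∀ (a : Box lam mu) (k l : Fin d), (l : ℕ) = k + 1 → L.contentUpTo a l ≤ L.contentUpTo a k

/-- The boxes with barred entries. -/
def barredBoxes (L : SkewBarredTableau lam mu) : Finset ((r : Fin d) × Fin (mu r)) :=
  Finset.univ.filter fun a => (L.bot a.1 a.2).2 = true

/-- The index pairs `(i, j)` of the factors `y_i - y_j` of `c_L`, one for each barred entry `a`:
`i = |a|' + ω(L^u_{<a})_{|a|}` and `j = |a|' + c(a) - r(a)`, where `|a|' = d + 1 - |a|` (in
`0`-based terms `|a|' = d - k` for the value `k`, and the shifts in `c(a) - r(a)` cancel). -/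
noncomputable def factorialFactors (L : SkewBarredTableau lam mu) : Multiset (ℤ × ℤ) :=
  L.barredBoxes.val.map fun a =>
    let k := (L.bot a.1 a.2).1
    ((d : ℤ) - k + L.contentBefore (.bot a.1 a.2) k, (d : ℤ) - k + (a.2 : ℕ) - (a.1 : ℕ))

/-- The index pairs `(i, j)` of the factors `Y_i - Y_j` of `C_L`, one for each barred entry `a`:
`i = (n - d) + |a| - (c(a) - r(a))` and `j = (n - d) + |a| - ω(L^u_{<a})_{|a|}`. -/
noncomputable def equivariantFactors (n : ℕ) (L : SkewBarredTableau lam mu) : Multiset (ℤ × ℤ) :=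
  L.barredBoxes.val.map fun a =>
    let k := (L.bot a.1 a.2).1
    (((n : ℤ) - d) + (k + 1) - ((a.2 : ℕ) - (a.1 : ℕ)),
      ((n : ℤ) - d) + (k + 1) - L.contentBefore (.bot a.1 a.2) k)

end SkewBarredTableau

/-- The set of equivariant Littlewood-Richardson skew tableaux of shape `λ * μ` and unbarred
content `ν`. -/
def LRTableaux {d : ℕ} (lam mu nu : Fin d → ℕ) : Set (SkewBarredTableau lam mu) :=
  {L | L.IsYamanouchi ∧ ∀ k, L.content k = nu k}

/-- The positive ones: every factor of `c_L` has the form `y_i - y_j` with `i > j`. -/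
def LRTableauxPos {d : ℕ} (lam mu nu : Fin d → ℕ) : Set (SkewBarredTableau lam mu) :=
  {L | L ∈ LRTableaux lam mu nu ∧ ∀ p ∈ L.factorialFactors, p.2 < p.1}

/-- The product of the factors `y_i - y_j` over a multiset of index pairs `(i, j)`. -/
noncomputable def factorProduct (m : Multiset (ℤ × ℤ)) : MvPolynomial ℤ ℂ :=
  (m.map fun p => MvPolynomial.X p.1 - MvPolynomial.X p.2).prod

/-! ### Puzzles

The triangular lattice is described by the integer coordinates `(x, y)`, standing for the point
`x • (1, 0) + y • (1/2, √3/2)` of the plane. -/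

/-- Unit triangles: `up x y` has the vertices `(x, y), (x+1, y), (x, y+1)` and points upward,
`down x y` has the vertices `(x+1, y), (x, y+1), (x+1, y+1)` and points downward. -/
inductive UnitTriangle : Type
  | up (x y : ℤ) : UnitTriangle
  | down (x y : ℤ) : UnitTriangle
  deriving DecidableEq

/-- The vertices of a unit triangle. -/
def UnitTriangle.vertices : UnitTriangle → Finset (ℤ × ℤ)
  | .up x y => {(x, y), (x + 1, y), (x, y + 1)}
  | .down x y => {(x + 1, y), (x, y + 1), (x + 1, y + 1)}

/-- Unit edges: `hor x y` is horizontal, from `(x, y)` to `(x+1, y)`; `slash x y` goes from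
`(x, y)` north-east to `(x, y+1)`; `back x y` goes from `(x, y+1)` south-east to `(x+1, y)`. -/
inductive Edge : Type
  | hor (x y : ℤ) : Edge
  | slash (x y : ℤ) : Edge
  | back (x y : ℤ) : Edge
  deriving DecidableEq

/-- The eight puzzle pieces (labels are Booleans: `true` is `1`, `false` is `0`):
triangles pointing upward or downward with all labels equal to `b`; the rhombus with horizontal
edges labelled 1 and slash edges labelled 0; the rhombus with back edges labelled 1 and horizontal
edges labelled 0; the rhombus with slash edges labelled 1 and back edges labelled 0; and the
equivariant piece, the rhombus with back edges labelled 1 and slash edges labelled 0. -/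
inductive PieceKind : Type
  | upTri (b : Bool) : PieceKind
  | downTri (b : Bool) : PieceKind
  | horOne : PieceKind
  | backOne : PieceKind
  | slashOne : PieceKind
  | equivariant : PieceKind
  deriving DecidableEq

/-- A puzzle piece placed in the lattice (pieces are not rotated). -/
structure Piece where
  kind : PieceKind
  x : ℤ
  y : ℤ
  deriving DecidableEq

/-- The unit triangles covered by a piece. -/
def Piece.cells : Piece → Finset UnitTriangle
  | ⟨.upTri _, x, y⟩ => {.up x y}
  | ⟨.downTri _, x, y⟩ => {.down x y}
  | ⟨.horOne, x, y⟩ => {.up x y, .down x y}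
  | ⟨.backOne, x, y⟩ => {.down x y, .up (x + 1) y}
  | ⟨.slashOne, x, y⟩ => {.down x y, .up x (y + 1)}
  | ⟨.equivariant, x, y⟩ => {.down x y, .up x (y + 1)}

/-- The edges of a piece with their labels. -/
def Piece.edges : Piece → Finset (Edge × Bool)
  | ⟨.upTri b, x, y⟩ => {(.hor x y, b), (.slash x y, b), (.back x y, b)}
  | ⟨.downTri b, x, y⟩ => {(.hor x (y + 1), b), (.slash (x + 1) y, b), (.back x y, b)}
  | ⟨.horOne, x, y⟩ =>
      {(.hor x y, true), (.hor x (y + 1), true), (.slash x y, false), (.slash (x + 1) y, false)}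
  | ⟨.backOne, x, y⟩ =>
      {(.back x y, true), (.back (x + 1) y, true), (.hor x (y + 1), false),
        (.hor (x + 1) y, false)}
  | ⟨.slashOne, x, y⟩ =>
      {(.slash x (y + 1), true), (.slash (x + 1) y, true), (.back x y, false),
        (.back x (y + 1), false)}
  | ⟨.equivariant, x, y⟩ =>
      {(.back x y, true), (.back x (y + 1), true), (.slash x (y + 1), false),
        (.slash (x + 1) y, false)}

/-- A partitioning into puzzle pieces of the convex lattice region whose set of lattice points is
`R`: the pieces lie in the region, every unit triangle of the region is covered by exactly one
piece, and two pieces sharing an edge have the same label on it. -/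
def IsPartitioning (R : Set (ℤ × ℤ)) (P : Finset Piece) : Prop :=
  (∀ p ∈ P, ∀ t ∈ p.cells, ∀ v ∈ t.vertices, v ∈ R) ∧
  (∀ t : UnitTriangle, (∀ v ∈ t.vertices, v ∈ R) → ∃! p, p ∈ P ∧ t ∈ p.cells) ∧
  (∀ p ∈ P, ∀ q ∈ P, ∀ e b b', (e, b) ∈ p.edges → (e, b') ∈ q.edges → b = b')

/-- Some piece of `P` has the edge `e` with label `b`. -/
def HasLabel (P : Finset Piece) (e : Edge) (b : Bool) : Prop :=
  ∃ p ∈ P, (e, b) ∈ p.edges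

instance (P : Finset Piece) (e : Edge) (b : Bool) : Decidable (HasLabel P e b) :=
  inferInstanceAs (Decidable (∃ p ∈ P, (e, b) ∈ p.edges))

/-- The binary word of the labels along a list of edges. -/
def wordAlong (P : Finset Piece) (es : List Edge) : List Bool :=
  es.map fun e => decide (HasLabel P e true)

/-- The list `η₁, η₂, …` attached to a binary word: `η_j` is the number of zeros to the right of
the `j`-th one from the left. -/
def partsOfWord : List Bool → List ℕ
  | [] => []
  | true :: w => w.count false :: partsOfWord w
  | false :: w => partsOfWord w

/-- The equilateral triangle of side length `n` with corners `(0, 0)`, `(n, 0)`, `(0, n)`. -/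
def triangleRegion (n : ℕ) : Set (ℤ × ℤ) :=
  {v | 0 ≤ v.1 ∧ 0 ≤ v.2 ∧ v.1 + v.2 ≤ n}

/-- The isosceles trapezoid with corners `(0, n)`, `(n, 0)`, `(n, -n)`, `(0, -n)`: the
equilateral triangle above on top of the rhombus with corners
`(0, 0)`, `(n, 0)`, `(n, -n)`, `(0, -n)`. -/
def trapezoidRegion (n : ℕ) : Set (ℤ × ℤ) :=
  {v | 0 ≤ v.1 ∧ v.1 ≤ n ∧ -(n : ℤ) ≤ v.2 ∧ v.1 + v.2 ≤ n}

/-- The northeast side of the triangle, from top to bottom. -/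
def edgesNE (n : ℕ) : List Edge :=
  (List.range n).map fun j => .back (j : ℤ) ((n : ℤ) - 1 - j)

/-- The northwest side of the triangle, from bottom to top. -/
def edgesNW (n : ℕ) : List Edge :=
  (List.range n).map fun j => .slash 0 (j : ℤ)

/-- The horizontal line from `(0, h)` to `(n, h)`, from left to right: the south side of the
triangle for `h = 0`, the south side of the trapezoid for `h = -n`. -/
def edgesHor (n : ℕ) (h : ℤ) : List Edge :=
  (List.range n).map fun j => .hor (j : ℤ) h

/-- The west side of the rhombus. -/
def edgesW (n : ℕ) : List Edge :=
  (List.range n).map fun j => .slash 0 (-(j : ℤ) - 1)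

/-- The east side of the rhombus. -/
def edgesE (n : ℕ) : List Edge :=
  (List.range n).map fun j => .slash (n : ℤ) (-(j : ℤ) - 1)

/-- The puzzles of side length `n` whose words on the NE, NW and S sides correspond to the
partitions `λ`, `μ`, `ν`. -/
def Puzzles {d : ℕ} (n : ℕ) (lam mu nu : Fin d → ℕ) : Set (Finset Piece) :=
  {P | IsPartitioning (triangleRegion n) P ∧
    partsOfWord (wordAlong P (edgesNE n)) = List.ofFn lam ∧
    partsOfWord (wordAlong P (edgesNW n)) = List.ofFn mu ∧
    partsOfWord (wordAlong P (edgesHor n 0)) = List.ofFn nu}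

/-- The trapezoid puzzles (all labels on the E and W sides are 0) whose words on the NE, NW and S
sides correspond to the partitions `λ`, `μ`, `ν`. -/
def TrapezoidPuzzles {d : ℕ} (n : ℕ) (lam mu nu : Fin d → ℕ) : Set (Finset Piece) :=
  {P | IsPartitioning (trapezoidRegion n) P ∧
    (∀ e ∈ edgesE n, HasLabel P e false) ∧
    (∀ e ∈ edgesW n, HasLabel P e false) ∧
    partsOfWord (wordAlong P (edgesNE n)) = List.ofFn lam ∧
    partsOfWord (wordAlong P (edgesNW n)) = List.ofFn mu ∧
    partsOfWord (wordAlong P (edgesHor n (-(n : ℤ)))) = List.ofFn nu}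

/-- A puzzle viewed as a trapezoid puzzle: below every edge labelled 1 of the south side one places
a column of `n` rhombi with horizontal edges labelled 1, below every edge labelled 0 a column of
0-triangles. -/
def extendToTrapezoid (n : ℕ) (P : Finset Piece) : Finset Piece :=
  P ∪ (Finset.range n).biUnion fun x => (Finset.range n).biUnion fun j =>
    if HasLabel P (.hor (x : ℤ) 0) true then
      {⟨.horOne, (x : ℤ), -(j : ℤ) - 1⟩}
    else
      {⟨.upTri false, (x : ℤ), -(j : ℤ) - 1⟩, ⟨.downTri false, (x : ℤ), -(j : ℤ) - 1⟩}

/-! ### Weights of puzzles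

The center of the equivariant piece at `(x, y)` is the point `(x + 1/2, y + 1)`.  The line through
it parallel to the NW side meets the line `D` of points `(·, 0)` in `(x + 1/2, 0)`, at distance
`e - 1/2` from `(n, 0)` for `e = n - x`; the line parallel to the NE side meets `D` in
`(x + y + 3/2, 0)`, at distance `f - 1/2` from `(n, 0)` for `f = n - x - y - 1`. -/

/-- The index pairs `(e, f)` of the factorial weights `y_e - y_f` of the equivariant pieces. -/
def puzzleFactorialFactors (n : ℕ) (P : Finset Piece) : Multiset (ℤ × ℤ) :=
  (P.filter fun p => p.kind = .equivariant).val.map fun p =>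
    ((n : ℤ) - p.x, (n : ℤ) - p.x - p.y - 1)

/-- The index pairs `(n + 1 - f, n + 1 - e)` of the equivariant weights
`Y_{n+1-f} - Y_{n+1-e}` of the equivariant pieces. -/
def puzzleEquivariantFactors (n : ℕ) (P : Finset Piece) : Multiset (ℤ × ℤ) :=
  (puzzleFactorialFactors n P).map fun q => ((n : ℤ) + 1 - q.2, (n : ℤ) + 1 - q.1)

/-- `c_P` and `c_L`, and likewise `C_P` and `C_L`, are equal and moreover identical expressions,
that is, they are products of the same factors with the same multiplicities.  Moreover only the
variables with indices `1, …, n` occur in them. -/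
def SameWeights {d : ℕ} {lam mu : Fin d → ℕ} (n : ℕ) (P : Finset Piece)
    (L : SkewBarredTableau lam mu) : Prop :=
  puzzleFactorialFactors n P = L.factorialFactors ∧
  puzzleEquivariantFactors n P = L.equivariantFactors n ∧
  factorProduct (puzzleFactorialFactors n P) = factorProduct L.factorialFactors ∧
  factorProduct (puzzleEquivariantFactors n P) = factorProduct (L.equivariantFactors n) ∧
  ∀ q ∈ puzzleFactorialFactors n P, (1 ≤ q.1 ∧ q.1 ≤ n) ∧ (1 ≤ q.2 ∧ q.2 ≤ n)

/-! ### The correspondence `Φ` -/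

/-- Follow a path of 1-triangles and rhombi from an edge labelled 1 toward the west and southwest,
always leaving a piece through its other edge that is labelled 1 and is not a slash edge.  The
result is the list of the first `m` pieces of the path (or all, if there are at most `m`). -/
def followPath (P : Finset Piece) : ℕ → Edge → List Piece
  | 0, _ => []
  | m + 1, .back x y =>
      if ⟨.upTri true, x, y⟩ ∈ P then
        ⟨.upTri true, x, y⟩ :: followPath P m (.hor x y)
      else if ⟨.backOne, x - 1, y⟩ ∈ P then
        ⟨.backOne, x - 1, y⟩ :: followPath P m (.back (x - 1) y)
      else if ⟨.equivariant, x, y - 1⟩ ∈ P then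
        ⟨.equivariant, x, y - 1⟩ :: followPath P m (.back x (y - 1))
      else []
  | m + 1, .hor x y =>
      if ⟨.downTri true, x, y - 1⟩ ∈ P then
        ⟨.downTri true, x, y - 1⟩ :: followPath P m (.back x (y - 1))
      else if ⟨.horOne, x, y - 1⟩ ∈ P then
        ⟨.horOne, x, y - 1⟩ :: followPath P m (.hor x (y - 1))
      else []
  | _ + 1, .slash _ _ => []

/-- The path `P_i` (`i = 0, 1, …`) of `P`: it starts at the `i`-th edge labelled 1 from the top on
the NE side.  A path does not visit a piece twice, so `P.card` steps suffice. -/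
def puzzlePath (n : ℕ) (P : Finset Piece) (i : ℕ) : List Piece :=
  match ((edgesNE n).filter fun e => decide (HasLabel P e true))[i]? with
  | some e => followPath P P.card e
  | none => []

/-- The segment `P_{i,k}` (`k = 0, 1, …`), listed from east to west: the rhombi with horizontal
edges labelled 0 and the equivariant pieces that occur on the path `P_i` after exactly `k`
upward pointing 1-triangles.  So it lies to the right of the `k`-th (from `0`) upward pointing
1-triangle of `P_i`, and to the left of the NE side if `k = 0`, of a downward pointing 1-triangle
if `k > 0`. -/
def puzzleSegment (n : ℕ) (P : Finset Piece) (i k : ℕ) : List Piece :=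
  (((puzzlePath n P i).splitOnP fun p => decide (p.kind = .upTri true)).getD k []).filter
    fun p => decide (p.kind = .backOne ∨ p.kind = .equivariant)

/-- The entries (value and bar) of the `t`-th row from the top (`t = 0, 1, …`) of the reverse
barred tableau attached to `P`, listed from right to left.  The row consists of the segments
`P_{0,t}, P_{1,t-1}, …, P_{t,0}`, placed from left to right, where each rhombus of `P_{i,k}`
becomes a box with entry `i`, barred if the rhombus is an equivariant piece. -/
def puzzleRow (n : ℕ) (P : Finset Piece) (t : ℕ) : List (ℕ × Bool) :=
  (List.range (t + 1)).flatMap fun k =>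
    (puzzleSegment n P (t - k) k).map fun p => (t - k, decide (p.kind = .equivariant))

/-- `L` is the skew barred tableau `Φ(P)` constructed from the puzzle or trapezoid puzzle `P`:
the `i`-th row of `λ` is filled with unbarred `i`'s, and the rows of `μ` are given by `puzzleRow`
(in `L` the rows of `μ` are numbered from the bottom). -/
def IsPhi {d : ℕ} {lam mu : Fin d → ℕ} (n : ℕ) (P : Finset Piece)
    (L : SkewBarredTableau lam mu) : Prop :=
  (∀ i j, L.top i j = i) ∧
  ∀ r : Fin d, (List.ofFn fun c : Fin (mu r) => (((L.bot r c).1 : ℕ), (L.bot r c).2)) =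
    puzzleRow n P (d - 1 - r)

/-! ### Edge labelings -/

/-! Puzzles and tableaux are two encodings of the same object, a path system `(u, x)`
(`IsPathSystem`); the theorem amounts to showing that both encodings are bijective and that `Φ`
composes one with the inverse of the other.

Puzzles. Cut the region into strips between consecutive lines parallel to the NE side. Path `i` sits
at position `x i j` on line `j`, after passing `u i j` upward 1-triangles. The slash edge of an
upward 1-triangle on path `i + 1` sends a beam of `slashOne` rhombi to the west, inside the same
strip. The beam can end only at a downward 1-triangle of path `i`, or at the NW side if there is no
path further west. So downward triangles of path `i` match upward triangles of path `i + 1`, and `u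
i j - u (i + 1) j` is `0` when the path crosses line `j` through a back edge labelled 1 and `1` when
it runs down a column of `horOne` rhombi. The path has a piece of one of its segments in strip `j`
exactly when `u i (j + 1) = u (i + 1) j`; below such a pair `(i, j)` is called a letter. At a
letter, `x` drops by one for a `backOne` rhombus and is unchanged for an equivariant piece.
Conversely `(u, x)` determines every edge label (`pathLabels`, `isTriangleLabel_up`,
`isTriangleLabel_down`), and every labeling arises this way (`trace_invariant`, `trace_state`,
`hor_slash_eq`).

Tableaux. Beams are rows of `μ`: the beam of row `t` from the top meets path `i` at its triangle
number `t - i`, in the strip `t - i` plus the number of entries `≥ i` of that row. The box of value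
`i` in row `t` and column `c` is then the letter of path `i` in strip `t - i + c` (`letter_of_box`,
`box_of_letter`), barred when `x` stays put. Row and column conditions become the interlacing of
`u`. Since `x i j` is the starting position minus the number of unbarred `i`'s met so far,
disjointness of the paths is the Yamanouchi condition, and the final positions record the content
`ν`.

Weights. For a barred letter of path `i` in strip `j`, both the puzzle and the tableau give `e = n -
x i j` and `f = j + 1`.

Heights. Triangle and trapezoid are handled together as the region reaching down to height `-h`,
with `h = 0` or `h = n`. A path system does not know `h`; it fits into the region when it is settled
(`IsSettled`). For `h = n` this is automatic. For `h = 0` it is equivalent to positivity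
(`mem_LRTableauxPos_iff`), because `e > f` says that the equivariant piece lies above `D`. The same
path system at heights `0` and `n` gives a puzzle and its extension to the trapezoid.

The bijection is built from tableaux to puzzles: reading the segments of the puzzle of `L` returns
`L` (`isPhi`), which gives injectivity, and surjectivity is the encoding of puzzles by path systems
(`exists_puzzle_eq`). -/

/-- Labels of unit edges: `zero` and `one`, or the edge is interior to a rhombus; `eqv` marks the
interior edge of an equivariant piece, `inner` that of any other rhombus. -/
inductive EdgeLabel : Type
  | zero | one | inner | eqv
  deriving DecidableEq

/-- The edge label of a binary label. -/
def EdgeLabel.ofBool : Bool → EdgeLabel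
  | true => .one
  | false => .zero

theorem EdgeLabel.ofBool_injective : Function.Injective EdgeLabel.ofBool := by
  intro b b'; cases b <;> cases b' <;> simp [EdgeLabel.ofBool]

/-- The admissible labels of the horizontal, the slash and the back edge of a unit triangle. -/
inductive IsTriangleLabel : EdgeLabel → EdgeLabel → EdgeLabel → Prop
  | zeros : IsTriangleLabel .zero .zero .zero
  | ones : IsTriangleLabel .one .one .one
  | horOne : IsTriangleLabel .one .zero .inner
  | backOne : IsTriangleLabel .zero .inner .one
  | slashOne : IsTriangleLabel .inner .one .zero
  | equivariant : IsTriangleLabel .eqv .zero .one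

namespace UnitTriangle

/-- The edges of a unit triangle. -/
def edges : UnitTriangle → Finset Edge
  | .up x y => {.hor x y, .slash x y, .back x y}
  | .down x y => {.hor x (y + 1), .slash (x + 1) y, .back x y}

/-- The labels of the edges of a unit triangle are admissible. -/
def IsLabeled (l : Edge → EdgeLabel) : UnitTriangle → Prop
  | .up x y => IsTriangleLabel (l (.hor x y)) (l (.slash x y)) (l (.back x y))
  | .down x y => IsTriangleLabel (l (.hor x (y + 1))) (l (.slash (x + 1) y)) (l (.back x y))

/-- The unit triangle lies in the region. -/
def Inside (R : Set (ℤ × ℤ)) (t : UnitTriangle) : Prop := ∀ v ∈ t.vertices, v ∈ R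

end UnitTriangle

/-- The region between the NE side and the height `-h`: the triangle for `h = 0`, the trapezoid
for `h = n`. -/
def puzzleRegion (n h : ℕ) : Set (ℤ × ℤ) :=
  {v | 0 ≤ v.1 ∧ v.1 ≤ n ∧ -(h : ℤ) ≤ v.2 ∧ v.1 + v.2 ≤ n}

theorem inside_up {n h : ℕ} {x y : ℤ} :
    (UnitTriangle.up x y).Inside (puzzleRegion n h) ↔
      0 ≤ x ∧ x + 1 ≤ n ∧ -(h : ℤ) ≤ y ∧ x + y + 1 ≤ n := by
  simp only [UnitTriangle.Inside, UnitTriangle.vertices, puzzleRegion, Finset.mem_insert,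
    Finset.mem_singleton, forall_eq_or_imp, forall_eq, Set.mem_ofPred_eq]
  omega

theorem inside_down {n h : ℕ} {x y : ℤ} :
    (UnitTriangle.down x y).Inside (puzzleRegion n h) ↔
      0 ≤ x ∧ x + 1 ≤ n ∧ -(h : ℤ) ≤ y ∧ x + y + 2 ≤ n := by
  simp only [UnitTriangle.Inside, UnitTriangle.vertices, puzzleRegion, Finset.mem_insert,
    Finset.mem_singleton, forall_eq_or_imp, forall_eq, Set.mem_ofPred_eq]
  omega

/-- The piece is compatible with the edge labels. -/
def Piece.Fits (l : Edge → EdgeLabel) : Piece → Prop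
  | ⟨.upTri b, x, y⟩ =>
      l (.hor x y) = .ofBool b ∧ l (.slash x y) = .ofBool b ∧ l (.back x y) = .ofBool b
  | ⟨.downTri b, x, y⟩ =>
      l (.hor x (y + 1)) = .ofBool b ∧ l (.slash (x + 1) y) = .ofBool b ∧
        l (.back x y) = .ofBool b
  | ⟨.horOne, x, y⟩ => l (.back x y) = .inner
  | ⟨.backOne, x, y⟩ => l (.slash (x + 1) y) = .inner
  | ⟨.slashOne, x, y⟩ => l (.hor x (y + 1)) = .inner
  | ⟨.equivariant, x, y⟩ => l (.hor x (y + 1)) = .eqv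

theorem IsTriangleLabel.of_back_inner {h g b} (H : IsTriangleLabel h g b) (hb : b = .inner) :
    h = .one ∧ g = .zero := by
  subst hb; cases H; simp

theorem IsTriangleLabel.of_slash_inner {h g b} (H : IsTriangleLabel h g b) (hb : g = .inner) :
    h = .zero ∧ b = .one := by
  subst hb; cases H; simp

theorem IsTriangleLabel.of_hor_inner {h g b} (H : IsTriangleLabel h g b) (hb : h = .inner) :
    g = .one ∧ b = .zero := by
  subst hb; cases H; simp

theorem IsTriangleLabel.of_hor_eqv {h g b} (H : IsTriangleLabel h g b) (hb : h = .eqv) :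
    g = .zero ∧ b = .one := by
  subst hb; cases H; simp

/-- The boundary edges of a fitting piece carry the labels of the piece. -/
theorem Piece.Fits.label {l : Edge → EdgeLabel} {p : Piece} (hp : p.Fits l)
    (hc : ∀ t ∈ p.cells, t.IsLabeled l) {e : Edge} {b : Bool} (he : (e, b) ∈ p.edges) :
    l e = .ofBool b := by
  obtain ⟨k, x, y⟩ := p
  cases k <;> simp only [Piece.Fits, Piece.cells, Piece.edges, Finset.mem_insert,
    Finset.mem_singleton, forall_eq_or_imp, forall_eq, UnitTriangle.IsLabeled,
    Prod.mk.injEq] at hp hc he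
  · rcases he with ⟨rfl, rfl⟩ | ⟨rfl, rfl⟩ | ⟨rfl, rfl⟩ <;> simp [hp]
  · rcases he with ⟨rfl, rfl⟩ | ⟨rfl, rfl⟩ | ⟨rfl, rfl⟩ <;> simp [hp]
  · have h1 := hc.1.of_back_inner hp
    have h2 := hc.2.of_back_inner hp
    rcases he with ⟨rfl, rfl⟩ | ⟨rfl, rfl⟩ | ⟨rfl, rfl⟩ | ⟨rfl, rfl⟩ <;>
      simp [h1, h2, EdgeLabel.ofBool]
  · have h1 := hc.1.of_slash_inner hp
    have h2 := hc.2.of_slash_inner hp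
    rcases he with ⟨rfl, rfl⟩ | ⟨rfl, rfl⟩ | ⟨rfl, rfl⟩ | ⟨rfl, rfl⟩ <;>
      simp [h1, h2, EdgeLabel.ofBool]
  · have h1 := hc.1.of_hor_inner hp
    have h2 := hc.2.of_hor_inner hp
    rcases he with ⟨rfl, rfl⟩ | ⟨rfl, rfl⟩ | ⟨rfl, rfl⟩ | ⟨rfl, rfl⟩ <;>
      simp [h1, h2, EdgeLabel.ofBool]
  · have h1 := hc.1.of_hor_eqv hp
    have h2 := hc.2.of_hor_eqv hp
    rcases he with ⟨rfl, rfl⟩ | ⟨rfl, rfl⟩ | ⟨rfl, rfl⟩ | ⟨rfl, rfl⟩ <;>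
      simp [h1, h2, EdgeLabel.ofBool]

/-- An edge of a triangle covered by a fitting piece, if it has a binary label, is a boundary edge
of the piece. -/
theorem Piece.Fits.mem_edges {l : Edge → EdgeLabel} {p : Piece} (hp : p.Fits l)
    (hc : ∀ t ∈ p.cells, t.IsLabeled l) {t : UnitTriangle} (ht : t ∈ p.cells) {e : Edge}
    (het : e ∈ t.edges) {b : Bool} (he : l e = .ofBool b) : (e, b) ∈ p.edges := by
  suffices h : ∃ b', (e, b') ∈ p.edges ∨ (l e = .inner ∨ l e = .eqv) by
    obtain ⟨b', h | h⟩ := h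
    · have := hp.label hc h
      rw [he] at this
      cases b <;> cases b' <;> simp_all [EdgeLabel.ofBool]
    · cases b <;> simp_all [EdgeLabel.ofBool]
  obtain ⟨k, x, y⟩ := p
  cases k <;> simp only [Piece.Fits, Piece.cells, Finset.mem_insert,
    Finset.mem_singleton] at hp ht
  case upTri b' =>
    subst ht
    refine ⟨b', Or.inl ?_⟩
    simp only [UnitTriangle.edges, Finset.mem_insert, Finset.mem_singleton] at het
    rcases het with rfl | rfl | rfl <;> simp [Piece.edges]
  case downTri b' =>
    subst ht
    refine ⟨b', Or.inl ?_⟩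
    simp only [UnitTriangle.edges, Finset.mem_insert, Finset.mem_singleton] at het
    rcases het with rfl | rfl | rfl <;> simp [Piece.edges]
  all_goals
    rcases ht with rfl | rfl <;>
    simp only [UnitTriangle.edges, Finset.mem_insert, Finset.mem_singleton] at het <;>
    rcases het with rfl | rfl | rfl <;> simp [Piece.edges, hp]

theorem up_mem_cells {a b : ℤ} {p : Piece} (h : .up a b ∈ p.cells) :
    (∃ c, p = ⟨.upTri c, a, b⟩) ∨ p = ⟨.horOne, a, b⟩ ∨ p = ⟨.backOne, a - 1, b⟩ ∨
      p = ⟨.slashOne, a, b - 1⟩ ∨ p = ⟨.equivariant, a, b - 1⟩ := by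
  obtain ⟨k, x, y⟩ := p
  cases k <;> simp [Piece.cells] at h ⊢ <;> omega

theorem down_mem_cells {a b : ℤ} {p : Piece} (h : .down a b ∈ p.cells) :
    (∃ c, p = ⟨.downTri c, a, b⟩) ∨ p = ⟨.horOne, a, b⟩ ∨ p = ⟨.backOne, a, b⟩ ∨
      p = ⟨.slashOne, a, b⟩ ∨ p = ⟨.equivariant, a, b⟩ := by
  obtain ⟨k, x, y⟩ := p
  cases k <;> simp [Piece.cells] at h ⊢ <;> omega

/-- Two fitting pieces that cover the same unit triangle agree. -/
theorem Piece.Fits.unique {l : Edge → EdgeLabel} {p q : Piece} (hp : p.Fits l) (hq : q.Fits l)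
    {t : UnitTriangle} (hl : t.IsLabeled l) (htp : t ∈ p.cells) (htq : t ∈ q.cells) : p = q := by
  cases t with
  | up a b =>
    simp only [UnitTriangle.IsLabeled] at hl
    generalize h1 : l (.hor a b) = u at hl
    generalize h2 : l (.slash a b) = v at hl
    generalize h3 : l (.back a b) = w at hl
    rcases up_mem_cells htp with ⟨c, rfl⟩ | rfl | rfl | rfl | rfl <;>
    rcases up_mem_cells htq with ⟨c', rfl⟩ | rfl | rfl | rfl | rfl <;>
    (try rfl) <;>
    simp only [Piece.Fits, h1, h2, h3, sub_add_cancel] at hp hq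
    · rw [EdgeLabel.ofBool_injective (hp.1.symm.trans hq.1)]
    all_goals
      cases hl <;> (try cases c) <;> (try cases c') <;>
        simp [EdgeLabel.ofBool] at hp hq
  | down a b =>
    simp only [UnitTriangle.IsLabeled] at hl
    generalize h1 : l (.hor a (b + 1)) = u at hl
    generalize h2 : l (.slash (a + 1) b) = v at hl
    generalize h3 : l (.back a b) = w at hl
    rcases down_mem_cells htp with ⟨c, rfl⟩ | rfl | rfl | rfl | rfl <;>
    rcases down_mem_cells htq with ⟨c', rfl⟩ | rfl | rfl | rfl | rfl <;>
    (try rfl) <;>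
    simp only [Piece.Fits, h1, h2, h3] at hp hq
    · rw [EdgeLabel.ofBool_injective (hp.1.symm.trans hq.1)]
    all_goals
      cases hl <;> (try cases c) <;> (try cases c') <;>
        simp [EdgeLabel.ofBool] at hp hq

/-- Every labeled unit triangle is covered by a fitting piece. -/
theorem exists_fits {l : Edge → EdgeLabel} {t : UnitTriangle} (hl : t.IsLabeled l) :
    ∃ p : Piece, p.Fits l ∧ t ∈ p.cells := by
  cases t with
  | up a b =>
    simp only [UnitTriangle.IsLabeled] at hl
    generalize h1 : l (.hor a b) = u at hl
    generalize h2 : l (.slash a b) = v at hl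
    generalize h3 : l (.back a b) = w at hl
    cases hl
    · exact ⟨⟨.upTri false, a, b⟩, ⟨h1, h2, h3⟩, by simp [Piece.cells]⟩
    · exact ⟨⟨.upTri true, a, b⟩, ⟨h1, h2, h3⟩, by simp [Piece.cells]⟩
    · exact ⟨⟨.horOne, a, b⟩, h3, by simp [Piece.cells]⟩
    · exact ⟨⟨.backOne, a - 1, b⟩, by simpa [Piece.Fits] using h2, by simp [Piece.cells]⟩
    · exact ⟨⟨.slashOne, a, b - 1⟩, by simpa [Piece.Fits] using h1, by simp [Piece.cells]⟩
    · exact ⟨⟨.equivariant, a, b - 1⟩, by simpa [Piece.Fits] using h1, by simp [Piece.cells]⟩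
  | down a b =>
    simp only [UnitTriangle.IsLabeled] at hl
    generalize h1 : l (.hor a (b + 1)) = u at hl
    generalize h2 : l (.slash (a + 1) b) = v at hl
    generalize h3 : l (.back a b) = w at hl
    cases hl
    · exact ⟨⟨.downTri false, a, b⟩, ⟨h1, h2, h3⟩, by simp [Piece.cells]⟩
    · exact ⟨⟨.downTri true, a, b⟩, ⟨h1, h2, h3⟩, by simp [Piece.cells]⟩
    · exact ⟨⟨.horOne, a, b⟩, h3, by simp [Piece.cells]⟩
    · exact ⟨⟨.backOne, a, b⟩, h2, by simp [Piece.cells]⟩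
    · exact ⟨⟨.slashOne, a, b⟩, h1, by simp [Piece.cells]⟩
    · exact ⟨⟨.equivariant, a, b⟩, h1, by simp [Piece.cells]⟩

/-- All kinds of pieces. -/
def allPieceKinds : Finset PieceKind :=
  {.upTri true, .upTri false, .downTri true, .downTri false, .horOne, .backOne, .slashOne,
    .equivariant}

open scoped Classical in
/-- The fitting pieces in the region of height `h`. -/
noncomputable def labelPieces (n h : ℕ) (l : Edge → EdgeLabel) : Finset Piece :=
  ((allPieceKinds ×ˢ Finset.Icc (0 : ℤ) n ×ˢ Finset.Icc (-(h : ℤ)) n).image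
    fun q => (⟨q.1, q.2.1, q.2.2⟩ : Piece)).filter
      fun p => (∀ t ∈ p.cells, t.Inside (puzzleRegion n h)) ∧ p.Fits l

theorem mem_labelPieces {n h : ℕ} {l : Edge → EdgeLabel} {p : Piece} :
    p ∈ labelPieces n h l ↔ (∀ t ∈ p.cells, t.Inside (puzzleRegion n h)) ∧ p.Fits l := by
  simp only [labelPieces, Finset.mem_filter, and_iff_right_iff_imp]
  rintro ⟨hp, -⟩
  obtain ⟨k, x, y⟩ := p
  simp only [Finset.mem_image, Finset.mem_product, Finset.mem_Icc]
  refine ⟨(k, x, y), ⟨?_, ?_⟩, rfl⟩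
  · cases k <;> simp [allPieceKinds]
  · cases k <;> simp only [Piece.cells, Finset.mem_insert, Finset.mem_singleton,
      forall_eq_or_imp, forall_eq, inside_up, inside_down] at hp <;> (constructor <;> constructor <;> simp only <;> omega)

/-- The labels are admissible on the region of height `h`, and no rhombus crosses its boundary. -/
structure IsLabeling (n h : ℕ) (l : Edge → EdgeLabel) : Prop where
  labeled : ∀ t : UnitTriangle, t.Inside (puzzleRegion n h) → t.IsLabeled l
  northEast : ∀ x : ℤ, 0 ≤ x → x < n → l (.back x (n - 1 - x)) ≠ .inner
  west : 0 < n → ∀ y : ℤ, -(h : ℤ) ≤ y → y < n → l (.slash 0 y) ≠ .inner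
  east : 0 < n → ∀ y : ℤ, -(h : ℤ) ≤ y → y < 0 → l (.slash n y) ≠ .inner
  south_inner : ∀ x : ℤ, 0 ≤ x → x < n → l (.hor x (-(h : ℤ))) ≠ .inner
  south_eqv : ∀ x : ℤ, 0 ≤ x → x < n → l (.hor x (-(h : ℤ))) ≠ .eqv

/-- A fitting piece that covers a unit triangle of the region lies in the region. -/
theorem IsLabeling.inside {n h : ℕ} {l : Edge → EdgeLabel} (H : IsLabeling n h l) {p : Piece}
    (hp : p.Fits l) {t : UnitTriangle} (ht : t.Inside (puzzleRegion n h)) (htp : t ∈ p.cells) :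
    ∀ t ∈ p.cells, t.Inside (puzzleRegion n h) := by
  obtain ⟨k, x, y⟩ := p
  cases k <;> simp only [Piece.cells, Piece.Fits, Finset.mem_insert, Finset.mem_singleton,
    forall_eq_or_imp, forall_eq] at hp htp ⊢
  · exact htp ▸ ht
  · exact htp ▸ ht
  · rcases htp with rfl | rfl <;> simp only [inside_up, inside_down] at ht ⊢
    · have : x + y + 1 ≠ n := fun h' => H.northEast x (by omega) (by omega) (by
        rw [← hp]; congr 2; omega)
      omega
    · omega
  · rcases htp with rfl | rfl <;> simp only [inside_up, inside_down] at ht ⊢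
    · have : x + 1 ≠ n := fun h' => H.east (by omega) y (by omega) (by omega) (by
        rw [← hp]; congr 2; omega)
      omega
    · have : x + 1 ≠ 0 := fun h' => H.west (by omega) y (by omega) (by omega) (by
        rw [← hp]; congr 2; omega)
      omega
  · rcases htp with rfl | rfl <;> simp only [inside_up, inside_down] at ht ⊢
    · omega
    · have : y + 1 ≠ -(h : ℤ) := fun h' => H.south_inner x (by omega) (by omega) (by
        rw [← hp]; congr 2; omega)
      omega
  · rcases htp with rfl | rfl <;> simp only [inside_up, inside_down] at ht ⊢
    · omega
    · have : y + 1 ≠ -(h : ℤ) := fun h' => H.south_eqv x (by omega) (by omega) (by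
        rw [← hp]; congr 2; omega)
      omega

theorem IsLabeling.existsUnique {n h : ℕ} {l : Edge → EdgeLabel} (H : IsLabeling n h l)
    {t : UnitTriangle} (ht : t.Inside (puzzleRegion n h)) :
    ∃! p, p ∈ labelPieces n h l ∧ t ∈ p.cells := by
  obtain ⟨p, hp, htp⟩ := exists_fits (H.labeled t ht)
  refine ⟨p, ⟨mem_labelPieces.2 ⟨H.inside hp ht htp, hp⟩, htp⟩, ?_⟩
  rintro q ⟨hq, htq⟩
  exact (mem_labelPieces.1 hq).2.unique hp (H.labeled t ht) htq htp

theorem IsLabeling.label {n h : ℕ} {l : Edge → EdgeLabel} (H : IsLabeling n h l) {p : Piece}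
    (hp : p ∈ labelPieces n h l) {e : Edge} {b : Bool} (he : (e, b) ∈ p.edges) :
    l e = .ofBool b := by
  rw [mem_labelPieces] at hp
  exact hp.2.label (fun t ht => H.labeled t (hp.1 t ht)) he

theorem IsLabeling.isPartitioning {n h : ℕ} {l : Edge → EdgeLabel} (H : IsLabeling n h l) :
    IsPartitioning (puzzleRegion n h) (labelPieces n h l) :=
  ⟨fun _ hp => (mem_labelPieces.1 hp).1, fun _ ht => H.existsUnique ht,
    fun _ hp _ hq _ _ _ he he' => EdgeLabel.ofBool_injective
      ((H.label hp he).symm.trans (H.label hq he'))⟩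

theorem IsLabeling.hasLabel_iff {n h : ℕ} {l : Edge → EdgeLabel} (H : IsLabeling n h l)
    {t : UnitTriangle} (ht : t.Inside (puzzleRegion n h)) {e : Edge} (he : e ∈ t.edges)
    {b : Bool} : HasLabel (labelPieces n h l) e b ↔ l e = .ofBool b := by
  constructor
  · rintro ⟨p, hp, hpe⟩
    exact H.label hp hpe
  · intro hl
    obtain ⟨p, ⟨hp, htp⟩, -⟩ := H.existsUnique ht
    have hp' := mem_labelPieces.1 hp
    exact ⟨p, hp, hp'.2.mem_edges (fun t ht => H.labeled t (hp'.1 t ht)) htp he hl⟩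

/-! ### The edge labeling of a partitioning -/

theorem edge_hor_mem {t : UnitTriangle} {x y : ℤ} :
    .hor x y ∈ t.edges ↔ t = .up x y ∨ t = .down x (y - 1) := by
  cases t <;> simp [UnitTriangle.edges] <;> omega

theorem edge_slash_mem {t : UnitTriangle} {x y : ℤ} :
    .slash x y ∈ t.edges ↔ t = .up x y ∨ t = .down (x - 1) y := by
  cases t <;> simp [UnitTriangle.edges] <;> omega

theorem edge_back_mem {t : UnitTriangle} {x y : ℤ} :
    .back x y ∈ t.edges ↔ t = .up x y ∨ t = .down x y := by
  cases t <;> simp [UnitTriangle.edges] <;> omega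

/-- An edge of a covered unit triangle is a boundary edge of the piece, or both adjacent triangles
are covered by the piece. -/
theorem Piece.mem_edges_or {p : Piece} {t : UnitTriangle} (ht : t ∈ p.cells) {e : Edge}
    (he : e ∈ t.edges) : (∃ b, (e, b) ∈ p.edges) ∨ ∀ t' : UnitTriangle, e ∈ t'.edges →
      t' ∈ p.cells := by
  obtain ⟨k, x, y⟩ := p
  cases k <;> simp only [Piece.cells, Finset.mem_insert, Finset.mem_singleton] at ht ⊢
  case upTri =>
    subst ht
    left
    simp only [UnitTriangle.edges, Finset.mem_insert, Finset.mem_singleton] at he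
    rcases he with rfl | rfl | rfl <;> simp [Piece.edges]
  case downTri =>
    subst ht
    left
    simp only [UnitTriangle.edges, Finset.mem_insert, Finset.mem_singleton] at he
    rcases he with rfl | rfl | rfl <;> simp [Piece.edges]
  all_goals
    rcases ht with rfl | rfl <;>
    simp only [UnitTriangle.edges, Finset.mem_insert, Finset.mem_singleton] at he <;>
    rcases he with rfl | rfl | rfl <;>
    simp [Piece.edges, edge_hor_mem, edge_slash_mem, edge_back_mem]

/-- A boundary edge of a piece is an edge of a covered unit triangle. -/
theorem Piece.exists_cell {p : Piece} {e : Edge} {b : Bool} (he : (e, b) ∈ p.edges) :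
    ∃ t ∈ p.cells, e ∈ t.edges := by
  obtain ⟨k, x, y⟩ := p
  cases k <;> simp only [Piece.edges, Finset.mem_insert, Finset.mem_singleton,
    Prod.mk.injEq] at he
  case upTri => exact ⟨.up x y, by simp [Piece.cells], by
    rcases he with ⟨rfl, -⟩ | ⟨rfl, -⟩ | ⟨rfl, -⟩ <;> simp [UnitTriangle.edges]⟩
  case downTri => exact ⟨.down x y, by simp [Piece.cells], by
    rcases he with ⟨rfl, -⟩ | ⟨rfl, -⟩ | ⟨rfl, -⟩ <;> simp [UnitTriangle.edges]⟩
  all_goals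
    rcases he with ⟨rfl, -⟩ | ⟨rfl, -⟩ | ⟨rfl, -⟩ | ⟨rfl, -⟩ <;>
      simp [Piece.cells, UnitTriangle.edges]

open scoped Classical in
/-- The edge labeling read off from a set of pieces. -/
noncomputable def pieceLabels (P : Finset Piece) (e : Edge) : EdgeLabel :=
  if HasLabel P e true then .one else if HasLabel P e false then .zero
  else if ∃ x y, e = .hor x (y + 1) ∧ (⟨.equivariant, x, y⟩ : Piece) ∈ P then .eqv else .inner

section

variable {n h : ℕ} {P : Finset Piece} (H : IsPartitioning (puzzleRegion n h) P)
include H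

theorem IsPartitioning.pieceLabels_of_mem {p : Piece} (hp : p ∈ P) {e : Edge} {b : Bool}
    (he : (e, b) ∈ p.edges) : pieceLabels P e = .ofBool b := by
  cases b
  · have h1 : ¬ HasLabel P e true := fun ⟨q, hq, hqe⟩ => by
      simpa using H.2.2 p hp q hq e _ _ he hqe
    have h2 : HasLabel P e false := ⟨p, hp, he⟩
    simp [pieceLabels, h1, h2, EdgeLabel.ofBool]
  · have h2 : HasLabel P e true := ⟨p, hp, he⟩
    simp [pieceLabels, h2, EdgeLabel.ofBool]

theorem IsPartitioning.eq_of_mem_cells {p q : Piece} (hp : p ∈ P) (hq : q ∈ P)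
    {t : UnitTriangle} (htp : t ∈ p.cells) (htq : t ∈ q.cells) : p = q :=
  (H.2.1 t (H.1 p hp t htp)).unique ⟨hp, htp⟩ ⟨hq, htq⟩

theorem IsPartitioning.not_hasLabel {p : Piece} (hp : p ∈ P) {t : UnitTriangle}
    (ht : t ∈ p.cells) {e : Edge} (he : e ∈ t.edges) (hpe : ∀ b, (e, b) ∉ p.edges) (b : Bool) :
    ¬ HasLabel P e b := by
  rintro ⟨q, hq, hqe⟩
  obtain ⟨t', ht', het'⟩ := q.exists_cell hqe
  rcases p.mem_edges_or ht he with ⟨b', hb'⟩ | h'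
  · exact hpe _ hb'
  · rw [← H.eq_of_mem_cells hp hq (h' t' het') ht'] at hqe
    exact hpe _ hqe

theorem IsPartitioning.pieceLabels_interior {p : Piece} (hp : p ∈ P) {t : UnitTriangle}
    (ht : t ∈ p.cells) {e : Edge} (he : e ∈ t.edges) (hpe : ∀ b, (e, b) ∉ p.edges) :
    pieceLabels P e = if p.kind = .equivariant then .eqv else .inner := by
  have h1 := H.not_hasLabel hp ht he hpe true
  have h2 := H.not_hasLabel hp ht he hpe false
  have h3 : (∃ x y, e = .hor x (y + 1) ∧ (⟨.equivariant, x, y⟩ : Piece) ∈ P) ↔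
      p.kind = .equivariant := by
    constructor
    · rintro ⟨x, y, rfl, hq⟩
      rcases p.mem_edges_or ht he with ⟨b', hb'⟩ | h'
      · exact absurd hb' (hpe _)
      · rw [H.eq_of_mem_cells hp hq (h' (.up x (y + 1)) (by simp [edge_hor_mem]))
          (by simp [Piece.cells])]
    · intro hk
      obtain ⟨k, x, y⟩ := p
      obtain rfl : k = .equivariant := hk
      refine ⟨x, y, ?_, hp⟩
      simp only [Piece.cells, Piece.edges, Finset.mem_insert, Finset.mem_singleton] at ht hpe
      rcases ht with rfl | rfl <;>
        simp only [UnitTriangle.edges, Finset.mem_insert, Finset.mem_singleton] at he <;>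
        rcases he with rfl | rfl | rfl <;> simp at hpe <;> rfl
  simp only [pieceLabels, h1, h2, h3, if_false]

theorem IsPartitioning.fits {p : Piece} (hp : p ∈ P) : p.Fits (pieceLabels P) := by
  obtain ⟨k, x, y⟩ := p
  have h1 : ∀ e b, (e, b) ∈ Piece.edges ⟨k, x, y⟩ → pieceLabels P e = .ofBool b :=
    fun e b => H.pieceLabels_of_mem hp
  have h2 : ∀ t ∈ Piece.cells ⟨k, x, y⟩, ∀ e ∈ t.edges,
      (∀ b, (e, b) ∉ Piece.edges ⟨k, x, y⟩) →
      pieceLabels P e = if k = .equivariant then .eqv else .inner :=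
    fun t ht e => H.pieceLabels_interior hp ht
  cases k
  case upTri b => exact ⟨h1 _ _ (by simp [Piece.edges]), h1 _ _ (by simp [Piece.edges]),
      h1 _ _ (by simp [Piece.edges])⟩
  case downTri b => exact ⟨h1 _ _ (by simp [Piece.edges]), h1 _ _ (by simp [Piece.edges]),
      h1 _ _ (by simp [Piece.edges])⟩
  all_goals
    simp only [Piece.Fits]
    rw [h2 (.down x y) (by simp [Piece.cells]) _ (by simp [UnitTriangle.edges])
      (by simp [Piece.edges])]
    simp

theorem IsPartitioning.isLabeled {t : UnitTriangle} (ht : t.Inside (puzzleRegion n h)) :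
    t.IsLabeled (pieceLabels P) := by
  obtain ⟨p, ⟨hp, htp⟩, -⟩ := H.2.1 t ht
  have h1 : ∀ e b, (e, b) ∈ p.edges → pieceLabels P e = .ofBool b :=
    fun e b => H.pieceLabels_of_mem hp
  have h2 := H.fits hp
  cases t with
  | up a b =>
    rcases up_mem_cells htp with ⟨c, rfl⟩ | rfl | rfl | rfl | rfl <;>
    simp only [Piece.edges, Finset.mem_insert, Finset.mem_singleton, Prod.mk.injEq, or_imp,
      forall_and, Piece.Fits, sub_add_cancel, and_imp, forall_eq_apply_imp_iff, forall_eq] at h1 h2 <;>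
    simp only [UnitTriangle.IsLabeled, h1, h2]
    · cases c <;> constructor
    all_goals constructor
  | down a b =>
    rcases down_mem_cells htp with ⟨c, rfl⟩ | rfl | rfl | rfl | rfl <;>
    simp only [Piece.edges, Finset.mem_insert, Finset.mem_singleton, Prod.mk.injEq, or_imp,
      forall_and, Piece.Fits, and_imp, forall_eq_apply_imp_iff, forall_eq] at h1 h2 <;>
    simp only [UnitTriangle.IsLabeled, h1, h2]
    · cases c <;> constructor
    all_goals constructor

/-- An edge without a binary label is interior to a rhombus, which then covers the triangles on both
sides of the edge; one of these is outside the region. -/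
theorem IsPartitioning.pieceLabels_boundary {t t' : UnitTriangle}
    (ht : t.Inside (puzzleRegion n h)) (ht' : ¬ t'.Inside (puzzleRegion n h)) {e : Edge}
    (he : e ∈ t.edges) (he' : e ∈ t'.edges) : ∃ b, pieceLabels P e = .ofBool b := by
  obtain ⟨p, ⟨hp, htp⟩, -⟩ := H.2.1 t ht
  rcases p.mem_edges_or htp he with ⟨b, hb⟩ | h'
  · exact ⟨b, H.pieceLabels_of_mem hp hb⟩
  · exact absurd (H.1 p hp t' (h' t' he')) ht'

theorem IsPartitioning.isLabeling : IsLabeling n h (pieceLabels P) where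
  labeled t ht := H.isLabeled ht
  northEast x hx hx' := by
    obtain ⟨b, hb⟩ := H.pieceLabels_boundary (e := .back x (n - 1 - x))
      (t := .up x (n - 1 - x)) (t' := .down x (n - 1 - x)) (inside_up.2 (by omega))
      (by rw [inside_down]; omega) (by simp [edge_back_mem]) (by simp [edge_back_mem])
    cases b <;> simp [hb, EdgeLabel.ofBool]
  west hn y hy hy' := by
    obtain ⟨b, hb⟩ := H.pieceLabels_boundary (e := .slash 0 y)
      (t := .up 0 y) (t' := .down (0 - 1) y) (inside_up.2 (by omega))
      (by rw [inside_down]; omega) (by simp [edge_slash_mem]) (by simp [edge_slash_mem])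
    cases b <;> simp [hb, EdgeLabel.ofBool]
  east hn y hy hy' := by
    obtain ⟨b, hb⟩ := H.pieceLabels_boundary (e := .slash n y)
      (t := .down (n - 1) y) (t' := .up n y) (inside_down.2 (by omega))
      (by rw [inside_up]; omega) (by simp [edge_slash_mem]) (by simp [edge_slash_mem])
    cases b <;> simp [hb, EdgeLabel.ofBool]
  south_inner x hx hx' := by
    obtain ⟨b, hb⟩ := H.pieceLabels_boundary (e := .hor x (-(h : ℤ)))
      (t := .up x (-h)) (t' := .down x (-h - 1)) (inside_up.2 (by omega))
      (by rw [inside_down]; omega) (by simp [edge_hor_mem]) (by simp [edge_hor_mem])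
    cases b <;> simp [hb, EdgeLabel.ofBool]
  south_eqv x hx hx' := by
    obtain ⟨b, hb⟩ := H.pieceLabels_boundary (e := .hor x (-(h : ℤ)))
      (t := .up x (-h)) (t' := .down x (-h - 1)) (inside_up.2 (by omega))
      (by rw [inside_down]; omega) (by simp [edge_hor_mem]) (by simp [edge_hor_mem])
    cases b <;> simp [hb, EdgeLabel.ofBool]

/-- A partitioning consists of the pieces that fit its edge labels. -/
theorem IsPartitioning.eq_labelPieces : P = labelPieces n h (pieceLabels P) := by
  ext p
  rw [mem_labelPieces]
  refine ⟨fun hp => ⟨H.1 p hp, H.fits hp⟩, fun ⟨hp, hf⟩ => ?_⟩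
  obtain ⟨t, ht⟩ : ∃ t, t ∈ p.cells := by
    obtain ⟨k, x, y⟩ := p
    cases k <;> simp [Piece.cells]
  obtain ⟨q, ⟨hq, htq⟩, -⟩ := H.2.1 t (hp t ht)
  rwa [hf.unique (H.fits hq) (H.isLabeled (hp t ht)) ht htq]

end

/-! ### Path systems -/

/-- A system of `d` paths in the strips `0, 1, …` between consecutive lines parallel to the NE
side.  `x i j` is the position of the path `i` on the line `j` and `u i j` the number of upward
pointing 1-triangles on the path `i` before this line. -/
structure IsPathSystem (d n : ℕ) (u : ℕ → ℕ → ℕ) (x : ℕ → ℕ → ℤ) : Prop where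
  u_zero : ∀ i, u i 0 = 0
  u_last : ∀ i j, d ≤ i → u i j = 0
  u_mono : ∀ i j, u i j ≤ u i (j + 1)
  -- Interlacing of the triangles of neighbouring paths. With `u_mono` and `u_step` this forces `u i
  -- j - u (i + 1) j` to be `0` or `1`, the two possible states of a path on a line.
  u_le : ∀ i j, u (i + 1) j ≤ u i j
  u_step : ∀ i j, u i (j + 1) ≤ u (i + 1) j + 1
  -- From line `n` on, path `i` has passed its `d - i` triangles, so all consecutive differences are
  -- `1` and every path runs vertically.
  u_final : ∀ i j, n ≤ j → u i j = d - i
  -- A fixed junk value, so that a path system can be recovered as an equality of functions.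
  x_off : ∀ i j, d ≤ i → x i j = 0
  x_step : ∀ i j, i < d →
    x i (j + 1) = x i j ∨ (x i (j + 1) = x i j - 1 ∧ u i (j + 1) = u (i + 1) j)
  x_lt : ∀ i j, i + 1 < d → x i j < x (i + 1) j
  x_nonneg : ∀ i j, i < d → 0 ≤ x i j
  x_lt_n : ∀ i j, i < d → x i j < n

section labels

variable (d : ℕ) (u : ℕ → ℕ → ℕ) (x : ℕ → ℕ → ℤ) (a : ℤ) (j : ℕ)

/-- The first path weakly to the right of the position `a` contains an upward pointing 1-triangle
in the strip `j`. -/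
def IsBeam : Prop := ∃ i < d, (∀ i' < i, x i' j < a) ∧ a ≤ x i j ∧ u i (j + 1) ≠ u i j

open scoped Classical in
/-- The labels of the back edges on the line `j`. -/
noncomputable def backLabel : EdgeLabel :=
  if ∃ i < d, x i j = a ∧ u i j = u (i + 1) j then .one
  else if ∃ i < d, x i j = a then .inner else .zero

open scoped Classical in
/-- The labels of the slash edges in the strip `j`. -/
noncomputable def slashLabel : EdgeLabel :=
  if ∃ i < d, x i j = a ∧ x i (j + 1) ≠ a then .inner
  else if IsBeam d u x a j then .one else .zero

open scoped Classical in
/-- The labels of the horizontal edges in the strip `j`. -/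
noncomputable def horLabel : EdgeLabel :=
  if ∃ i < d, x i j = a ∧ u i (j + 1) ≠ u (i + 1) j then .one
  else if ∃ i < d, x i j = a ∧ x i (j + 1) = a then .eqv
  else if ∃ i < d, x i j = a then .zero
  else if IsBeam d u x a j then .inner else .zero

end labels

/-- The edge labeling of a path system. -/
noncomputable def pathLabels (d n : ℕ) (u : ℕ → ℕ → ℕ) (x : ℕ → ℕ → ℤ) : Edge → EdgeLabel
  | .hor a b => horLabel d u x a ((n : ℤ) - 1 - a - b).toNat
  | .slash a b => slashLabel d u x a ((n : ℤ) - 1 - a - b).toNat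
  | .back a b => backLabel d u x a ((n : ℤ) - 1 - a - b).toNat

namespace IsPathSystem

variable {d n : ℕ} {u : ℕ → ℕ → ℕ} {x : ℕ → ℕ → ℤ} (S : IsPathSystem d n u x)
include S

theorem x_strictMono {i i' : ℕ} (j : ℕ) (h : i < i') (hi' : i' < d) : x i j < x i' j := by
  induction i', h using Nat.le_induction with
  | base => exact S.x_lt i j hi'
  | succ k hk ih => exact (ih (by omega)).trans (S.x_lt k j hi')

theorem x_mono {i i' : ℕ} (j : ℕ) (h : i ≤ i') (hi' : i' < d) : x i j ≤ x i' j := by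
  rcases h.eq_or_lt with rfl | h
  · exact le_rfl
  · exact (S.x_strictMono j h hi').le

theorem x_inj {i i' j : ℕ} (hi : i < d) (hi' : i' < d) (h : x i j = x i' j) : i = i' := by
  rcases lt_trichotomy i i' with h' | h' | h'
  · exact absurd h (S.x_strictMono j h' hi').ne
  · exact h'
  · exact absurd h (S.x_strictMono j h' hi).ne'

/-- Distinct paths have distinct positions on a line, so the existential conditions in the labels
can be evaluated on the one path at the given position. -/
theorem exists_at_iff {i j : ℕ} (hi : i < d) (p : ℕ → Prop) :
    (∃ i' < d, x i' j = x i j ∧ p i') ↔ p i :=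
  ⟨fun ⟨_, h1, h2, h3⟩ => S.x_inj h1 hi h2 ▸ h3, fun h => ⟨i, hi, rfl, h⟩⟩

theorem isBeam_at {i j : ℕ} (hi : i < d) : IsBeam d u x (x i j) j ↔ u i (j + 1) ≠ u i j := by
  constructor
  · rintro ⟨k, hk, h1, h2, h3⟩
    rcases lt_trichotomy k i with h | rfl | h
    · exact absurd (S.x_strictMono j h hi) (by omega)
    · exact h3
    · exact absurd (h1 i h) (lt_irrefl _)
  · exact fun h => ⟨i, hi, fun k hk => S.x_strictMono j hk hi, le_rfl, h⟩

/-- Just to the right of path `i` the first path is path `i + 1`. If there is none, both sides are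
false because `u d` vanishes identically. -/
theorem isBeam_at_succ {i j : ℕ} (hi : i < d) :
    IsBeam d u x (x i j + 1) j ↔ u (i + 1) (j + 1) ≠ u (i + 1) j := by
  constructor
  · rintro ⟨k, hk, h1, h2, h3⟩
    rcases lt_trichotomy k (i + 1) with h | rfl | h
    · exact absurd (S.x_mono j (Nat.lt_succ_iff.1 h) hi) (by omega)
    · exact h3
    · have := h1 (i + 1) h
      have := S.x_lt i j (h.trans hk)
      omega
  · intro h
    have hi' : i + 1 < d := by
      by_contra h'
      exact h (by rw [S.u_last _ _ (by omega), S.u_last _ _ (by omega)])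
    refine ⟨i + 1, hi', fun k hk => ?_, S.x_lt i j hi', h⟩
    have := S.x_mono j (Nat.lt_succ_iff.1 hk) hi
    omega

-- A beam passes unchanged over a position not occupied by a path.
omit S in
theorem isBeam_succ_iff {a : ℤ} {j : ℕ} (ha : ∀ i < d, x i j ≠ a) :
    IsBeam d u x (a + 1) j ↔ IsBeam d u x a j := by
  refine exists_congr fun i => and_congr_right fun hi => ?_
  have h1 := ha i hi
  have h2 : (∀ i' < i, x i' j < a + 1) ↔ ∀ i' < i, x i' j < a :=
    forall_congr' fun k => forall_congr' fun hk => by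
      have := ha k (by omega)
      omega
  rw [h2]
  have h3 : a + 1 ≤ x i j ↔ a ≤ x i j := by omega
  rw [h3]

theorem backLabel_at {i j : ℕ} (hi : i < d) :
    backLabel d u x (x i j) j = if u i j = u (i + 1) j then .one else .inner := by
  have h1 := S.exists_at_iff (j := j) hi fun i => u i j = u (i + 1) j
  have h2 : ∃ i' < d, x i' j = x i j := ⟨i, hi, rfl⟩
  simp only [backLabel, h1, h2, if_true]

theorem slashLabel_at {i j : ℕ} (hi : i < d) :
    slashLabel d u x (x i j) j = if x i (j + 1) ≠ x i j then .inner else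
      if u i (j + 1) ≠ u i j then .one else .zero := by
  have h1 := S.exists_at_iff (j := j) hi fun i' => x i' (j + 1) ≠ x i j
  simp only [slashLabel, h1, S.isBeam_at hi]

theorem horLabel_at {i j : ℕ} (hi : i < d) :
    horLabel d u x (x i j) j = if u i (j + 1) ≠ u (i + 1) j then .one else
      if x i (j + 1) = x i j then .eqv else .zero := by
  have h1 := S.exists_at_iff (j := j) hi fun i => u i (j + 1) ≠ u (i + 1) j
  have h2 := S.exists_at_iff (j := j) hi fun i' => x i' (j + 1) = x i j
  have h3 : ∃ i' < d, x i' j = x i j := ⟨i, hi, rfl⟩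
  simp only [horLabel, h1, h2, h3, if_true]

omit S in
theorem backLabel_none {a : ℤ} {j : ℕ} (ha : ∀ i < d, x i j ≠ a) :
    backLabel d u x a j = .zero := by
  have h1 : ¬ ∃ i < d, x i j = a ∧ u i j = u (i + 1) j := fun ⟨i, hi, h, _⟩ => ha i hi h
  have h2 : ¬ ∃ i < d, x i j = a := fun ⟨i, hi, h⟩ => ha i hi h
  simp only [backLabel, h1, h2, if_false]

open scoped Classical in
omit S in
theorem slashLabel_none {a : ℤ} {j : ℕ} (ha : ∀ i < d, x i j ≠ a) :
    slashLabel d u x a j = if IsBeam d u x a j then .one else .zero := by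
  have h1 : ¬ ∃ i < d, x i j = a ∧ x i (j + 1) ≠ a := fun ⟨i, hi, h, _⟩ => ha i hi h
  simp only [slashLabel, h1, if_false]

open scoped Classical in
omit S in
theorem horLabel_none {a : ℤ} {j : ℕ} (ha : ∀ i < d, x i j ≠ a) :
    horLabel d u x a j = if IsBeam d u x a j then .inner else .zero := by
  have h1 : ¬ ∃ i < d, x i j = a ∧ u i (j + 1) ≠ u (i + 1) j := fun ⟨i, hi, h, _⟩ => ha i hi h
  have h2 : ¬ ∃ i < d, x i j = a ∧ x i (j + 1) = a := fun ⟨i, hi, h, _⟩ => ha i hi h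
  have h3 : ¬ ∃ i < d, x i j = a := fun ⟨i, hi, h⟩ => ha i hi h
  simp only [horLabel, h1, h2, h3, if_false]

/-- A path crossing the back edge meets an equivariant piece, an upward 1-triangle, a `horOne` or a
`backOne` rhombus, according to whether `x` moves and which of `u i j`, `u (i + 1) j`, `u i (j + 1)`
coincide. Without a path, the triangle is part of a beam or a 0-triangle. -/
theorem isTriangleLabel_up (a : ℤ) (j : ℕ) :
    IsTriangleLabel (horLabel d u x a j) (slashLabel d u x a j) (backLabel d u x a j) := by
  by_cases ha : ∃ i < d, x i j = a
  · obtain ⟨i, hi, rfl⟩ := ha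
    rw [S.horLabel_at hi, S.slashLabel_at hi, S.backLabel_at hi]
    have h1 := S.u_mono i j
    have h2 := S.u_le i j
    have h3 := S.u_step i j
    rcases S.x_step i j hi with h | ⟨h, h'⟩
    · by_cases h4 : u i (j + 1) = u (i + 1) j
      · have h5 : u i j = u (i + 1) j := by omega
        simp only [h, h4, h5, ne_eq, not_true_eq_false, if_true, if_false]
        exact .equivariant
      · by_cases h5 : u i j = u (i + 1) j
        · simp only [h, h4, h5, ne_eq, not_true_eq_false, not_false_eq_true, if_true, if_false]
          exact .ones
        · have h6 : u i (j + 1) = u i j := by omega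
          simp only [h, h6, h5, ne_eq, not_true_eq_false, not_false_eq_true, if_true, if_false]
          exact .horOne
    · have h5 : u i j = u (i + 1) j := by omega
      have h6 : x i (j + 1) ≠ x i j := by omega
      simp only [h', h6, h5, ne_eq, not_true_eq_false, not_false_eq_true, if_true, if_false]
      exact .backOne
  · have ha' : ∀ i < d, x i j ≠ a := fun i hi h => ha ⟨i, hi, h⟩
    rw [horLabel_none ha', slashLabel_none ha', backLabel_none ha']
    split_ifs
    · exact .slashOne
    · exact .zeros

/-- The lower half of a strip contains either a path arriving from `a + 1`, or the continuation of
the path at `a`, or no path. Compatibility with the right slash edge is the matching of upward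
triangles on path `i + 1` with downward triangles on path `i`. -/
theorem isTriangleLabel_down (a : ℤ) (j : ℕ) :
    IsTriangleLabel (horLabel d u x a j) (slashLabel d u x (a + 1) j)
      (backLabel d u x a (j + 1)) := by
  by_cases hW : ∃ i < d, x i j = a + 1 ∧ x i (j + 1) ≠ a + 1
  · obtain ⟨i, hi, h1, h2⟩ := hW
    rcases S.x_step i j hi with h | ⟨h, h'⟩
    · omega
    have h3 : a = x i (j + 1) := by omega
    have h4 := S.u_mono i j
    have h5 := S.u_le i j
    have h6 := S.u_mono (i + 1) j
    have h7 := S.u_le i (j + 1)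
    have h8 : backLabel d u x a (j + 1) = .one := by
      rw [h3, S.backLabel_at hi, if_pos (by omega)]
    have h9 : slashLabel d u x (a + 1) j = .inner := by
      rw [← h1, S.slashLabel_at hi, if_pos (by omega)]
    -- A path already at `a` has to move west as well, since otherwise it would meet path `i` on
    -- line `j + 1`. If there is none, no beam runs here, since path `i` has no triangle in this
    -- strip.
    have h10 : horLabel d u x a j = .zero := by
      by_cases ha : ∃ k < d, x k j = a
      · obtain ⟨k, hk, rfl⟩ := ha
        rcases S.x_step k j hk with h' | ⟨h', h''⟩
        · have := S.x_inj hk hi (h'.trans h3)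
          subst this
          omega
        · rw [S.horLabel_at hk, if_neg (by simpa using h''), if_neg (by omega)]
      · have ha' : ∀ i < d, x i j ≠ a := fun i hi h => ha ⟨i, hi, h⟩
        rw [horLabel_none ha', if_neg]
        rw [← isBeam_succ_iff ha', ← h1, S.isBeam_at hi]
        omega
    rw [h8, h9, h10]
    exact .backOne
  · have hG : slashLabel d u x (a + 1) j =
        open scoped Classical in if IsBeam d u x (a + 1) j then .one else .zero := by
      rw [slashLabel, if_neg hW]
    rw [hG]
    by_cases ha : ∃ i < d, x i j = a
    · obtain ⟨i, hi, rfl⟩ := ha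
      have h1 := S.u_mono i j
      have h2 := S.u_le i j
      have h3 := S.u_step i j
      have h4 := S.u_mono (i + 1) j
      have h5 := S.u_le i (j + 1)
      rw [S.horLabel_at hi]
      simp only [S.isBeam_at_succ hi]
      rcases S.x_step i j hi with h | ⟨h, h'⟩
      · rw [← h, S.backLabel_at hi]
        by_cases h6 : u i (j + 1) = u (i + 1) j
        · have h7 : u (i + 1) (j + 1) = u (i + 1) j := by omega
          simp only [h6, h7, ne_eq, not_true_eq_false, if_true, if_false]
          exact .equivariant
        · by_cases h7 : u (i + 1) (j + 1) = u (i + 1) j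
          · simp only [h6, h7, ne_eq, not_true_eq_false, not_false_eq_true, if_true, if_false]
            exact .horOne
          · have h8 : u i (j + 1) = u (i + 1) (j + 1) := by
              have := S.u_step (i + 1) j
              omega
            simp only [h7, h8, ne_eq, not_false_eq_true, if_true]
            exact .ones
      · have h7 : u (i + 1) (j + 1) = u (i + 1) j := by omega
        have h8 : x i (j + 1) ≠ x i j := by omega
        have h9 : backLabel d u x (x i j) (j + 1) = .zero := by
          refine backLabel_none fun k hk hk' => ?_
          rcases S.x_step k j hk with h' | ⟨h', h''⟩
          · have := S.x_inj hk hi (h'.symm.trans hk')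
            subst this
            omega
          · exact hW ⟨k, hk, by omega, by omega⟩
        simp only [h', h7, h8, h9, ne_eq, not_true_eq_false, if_false]
        exact .zeros
    · have ha' : ∀ i < d, x i j ≠ a := fun i hi h => ha ⟨i, hi, h⟩
      rw [horLabel_none ha', backLabel_none]
      · by_cases hb : IsBeam d u x a j
        · rw [if_pos hb, if_pos ((isBeam_succ_iff ha').2 hb)]
          exact .slashOne
        · rw [if_neg hb, if_neg fun h => hb ((isBeam_succ_iff ha').1 h)]
          exact .zeros
      · intro k hk hk'
        rcases S.x_step k j hk with h' | ⟨h', h''⟩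
        · exact ha' k hk (h'.symm.trans hk')
        · exact hW ⟨k, hk, by omega, by omega⟩

/-- The labels of a path system are admissible on all unit triangles south-west of the NE side. -/
theorem isLabeled_up {a b : ℤ} : (UnitTriangle.up a b).IsLabeled (pathLabels d n u x) :=
  S.isTriangleLabel_up a _

/-- The bound makes the strip index of the horizontal edge a genuine natural number, so that
truncation by `toNat` does not identify it with that of the back edge below. -/
theorem isLabeled_down {a b : ℤ} (h : a + b + 2 ≤ n) :
    (UnitTriangle.down a b).IsLabeled (pathLabels d n u x) := by
  have := S.isTriangleLabel_down a ((n : ℤ) - 1 - a - (b + 1)).toNat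
  simp only [UnitTriangle.IsLabeled, pathLabels]
  convert this using 2 <;> omega

theorem slashLabel_of_le {a : ℤ} (ha : n ≤ a) (j : ℕ) : slashLabel d u x a j = .zero := by
  have h : ∀ i < d, x i j ≠ a := fun i hi h => by have := S.x_lt_n i j hi; omega
  rw [slashLabel_none h, if_neg]
  rintro ⟨i, hi, -, h2, -⟩
  have := S.x_lt_n i j hi
  omega

theorem isBeam_zero_iff {j : ℕ} : IsBeam d u x 0 j ↔ u 0 (j + 1) ≠ u 0 j := by
  constructor
  · rintro ⟨i, hi, h1, h2, h3⟩
    rcases Nat.eq_zero_or_pos i with rfl | h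
    · exact h3
    · have := h1 0 h
      have := S.x_nonneg 0 j (by omega)
      omega
  · intro h
    have hd : 0 < d := by
      by_contra h'
      exact h (by rw [S.u_last _ _ (by omega), S.u_last _ _ (by omega)])
    exact ⟨0, hd, by simp, S.x_nonneg 0 j hd, h⟩

theorem slashLabel_zero (j : ℕ) :
    slashLabel d u x 0 j = if u 0 (j + 1) ≠ u 0 j then .one else .zero := by
  have h1 : ¬ ∃ i < d, x i j = 0 ∧ x i (j + 1) ≠ 0 := by
    rintro ⟨i, hi, h, h'⟩
    have := S.x_nonneg i (j + 1) hi
    rcases S.x_step i j hi with h2 | ⟨h2, -⟩ <;> omega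
  simp only [slashLabel, h1, if_false, S.isBeam_zero_iff]

theorem backLabel_zero_ne (a : ℤ) : backLabel d u x a 0 ≠ .inner := by
  by_cases ha : ∃ i < d, x i 0 = a
  · obtain ⟨i, hi, rfl⟩ := ha
    rw [S.backLabel_at hi, if_pos (by rw [S.u_zero, S.u_zero])]
    simp
  · rw [backLabel_none fun i hi h => ha ⟨i, hi, h⟩]
    simp

theorem u_succ_le (i j : ℕ) : u i (j + 1) ≤ u i j + 1 :=
  (S.u_step i j).trans (Nat.succ_le_succ (S.u_le i j))

theorem u_monotone (i : ℕ) : Monotone (u i) := monotone_nat_of_le_succ (S.u_mono i)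

theorem u_le_time (i j : ℕ) : u i j ≤ j := by
  induction j with
  | zero => exact (S.u_zero i).le
  | succ j ih => exact (S.u_succ_le i j).trans (by omega)

theorem x_antitone {i : ℕ} (hi : i < d) : Antitone (x i) :=
  antitone_nat_of_succ_le fun j => by rcases S.x_step i j hi with h | ⟨h, -⟩ <;> omega

end IsPathSystem

/-! ### Binary words -/

theorem length_partsOfWord (w : List Bool) : (partsOfWord w).length = w.count true := by
  induction w with
  | nil => rfl
  | cons b w ih => cases b <;> simp [partsOfWord, ih]

theorem count_false_add_length_partsOfWord (w : List Bool) :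
    w.count false + (partsOfWord w).length = w.length := by
  rw [length_partsOfWord, List.count_false_add_count_true]

theorem le_count_of_mem_partsOfWord {w : List Bool} {m : ℕ} (hm : m ∈ partsOfWord w) :
    m ≤ w.count false := by
  induction w with
  | nil => simp [partsOfWord] at hm
  | cons b w ih =>
    cases b
    · have := ih hm
      simp only [List.count_cons_self]
      omega
    · rcases List.mem_cons.1 hm with rfl | h
      · simp
      · simpa using ih h

/-- Length and parts determine the number of zeros. A word starting with 1 has this number as its
first part, while after an initial 0 all parts are smaller; so the first letter can be read off, and
induction applies. -/
theorem partsOfWord_injective : ∀ {w w' : List Bool}, w.length = w'.length →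
    partsOfWord w = partsOfWord w' → w = w' := by
  have key : ∀ w w' : List Bool, w.length = w'.length →
      partsOfWord (true :: w) ≠ partsOfWord (false :: w') := by
    intro w w' hl h
    have h1 := count_false_add_length_partsOfWord (true :: w)
    have h2 := count_false_add_length_partsOfWord (false :: w')
    have h3 : w.count false ≤ w'.count false := by
      apply le_count_of_mem_partsOfWord
      have : partsOfWord w' = partsOfWord (true :: w) := h.symm
      rw [this]
      simp [partsOfWord]
    rw [h] at h1
    simp only [List.length_cons] at h1 h2
    simp at h1 h2
    omega
  intro w
  induction w with
  | nil =>
    intro w' hl _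
    cases w' with
    | nil => rfl
    | cons => simp at hl
  | cons b w ih =>
    intro w' hl h
    cases w' with
    | nil => simp at hl
    | cons b' w' =>
      have hl' : w.length = w'.length := by simpa using hl
      cases b <;> cases b'
      · rw [ih hl' h]
      · exact absurd h.symm (key _ _ hl'.symm)
      · exact absurd h (key _ _ hl')
      · simp only [partsOfWord, List.cons.injEq] at h
        rw [ih hl' h.2]

/-- The parts of the word of length `m` (with positions starting from `s`) whose ones are at the
positions `p 0 < … < p (d - 1)`. -/
theorem partsOfWord_positions (m s d : ℕ) (p : ℕ → ℕ) (h1 : ∀ i < d, s ≤ p i ∧ p i < s + m)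
    (h2 : ∀ i, i + 1 < d → p i < p (i + 1)) :
    partsOfWord ((List.range' s m).map fun a => decide (∃ i < d, p i = a)) =
      (List.range d).map fun i => s + m + i - (p i + d) := by
  induction m generalizing s d p with
  | zero =>
    cases d with
    | zero => rfl
    | succ d => have := h1 0 (by omega); omega
  | succ m ih =>
    have hlt : ∀ i, 0 < i → i < d → p 0 < p i := by
      intro i hi hid
      induction i, hi using Nat.le_induction with
      | base => exact h2 0 hid
      | succ k hk ihk => exact (ihk (by omega)).trans (h2 k hid)
    rw [List.range'_succ, List.map_cons]
    by_cases h0 : ∃ i < d, p i = s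
    · obtain ⟨d, rfl⟩ : ∃ d', d = d' + 1 := ⟨d - 1, by obtain ⟨i, hi, -⟩ := h0; omega⟩
      have hp0 : p 0 = s := by
        obtain ⟨i, hi, hp⟩ := h0
        rcases Nat.eq_zero_or_pos i with rfl | h
        · exact hp
        · have := hlt i h hi
          have := h1 0 (by omega)
          omega
      have hw : (List.range' (s + 1) m).map (fun a => decide (∃ i < d + 1, p i = a)) =
          (List.range' (s + 1) m).map fun a => decide (∃ i < d, p (i + 1) = a) := by
        refine List.map_congr_left fun a ha => ?_
        rw [List.mem_range'_1] at ha
        rw [decide_eq_decide]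
        constructor
        · rintro ⟨i, hi, rfl⟩
          rcases Nat.eq_zero_or_pos i with rfl | h
          · omega
          · exact ⟨i - 1, by omega, by rw [Nat.sub_add_cancel h]⟩
        · rintro ⟨i, hi, h⟩
          exact ⟨i + 1, by omega, h⟩
      have ih' := ih (s + 1) d (fun i => p (i + 1)) (fun i hi => by
        have := h1 (i + 1) (by omega)
        have := hlt (i + 1) (by omega) (by omega)
        omega) (fun i hi => h2 (i + 1) (by omega))
      have hc := count_false_add_length_partsOfWord
        ((List.range' (s + 1) m).map fun a => decide (∃ i < d, p (i + 1) = a))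
      rw [ih'] at hc
      simp only [List.length_map, List.length_range, List.length_range'] at hc
      rw [hw, decide_eq_true h0, partsOfWord, ih', List.range_succ_eq_map, List.map_cons,
        List.map_map]
      congr 1
      -- Zeros to the right of the first one: all later positions minus the remaining ones, counted
      -- by `hc`.
      · omega
      · refine List.map_congr_left fun i _ => ?_
        simp only [Function.comp, Nat.succ_eq_add_one]
        omega
    · rw [decide_eq_false h0, partsOfWord, ih (s + 1) d p (fun i hi => by
        have := h1 i hi
        have : p i ≠ s := fun h => h0 ⟨i, hi, h⟩
        omega) h2]
      refine List.map_congr_left fun i _ => ?_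
      omega

/-- A word of length `n` corresponds to the partition `lam` if and only if its ones are at the
positions `n - d + i - lam i`. -/
theorem partsOfWord_eq_ofFn_iff {d n : ℕ} (hdn : d ≤ n) {lam : Fin d → ℕ}
    (hlam : IsBoxPartition d n lam) (b : ℕ → Bool) :
    partsOfWord ((List.range n).map b) = List.ofFn lam ↔
      ∀ a < n, b a = true ↔ ∃ i : Fin d, a + lam i = n - d + i := by
  have key : partsOfWord ((List.range n).map fun a =>
      decide (∃ i : Fin d, a + lam i = n - d + i)) = List.ofFn lam := by
    let p : ℕ → ℕ := fun i => if h : i < d then n - d + i - lam ⟨i, h⟩ else 0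
    have hp : ∀ i : Fin d, p i + lam i = n - d + i := fun i => by
      have := hlam.2 i
      simp only [p, i.2, dif_pos, Fin.eta]
      omega
    have h1 : ∀ i < d, 0 ≤ p i ∧ p i < 0 + n := fun i hi => by
      have := hp ⟨i, hi⟩
      simp only at this
      omega
    have h2 : ∀ i, i + 1 < d → p i < p (i + 1) := fun i hi => by
      have h3 := hp ⟨i, by omega⟩
      have h4 := hp ⟨i + 1, hi⟩
      have h5 : lam ⟨i + 1, hi⟩ ≤ lam ⟨i, by omega⟩ := hlam.1 (by simp)
      simp only at h3 h4
      omega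
    have h3 := partsOfWord_positions n 0 d p h1 h2
    rw [← List.range_eq_range'] at h3
    convert h3 using 1
    · congr 1
      refine List.map_congr_left fun a _ => ?_
      rw [decide_eq_decide]
      constructor
      · rintro ⟨i, hi⟩
        exact ⟨i, i.2, by have := hp i; omega⟩
      · rintro ⟨i, hi, hia⟩
        exact ⟨⟨i, hi⟩, by have := hp ⟨i, hi⟩; simp only at this ⊢; omega⟩
    · refine List.ext_getElem (by simp) fun i hi hi' => ?_
      have hi'' : i < d := by simpa using hi
      have := hp ⟨i, hi''⟩
      simp only [List.getElem_ofFn, List.getElem_map, List.getElem_range]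
      simp only at this
      omega
  rw [← key]
  constructor
  · intro h a ha
    have := partsOfWord_injective (by simp) h
    rw [List.map_inj_left] at this
    rw [this a (List.mem_range.2 ha), decide_eq_true_iff]
  · intro h
    congr 1
    refine List.map_congr_left fun a ha => ?_
    rw [Bool.eq_iff_iff, h a (List.mem_range.1 ha), decide_eq_true_iff]

/-! ### The tiling of a path system -/

/-- The paths leave the region of height `h` through horizontal edges, and do not contain
anything but vertical steps below it. -/
def IsSettled (d n h : ℕ) (u : ℕ → ℕ → ℕ) (x : ℕ → ℕ → ℤ) : Prop :=
  ∀ i < d, ∀ j, u i j = u (i + 1) j → -(h : ℤ) ≤ n - 1 - j - x i j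

namespace IsPathSystem

variable {d n h : ℕ} {u : ℕ → ℕ → ℕ} {x : ℕ → ℕ → ℤ} (S : IsPathSystem d n u x)
include S

theorem lt_of_eq {i j : ℕ} (hi : i < d) (h : u i j = u (i + 1) j) : j < n := by
  by_contra h'
  rw [S.u_final i j (by omega), S.u_final (i + 1) j (by omega)] at h
  omega

/-- At a letter the value `u i j` is squeezed between `u (i + 1) j` and `u i (j + 1)`, so the path
enters the strip through a back edge labelled 1; `succ_eq_of_letter` says that it also leaves
through one. -/
theorem eq_of_letter {i j : ℕ} (h : u i (j + 1) = u (i + 1) j) : u i j = u (i + 1) j := by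
  have := S.u_mono i j
  have := S.u_le i j
  omega

theorem succ_eq_of_letter {i j : ℕ} (h : u i (j + 1) = u (i + 1) j) :
    u i (j + 1) = u (i + 1) (j + 1) := by
  have := S.u_mono (i + 1) j
  have := S.u_le i (j + 1)
  omega

theorem x_succ_of_not_letter {i j : ℕ} (hi : i < d) (h : u i (j + 1) ≠ u (i + 1) j) :
    x i (j + 1) = x i j :=
  (S.x_step i j hi).resolve_right fun h' => h h'.2

theorem x_final {i j : ℕ} (hi : i < d) (hj : n ≤ j) : x i j = x i n := by
  induction j, hj using Nat.le_induction with
  | base => rfl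
  | succ j hj ih =>
    rw [S.x_succ_of_not_letter hi, ih]
    intro h
    have := S.lt_of_eq hi (S.eq_of_letter h)
    omega

theorem x_n_le {i : ℕ} (hi : i < d) (j : ℕ) : x i n ≤ x i j := by
  rcases le_total j n with h | h
  · exact S.x_antitone hi h
  · exact (S.x_final hi h).ge

/-- A crossing through a back edge labelled 1 needs `j < n`, and then `x i j < n` bounds its height
from below by `-n`. -/
theorem isSettled_self : IsSettled d n n u x := by
  intro i hi j h
  have := S.lt_of_eq hi h
  have := S.x_lt_n i j hi
  omega

omit S in
theorem _root_.IsSettled.ne (hs : IsSettled d n h u x) {i j : ℕ} (hi : i < d)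
    (hj : (n : ℤ) - 1 - j - x i j < -h) : u i j ≠ u (i + 1) j :=
  fun h' => absurd (hs i hi j h') (by omega)

/-- Below height `-h` there are no letters, and only letters can move a path west; each further step
lowers the path, so it stays below. -/
theorem x_eq_of_lt (hs : IsSettled d n h u x) {i j j' : ℕ} (hi : i < d)
    (hj : (n : ℤ) - 1 - j - x i j < -h) (hjj : j ≤ j') : x i j' = x i j := by
  induction j', hjj using Nat.le_induction with
  | base => rfl
  | succ k hk ih =>
    rw [← ih]
    refine S.x_succ_of_not_letter hi fun h' => hs.ne hi ?_ (S.eq_of_letter h')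
    omega

theorem x_n_eq_of_lt (hs : IsSettled d n h u x) {i j : ℕ} (hi : i < d)
    (hj : (n : ℤ) - 1 - j - x i j < -h) : x i n = x i j := by
  rcases le_total j n with h' | h'
  · exact S.x_eq_of_lt hs hi hj h'
  · exact (S.x_final hi h').symm

/-- A beam starts at an upward 1-triangle, which its path enters through a back edge labelled 1.
Such an edge further east on the same line would lie below height `-h`. -/
theorem not_isBeam_of_le (hs : IsSettled d n h u x) {a : ℤ} {j : ℕ}
    (hj : (n : ℤ) - 1 - j - a ≤ -h) (ha : ∀ i < d, x i j = a → u i j ≠ u (i + 1) j) :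
    ¬ IsBeam d u x a j := by
  rintro ⟨i, hi, -, h2, h3⟩
  have h4 : u i j ≠ u (i + 1) j := by
    rcases h2.eq_or_lt with h | h
    · exact ha i hi h.symm
    · exact hs.ne hi (by omega)
  have := S.u_step i j
  have := S.u_le i j
  have := S.u_mono i j
  omega

-- At and below height `-h` the horizontal labels no longer depend on the height: they mark the
-- final positions of the paths. This is the south word.
open scoped Classical in
theorem horLabel_of_le (hs : IsSettled d n h u x) {a : ℤ} {j : ℕ}
    (hj : (n : ℤ) - 1 - j - a ≤ -h) :
    horLabel d u x a j = if ∃ i < d, x i n = a then .one else .zero := by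
  by_cases ha : ∃ i < d, x i j = a
  · obtain ⟨i, hi, rfl⟩ := ha
    rw [S.horLabel_at hi]
    by_cases hl : u i (j + 1) = u (i + 1) j
    · have h1 : x i (j + 1) ≠ x i j := fun h' =>
        absurd (hs i hi (j + 1) (S.succ_eq_of_letter hl)) (by push_cast; omega)
      rw [if_neg (not_not.2 hl), if_neg h1, if_neg]
      rintro ⟨k, hk, hk'⟩
      rcases lt_trichotomy k i with h' | rfl | h'
      · have := S.x_strictMono j h' hi
        have := S.x_n_le hk j
        omega
      · have := S.x_n_le hk (j + 1)
        have := S.x_step k j hk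
        omega
      · have := S.x_strictMono j h' hk
        have := S.x_n_eq_of_lt hs hk (j := j) (by omega)
        omega
    · rw [if_pos hl, if_pos]
      have h1 := S.x_succ_of_not_letter hi hl
      exact ⟨i, hi, by rw [S.x_n_eq_of_lt hs hi (j := j + 1) (by push_cast; omega), h1]⟩
  · have ha' : ∀ i < d, x i j ≠ a := fun i hi h => ha ⟨i, hi, h⟩
    rw [horLabel_none ha', if_neg (S.not_isBeam_of_le hs hj fun i hi h => absurd h (ha' i hi)),
      if_neg]
    rintro ⟨k, hk, hk'⟩
    have h1 := S.x_n_le hk j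
    have h2 := ha' k hk
    have := S.x_n_eq_of_lt hs hk (j := j) (by omega)
    omega

theorem slashLabel_of_lt (hs : IsSettled d n h u x) {a : ℤ} {j : ℕ}
    (hj : (n : ℤ) - 1 - j - a < -h) : slashLabel d u x a j = .zero := by
  have h1 : ¬ ∃ i < d, x i j = a ∧ x i (j + 1) ≠ a := by
    rintro ⟨i, hi, rfl, h2⟩
    exact h2 (S.x_eq_of_lt hs hi hj (Nat.le_succ j))
  rw [slashLabel, if_neg h1, if_neg]
  exact S.not_isBeam_of_le hs hj.le fun i hi h => hs.ne hi (by omega)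

open scoped Classical in
theorem backLabel_of_lt (hs : IsSettled d n h u x) {a : ℤ} {j : ℕ}
    (hj : (n : ℤ) - 1 - j - a < -h) :
    backLabel d u x a j = if ∃ i < d, x i n = a then .inner else .zero := by
  by_cases ha : ∃ i < d, x i j = a
  · obtain ⟨i, hi, rfl⟩ := ha
    rw [S.backLabel_at hi, if_neg (hs.ne hi hj), if_pos ⟨i, hi, S.x_n_eq_of_lt hs hi hj⟩]
  · have ha' : ∀ i < d, x i j ≠ a := fun i hi h => ha ⟨i, hi, h⟩
    rw [backLabel_none ha', if_neg]
    rintro ⟨k, hk, hk'⟩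
    have h1 := S.x_n_le hk j
    have h2 := ha' k hk
    have := S.x_n_eq_of_lt hs hk (j := j) (by omega)
    omega

theorem isLabeling (hs : IsSettled d n h u x) : IsLabeling n h (pathLabels d n u x) where
  labeled t ht := by
    cases t with
    | up a b => exact S.isLabeled_up
    | down a b => exact S.isLabeled_down (by rw [inside_down] at ht; omega)
  northEast a _ _ := by
    have : ((n : ℤ) - 1 - a - (n - 1 - a)).toNat = 0 := by omega
    simp only [pathLabels, this]
    exact S.backLabel_zero_ne a
  west _ b _ _ := by
    simp only [pathLabels, S.slashLabel_zero]
    split_ifs <;> simp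
  east _ b _ _ := by
    simp only [pathLabels, S.slashLabel_of_le le_rfl]
    simp
  south_inner a _ _ := by
    simp only [pathLabels]
    rw [S.horLabel_of_le hs (by omega)]
    split_ifs <;> simp
  south_eqv a _ _ := by
    simp only [pathLabels]
    rw [S.horLabel_of_le hs (by omega)]
    split_ifs <;> simp

end IsPathSystem

/-! ### Puzzles of height `h` with prescribed boundary words -/

/-- The conditions on the boundary words of a path system that correspond to the partitions
`lam`, `mu`, `nu`. -/
structure HasBoundary {d : ℕ} (n : ℕ) (u : ℕ → ℕ → ℕ) (x : ℕ → ℕ → ℤ) (lam mu nu : Fin d → ℕ) :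
    Prop where
  north_east : ∀ i : Fin d, x i 0 = (n : ℤ) - d + i - lam i
  north_west : ∀ j, u 0 (j + 1) ≠ u 0 j ↔ ∃ r : Fin d, j + r + 1 = d + mu r
  south : ∀ i : Fin d, x i n = (n : ℤ) - d + i - nu i

/-- The partitionings of the region of height `h` whose labels on the E and W sides below the
height 0 are 0 and whose words correspond to `lam`, `mu`, `nu`. -/
def HeightPuzzles {d : ℕ} (n h : ℕ) (lam mu nu : Fin d → ℕ) : Set (Finset Piece) :=
  {P | IsPartitioning (puzzleRegion n h) P ∧
    (∀ j < h, HasLabel P (.slash n (-(j : ℤ) - 1)) false) ∧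
    (∀ j < h, HasLabel P (.slash 0 (-(j : ℤ) - 1)) false) ∧
    partsOfWord (wordAlong P (edgesNE n)) = List.ofFn lam ∧
    partsOfWord (wordAlong P (edgesNW n)) = List.ofFn mu ∧
    partsOfWord (wordAlong P (edgesHor n (-(h : ℤ)))) = List.ofFn nu}

theorem edgesNE_eq (n : ℕ) :
    edgesNE n = (List.range n).map fun a : ℕ => Edge.back (a : ℤ) ((n : ℤ) - 1 - a) := by
  simp [edgesNE, ← List.map_eq_flatMap]

theorem edgesNW_eq (n : ℕ) :
    edgesNW n = (List.range n).map fun a : ℕ => Edge.slash 0 (a : ℤ) := by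
  simp [edgesNW, ← List.map_eq_flatMap]

theorem edgesHor_eq (n : ℕ) (k : ℤ) :
    edgesHor n k = (List.range n).map fun a : ℕ => Edge.hor (a : ℤ) k := by
  simp [edgesHor, ← List.map_eq_flatMap]

section words

variable {d n : ℕ} (hdn : d ≤ n) {lam : Fin d → ℕ} (hlam : IsBoxPartition d n lam)
  (P : Finset Piece)
include hdn hlam

theorem word_northEast_iff : partsOfWord (wordAlong P (edgesNE n)) = List.ofFn lam ↔
    ∀ a < n, HasLabel P (.back (a : ℤ) ((n : ℤ) - 1 - a)) true ↔
      ∃ i : Fin d, a + lam i = n - d + i := by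
  have := partsOfWord_eq_ofFn_iff hdn hlam
    fun a => decide (HasLabel P (.back (a : ℤ) ((n : ℤ) - 1 - a)) true)
  simpa only [wordAlong, edgesNE_eq, List.map_map, decide_eq_true_iff, Function.comp_def] using this

theorem word_northWest_iff : partsOfWord (wordAlong P (edgesNW n)) = List.ofFn lam ↔
    ∀ a < n, HasLabel P (.slash 0 (a : ℤ)) true ↔ ∃ i : Fin d, a + lam i = n - d + i := by
  have := partsOfWord_eq_ofFn_iff hdn hlam fun a => decide (HasLabel P (.slash 0 (a : ℤ)) true)
  simpa only [wordAlong, edgesNW_eq, List.map_map, decide_eq_true_iff, Function.comp_def] using this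

theorem word_hor_iff (k : ℤ) : partsOfWord (wordAlong P (edgesHor n k)) = List.ofFn lam ↔
    ∀ a < n, HasLabel P (.hor (a : ℤ) k) true ↔ ∃ i : Fin d, a + lam i = n - d + i := by
  have := partsOfWord_eq_ofFn_iff hdn hlam fun a => decide (HasLabel P (.hor (a : ℤ) k) true)
  simpa only [wordAlong, edgesHor_eq, List.map_map, decide_eq_true_iff, Function.comp_def] using this

end words

theorem puzzles_eq {d n : ℕ} (lam mu nu : Fin d → ℕ) :
    Puzzles n lam mu nu = HeightPuzzles n 0 lam mu nu := by
  have : triangleRegion n = puzzleRegion n 0 := by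
    ext v
    simp only [triangleRegion, puzzleRegion, Set.mem_ofPred_eq]
    omega
  simp [Puzzles, HeightPuzzles, this]

theorem trapezoidPuzzles_eq {d n : ℕ} (lam mu nu : Fin d → ℕ) :
    TrapezoidPuzzles n lam mu nu = HeightPuzzles n n lam mu nu := by
  have : trapezoidRegion n = puzzleRegion n n := rfl
  simp [TrapezoidPuzzles, HeightPuzzles, this, edgesE, edgesW]

theorem IsPathSystem.mem_heightPuzzles {d n h : ℕ} {u : ℕ → ℕ → ℕ} {x : ℕ → ℕ → ℤ}
    (S : IsPathSystem d n u x) (hs : IsSettled d n h u x) (hn : 0 < n) (hdn : d ≤ n)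
    {lam mu nu : Fin d → ℕ} (hlam : IsBoxPartition d n lam) (hmu : IsBoxPartition d n mu)
    (hnu : IsBoxPartition d n nu) (hb : HasBoundary n u x lam mu nu) :
    labelPieces n h (pathLabels d n u x) ∈ HeightPuzzles n h lam mu nu := by
  have H := S.isLabeling hs
  refine ⟨H.isPartitioning, fun j hj => ?_, fun j hj => ?_, ?_, ?_, ?_⟩
  · rw [H.hasLabel_iff (t := .down (n - 1) (-j - 1)) (inside_down.2 (by omega))
      (by simp [edge_slash_mem])]
    exact S.slashLabel_of_le le_rfl _
  · rw [H.hasLabel_iff (t := .up 0 (-j - 1)) (inside_up.2 (by omega))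
      (by simp [edge_slash_mem])]
    simp only [pathLabels, S.slashLabel_zero, EdgeLabel.ofBool]
    rw [if_neg]
    rw [S.u_final _ _ (by omega), S.u_final _ _ (by omega)]
    simp
  · rw [word_northEast_iff hdn hlam]
    intro a ha
    rw [H.hasLabel_iff (t := .up a (n - 1 - a)) (inside_up.2 (by omega))
      (by simp [edge_back_mem])]
    have h0 : ((n : ℤ) - 1 - a - (n - 1 - a)).toNat = 0 := by omega
    simp only [pathLabels, h0, EdgeLabel.ofBool]
    constructor
    · intro h1
      by_contra h2
      rw [backLabel_none] at h1
      · simp at h1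
      · intro i hi hia
        refine h2 ⟨⟨i, hi⟩, ?_⟩
        have := hb.north_east ⟨i, hi⟩
        simp only at this ⊢
        omega
    · rintro ⟨i, hi⟩
      have h1 : (a : ℤ) = x i 0 := by rw [hb.north_east]; omega
      rw [h1, S.backLabel_at i.2, if_pos (by rw [S.u_zero, S.u_zero])]
  · rw [word_northWest_iff hdn hmu]
    intro a ha
    rw [H.hasLabel_iff (t := .up 0 a) (inside_up.2 (by omega))
      (by simp [edge_slash_mem])]
    simp only [pathLabels, S.slashLabel_zero, EdgeLabel.ofBool]
    have h1 := hb.north_west ((n : ℤ) - 1 - 0 - a).toNat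
    have h2 : (∃ i : Fin d, a + mu i = n - d + i) ↔
        ∃ r : Fin d, ((n : ℤ) - 1 - 0 - a).toNat + r + 1 = d + mu r :=
      exists_congr fun i => by omega
    rw [h2, ← h1]
    simp
  · rw [word_hor_iff hdn hnu]
    intro a ha
    rw [H.hasLabel_iff (t := .up a (-h)) (inside_up.2 (by omega))
      (by simp [edge_hor_mem])]
    simp only [pathLabels, EdgeLabel.ofBool]
    rw [S.horLabel_of_le hs (by omega)]
    -- The final positions of the paths are the positions of the ones in the word of `ν`.
    have h2 : (∃ i : Fin d, a + nu i = n - d + i) ↔ ∃ i < d, x i n = a := by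
      constructor
      · rintro ⟨i, hi⟩
        exact ⟨i, i.2, by rw [hb.south]; omega⟩
      · rintro ⟨i, hi, hia⟩
        have := hb.south ⟨i, hi⟩
        exact ⟨⟨i, hi⟩, by simp only at this ⊢; omega⟩
    rw [h2]
    simp

/-! ### The path system of a labeling -/

/-- An up and a down triangle share a horizontal edge. The labels of the two back edges and of the
right slash edge determine the shared edge and the left slash edge. Hence the labels in a strip
propagate from east to west. -/
theorem IsTriangleLabel.unique {h g b g' b' h₁ g₁ : EdgeLabel} (H₁ : IsTriangleLabel h g b)
    (H₂ : IsTriangleLabel h g' b') (H₃ : IsTriangleLabel h₁ g₁ b)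
    (H₄ : IsTriangleLabel h₁ g' b') : h = h₁ ∧ g = g₁ := by
  cases H₁ <;> cases H₂ <;> cases H₃ <;> cases H₄ <;> simp

/-- Admissible labels of the horizontal, slash and back edges in all strips, to the right of the
west side. -/
structure IsStripLabeling (d n : ℕ) (p : ℕ → ℤ) (H G B : ℤ → ℕ → EdgeLabel) : Prop where
  up : ∀ a j, 0 ≤ a → IsTriangleLabel (H a j) (G a j) (B a j)
  down : ∀ a j, 0 ≤ a → IsTriangleLabel (H a j) (G (a + 1) j) (B a (j + 1))
  east : ∀ a j, (n : ℤ) ≤ a → G a j = .zero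
  west : ∀ j, G 0 j ≠ .inner
  north_one : ∀ i < d, B (p i) 0 = .one
  north_zero : ∀ a, 0 ≤ a → (∀ i < d, p i ≠ a) → B a 0 = .zero
  nonneg : ∀ i < d, 0 ≤ p i
  lt_n : ∀ i < d, p i < n
  lt : ∀ i, i + 1 < d → p i < p (i + 1)

/-- The positions of the path `i` in a strip labeling. -/
def traceX (d : ℕ) (p : ℕ → ℤ) (G : ℤ → ℕ → EdgeLabel) (i : ℕ) : ℕ → ℤ
  | 0 => if i < d then p i else 0
  | j + 1 => if i < d ∧ G (traceX d p G i j) j = .inner then traceX d p G i j - 1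
      else traceX d p G i j

/-- The numbers of upward pointing 1-triangles on the path `i` in a strip labeling. -/
def traceU (d : ℕ) (p : ℕ → ℤ) (G : ℤ → ℕ → EdgeLabel) (i : ℕ) : ℕ → ℕ
  | 0 => 0
  | j + 1 => traceU d p G i j + if i < d ∧ G (traceX d p G i j) j = .one then 1 else 0

namespace IsStripLabeling

variable {d n : ℕ} {p : ℕ → ℤ} {H G B : ℤ → ℕ → EdgeLabel} (S : IsStripLabeling d n p H G B)
include S

local notation "xx" => traceX d p G
local notation "uu" => traceU d p G

omit S in
theorem traceX_succ {i j : ℕ} (hi : i < d) :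
    xx i (j + 1) = if G (xx i j) j = .inner then xx i j - 1 else xx i j := by
  simp only [traceX, hi, true_and]

omit S in
theorem traceU_succ {i j : ℕ} (hi : i < d) :
    uu i (j + 1) = uu i j + if G (xx i j) j = .one then 1 else 0 := by
  simp only [traceU, hi, true_and]

omit S in
theorem traceU_of_le {i : ℕ} (j : ℕ) (hi : d ≤ i) : uu i j = 0 := by
  induction j with
  | zero => rfl
  | succ j ih => simp [traceU, ih, not_lt.2 hi]

omit S in
theorem traceX_of_le {i : ℕ} (j : ℕ) (hi : d ≤ i) : xx i j = 0 := by
  induction j with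
  | zero => simp [traceX, not_lt.2 hi]
  | succ j ih => simp [traceX, ih, not_lt.2 hi]

/-- The paths are disjoint, and run through the back edges on a line with nonzero labels. -/
theorem trace_invariant (j : ℕ) :
    (∀ i < d, 0 ≤ xx i j ∧ xx i j < n ∧ B (xx i j) j ≠ .zero) ∧
    (∀ i, i + 1 < d → xx i j < xx (i + 1) j) ∧
    (∀ a, 0 ≤ a → B a j ≠ .zero → ∃ i < d, xx i j = a) := by
  induction j with
  | zero =>
    refine ⟨fun i hi => ?_, fun i hi => ?_, fun a ha hB => ?_⟩
    · simp only [traceX, if_pos hi]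
      exact ⟨S.nonneg i hi, S.lt_n i hi, by simp [S.north_one i hi]⟩
    · simp only [traceX, if_pos hi, if_pos (Nat.lt_of_succ_lt hi)]
      exact S.lt i hi
    · by_contra h
      refine hB (S.north_zero a ha fun i hi hia => h ⟨i, hi, ?_⟩)
      simpa only [traceX, if_pos hi] using hia
  | succ j ih =>
    obtain ⟨ih1, ih2, ih3⟩ := ih
    refine ⟨fun i hi => ?_, fun i hi => ?_, fun a ha hB => ?_⟩
    · obtain ⟨h1, h2, h3⟩ := ih1 i hi
      rw [traceX_succ hi]
      split_ifs with hG
      · have h4 : xx i j ≠ 0 := fun h => S.west j (by rw [← h]; exact hG)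
        refine ⟨by omega, by omega, ?_⟩
        have h5 := S.down (xx i j - 1) j (by omega)
        rw [sub_add_cancel, hG] at h5
        rw [(h5.of_slash_inner rfl).2]
        simp
      · refine ⟨h1, h2, ?_⟩
        have h4 := S.up (xx i j) j h1
        have h5 := S.down (xx i j) j h1
        revert h4 h5 h3 hG
        generalize H (xx i j) j = h'
        generalize G (xx i j) j = g
        generalize B (xx i j) j = b
        generalize G (xx i j + 1) j = g'
        generalize B (xx i j) (j + 1) = b'
        rintro h3 hG h4 h5
        cases h4 <;> cases h5 <;> simp at h3 hG ⊢
    · have h1 := ih2 i hi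
      obtain ⟨h2, -, h3⟩ := ih1 i (by omega)
      rw [traceX_succ hi, traceX_succ (Nat.lt_of_succ_lt hi)]
      split_ifs with hG hG' hG'
      · omega
      · omega
      -- Path `i` stays and path `i + 1` moves onto it. The rhombus of path `i + 1` would force the
      -- horizontal label at path `i` to be zero, and with a nonzero back label this leaves only a
      -- `backOne` rhombus, so path `i` would have moved too.
      · by_contra h4
        have h5 : xx (i + 1) j = xx i j + 1 := by omega
        rw [h5] at hG'
        have h6 := S.up (xx i j) j h2
        have h7 := S.down (xx i j) j h2
        rw [hG'] at h7
        rw [(h7.of_slash_inner rfl).1] at h6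
        revert h6 h3 hG
        generalize G (xx i j) j = g
        generalize B (xx i j) j = b
        rintro h3 hG h6
        cases h6 <;> simp at h3 hG
      · exact h1
    · have h4 := S.up a j ha
      have h5 := S.down a j ha
      -- Every nonzero back edge on the next line is reached by a path, either from position `a + 1`
      -- through a `backOne` rhombus or from position `a`.
      have h6 : G (a + 1) j = .inner ∨ (B a j ≠ .zero ∧ G a j ≠ .inner) := by
        revert h4 h5 hB
        generalize H a j = h'
        generalize G a j = g
        generalize B a j = b
        generalize G (a + 1) j = g'
        generalize B a (j + 1) = b'
        rintro hB h4 h5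
        cases h4 <;> cases h5 <;> simp at hB ⊢
      rcases h6 with h6 | ⟨h6, h7⟩
      · have h8 := S.up (a + 1) j (by omega)
        obtain ⟨i, hi, hia⟩ := ih3 (a + 1) (by omega) (by
          rw [h6] at h8
          rw [(h8.of_slash_inner rfl).2]
          simp)
        refine ⟨i, hi, ?_⟩
        rw [traceX_succ hi, hia, if_pos h6]
        omega
      · obtain ⟨i, hi, hia⟩ := ih3 a ha h6
        exact ⟨i, hi, by rw [traceX_succ hi, hia, if_neg h7]⟩

/-- Where no path crosses, the two triangles at a position have the same answer to whether their
slash edge is 1: a beam neither starts nor ends there. -/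
theorem slash_one_iff_of_zero {a : ℤ} {j : ℕ} (ha : 0 ≤ a) (k : ℕ)
    (hB : ∀ m < k, B (a + m) j = .zero) : G a j = .one ↔ G (a + k) j = .one := by
  induction k with
  | zero => simp
  | succ k ih =>
    rw [ih fun m hm => hB m (by omega)]
    have h4 := S.up (a + k) j (by omega)
    have h5 := S.down (a + k) j (by omega)
    rw [hB k (by omega)] at h4
    have h6 : a + ((k + 1 : ℕ) : ℤ) = a + k + 1 := by push_cast; ring
    rw [h6]
    revert h4 h5
    generalize H (a + k) j = h'
    generalize G (a + k) j = g
    generalize G (a + k + 1) j = g'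
    generalize B (a + k) (j + 1) = b'
    rintro h4 h5
    cases h4 <;> cases h5 <;> simp

theorem trace_strictMono {i i' : ℕ} (j : ℕ) (h : i < i') (hi' : i' < d) : xx i j < xx i' j := by
  induction i', h using Nat.le_induction with
  | base => exact (S.trace_invariant j).2.1 i hi'
  | succ k hk ih => exact (ih (by omega)).trans ((S.trace_invariant j).2.1 k hi')

/-- The beam arriving from the east at path `i` originates at an upward triangle of path `i + 1`,
since no path lies in between. East of the last path there is no beam because the slash labels
vanish from `n` on. -/
theorem slash_succ_one_iff {i j : ℕ} (hi : i < d) :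
    G (xx i j + 1) j = .one ↔ i + 1 < d ∧ G (xx (i + 1) j) j = .one := by
  obtain ⟨h1, h2, -⟩ := (S.trace_invariant j).1 i hi
  by_cases hi' : i + 1 < d
  · have h3 := S.trace_strictMono j (Nat.lt_succ_self i) hi'
    rw [S.slash_one_iff_of_zero (by omega) (xx (i + 1) j - (xx i j + 1)).toNat]
    · have : xx i j + 1 + ((xx (i + 1) j - (xx i j + 1)).toNat : ℤ) = xx (i + 1) j := by
        simp only [Nat.succ_eq_add_one] at h3
        omega
      rw [this]
      simp [hi']
    · intro m hm
      by_contra hB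
      obtain ⟨k, hk, hka⟩ := (S.trace_invariant j).2.2 _ (by omega) hB
      rcases lt_trichotomy k i with h | rfl | h
      · have := S.trace_strictMono j h hi
        omega
      · omega
      · rcases (Nat.succ_le_of_lt h).eq_or_lt with rfl | h
        · simp only [Nat.succ_eq_add_one] at hka
          omega
        · have := S.trace_strictMono j h hk
          simp only [Nat.succ_eq_add_one] at this
          omega
  · rw [S.slash_one_iff_of_zero (by omega) (n - (xx i j + 1)).toNat]
    · rw [S.east _ _ (by omega)]
      simp [hi']
    · intro m hm
      by_contra hB
      obtain ⟨k, hk, hka⟩ := (S.trace_invariant j).2.2 _ (by omega) hB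
      rcases lt_trichotomy k i with h | rfl | h
      · have := S.trace_strictMono j h hi
        omega
      · omega
      · omega

theorem slash_west_iff {j : ℕ} : G 0 j = .one ↔ 0 < d ∧ G (xx 0 j) j = .one := by
  by_cases hd : 0 < d
  · obtain ⟨h1, h2, -⟩ := (S.trace_invariant j).1 0 hd
    rw [S.slash_one_iff_of_zero le_rfl (xx 0 j).toNat]
    · rw [zero_add, Int.toNat_of_nonneg h1]
      simp [hd]
    · intro m hm
      by_contra hB
      obtain ⟨k, hk, hka⟩ := (S.trace_invariant j).2.2 _ (by omega) hB
      rcases Nat.eq_zero_or_pos k with rfl | h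
      · omega
      · have := S.trace_strictMono j h hk
        omega
  · rw [S.slash_one_iff_of_zero le_rfl n]
    · rw [S.east _ _ (by omega)]
      simp [hd]
    · intro m hm
      by_contra hB
      obtain ⟨k, hk, hka⟩ := (S.trace_invariant j).2.2 _ (by omega) hB
      omega

theorem traceU_succ_succ {i j : ℕ} (hi : i < d) :
    uu (i + 1) (j + 1) = uu (i + 1) j + if G (xx i j + 1) j = .one then 1 else 0 := by
  simp only [traceU, S.slash_succ_one_iff hi]

/-- An upward 1-triangle turns the back label of a path from one to inner and raises `u i`. A
downward 1-triangle turns it back and, being the end of a beam of path `i + 1`, raises `u (i + 1)`.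
So the label records the difference of the two counts. -/
theorem trace_state (j : ℕ) : ∀ i < d,
    (B (xx i j) j = .one ∧ uu i j = uu (i + 1) j) ∨
      (B (xx i j) j = .inner ∧ uu i j = uu (i + 1) j + 1) := by
  induction j with
  | zero =>
    intro i hi
    left
    simp only [traceX, if_pos hi, traceU]
    exact ⟨S.north_one i hi, trivial⟩
  | succ j ih =>
    intro i hi
    have h0 := ih i hi
    obtain ⟨h1, h2, h3⟩ := (S.trace_invariant j).1 i hi
    rw [S.traceU_succ_succ hi, traceU_succ hi]
    have h4 := S.up (xx i j) j h1
    have h5 := S.down (xx i j) j h1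
    by_cases hG : G (xx i j) j = .inner
    · have h6 : xx i j ≠ 0 := fun h => S.west j (by rw [← h]; exact hG)
      have h7 := S.down (xx i j - 1) j (by omega)
      rw [sub_add_cancel, hG] at h7
      rw [traceX_succ hi, if_pos hG, (h7.of_slash_inner rfl).2]
      rw [hG] at h4 ⊢
      revert h4 h5 h0
      generalize H (xx i j) j = h'
      generalize B (xx i j) j = b
      generalize G (xx i j + 1) j = g'
      generalize B (xx i j) (j + 1) = b'
      rintro h0 h4 h5
      cases h4; cases h5 <;> simp at h0 ⊢ <;> omega
    · rw [traceX_succ hi, if_neg hG]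
      revert h4 h5 h0 hG h3
      generalize H (xx i j) j = h'
      generalize G (xx i j) j = g
      generalize B (xx i j) j = b
      generalize G (xx i j + 1) j = g'
      generalize B (xx i j) (j + 1) = b'
      rintro h0 h3 h4 h5 hG
      cases h4 <;> cases h5 <;> simp at h0 hG h3 ⊢ <;> omega

theorem isPathSystem (h0 : ∀ j, n ≤ j → uu 0 j = d) : IsPathSystem d n uu xx where
  u_zero _ := rfl
  u_last i j hi := traceU_of_le j hi
  u_mono i j := Nat.le_add_right _ _
  u_le i j := by
    by_cases hi : i < d
    · rcases S.trace_state j i hi with h | h <;> omega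
    · rw [traceU_of_le j (by omega)]
      omega
  u_step i j := by
    by_cases hi : i < d
    · rw [traceU_succ hi]
      rcases S.trace_state j i hi with h | h
      · split_ifs <;> omega
      · have h4 := S.up (xx i j) j ((S.trace_invariant j).1 i hi).1
        rw [h.1] at h4
        rw [(h4.of_back_inner rfl).2, h.2]
        simp
    · rw [traceU_of_le (j + 1) (by omega)]
      omega
  u_final i j hj := by
    -- The counts start at `d` for path `0`, end at `0` for the fictitious path `d`, and drop by at
    -- most one at each of the `d` steps; so each step drops by exactly one.
    have h1 : ∀ i j, i < d → uu (i + 1) j ≤ uu i j ∧ uu i j ≤ uu (i + 1) j + 1 := fun i j hi => by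
      rcases S.trace_state j i hi with h | h <;> omega
    have h2 : ∀ i, i ≤ d → uu 0 j ≤ uu i j + i := fun i => by
      induction i with
      | zero => simp
      | succ i ih =>
        intro hi
        have := ih (by omega)
        have := h1 i j (by omega)
        omega
    have h3 : ∀ k, k ≤ d → uu (d - k) j ≤ k := fun k => by
      induction k with
      | zero => intro _; rw [traceU_of_le j (by omega)]
      | succ k ih =>
        intro hk
        have := ih (by omega)
        have := h1 (d - (k + 1)) j (by omega)
        rw [show d - (k + 1) + 1 = d - k by omega] at this
        omega
    by_cases hi : i ≤ d
    · have h4 := h2 i hi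
      have h5 := h3 (d - i) (by omega)
      rw [show d - (d - i) = i by omega] at h5
      rw [h0 j hj] at h4
      omega
    · rw [traceU_of_le j (by omega)]
      omega
  x_off i j hi := traceX_of_le j hi
  x_step i j hi := by
    rw [traceX_succ hi]
    split_ifs with hG
    · right
      refine ⟨rfl, ?_⟩
      have h4 := S.up (xx i j) j ((S.trace_invariant j).1 i hi).1
      have h5 := (h4.of_slash_inner hG).2
      rw [traceU_succ hi, hG]
      rcases S.trace_state j i hi with h | h
      · simp [h.2]
      · simp [h.1] at h5
    · exact Or.inl rfl
  x_lt i j hi := (S.trace_invariant j).2.1 i hi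
  x_nonneg i j hi := ((S.trace_invariant j).1 i hi).1
  x_lt_n i j hi := ((S.trace_invariant j).1 i hi).2.1

theorem back_eq (T : IsPathSystem d n uu xx) {a : ℤ} (ha : 0 ≤ a) (j : ℕ) :
    B a j = backLabel d uu xx a j := by
  by_cases h : ∃ i < d, xx i j = a
  · obtain ⟨i, hi, rfl⟩ := h
    rw [T.backLabel_at hi]
    rcases S.trace_state j i hi with h | h
    · rw [h.1, if_pos h.2]
    · rw [h.1, if_neg (by omega)]
  · rw [IsPathSystem.backLabel_none fun i hi hia => h ⟨i, hi, hia⟩]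
    by_contra hB
    exact h ((S.trace_invariant j).2.2 a ha hB)

/-- Both labelings agree on back edges and vanish at the slash edges from `n` on;
`IsTriangleLabel.unique` carries the agreement westward. The induction is on the distance to the
east side. -/
theorem hor_slash_eq (T : IsPathSystem d n uu xx) {a : ℤ} (ha : 0 ≤ a) (j : ℕ) :
    (a < n → H a j = horLabel d uu xx a j) ∧ G a j = slashLabel d uu xx a j := by
  obtain ⟨k, hk⟩ : ∃ k : ℕ, (n : ℤ) - a ≤ k := ⟨((n : ℤ) - a).toNat, by omega⟩
  induction k generalizing a with
  | zero =>
    exact ⟨by omega, by rw [S.east a j (by omega), T.slashLabel_of_le (by omega)]⟩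
  | succ k ih =>
    have h1 := (ih (a := a + 1) (by omega) (by push_cast at hk; omega)).2
    have h2 := S.up a j ha
    have h3 := S.down a j ha
    rw [h1, S.back_eq T ha] at h3
    rw [S.back_eq T ha] at h2
    have h4 := h2.unique h3 (T.isTriangleLabel_up a j) (T.isTriangleLabel_down a j)
    exact ⟨fun _ => h4.1, h4.2⟩

end IsStripLabeling

/-- A counting function that increases by one at the times `t + mu (d - 1 - t)`, `t < d`. -/
theorem lt_count_iff {d n : ℕ} {mu : Fin d → ℕ} (hmu : IsBoxPartition d n mu) {f : ℕ → ℕ}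
    (h0 : f 0 = 0) (h1 : ∀ j, f j ≤ f (j + 1)) (h2 : ∀ j, f (j + 1) ≤ f j + 1)
    (h3 : ∀ j, f (j + 1) ≠ f j ↔ ∃ r : Fin d, j + r + 1 = d + mu r) (t j : ℕ) :
    t < f j ↔ ∃ r : Fin d, t + r + 1 = d ∧ t + mu r < j := by
  induction j generalizing t with
  | zero => simp [h0]
  | succ j ih =>
    by_cases hj : ∃ r : Fin d, j + r + 1 = d + mu r
    · have h4 : f (j + 1) = f j + 1 := by
        have := (h3 j).2 hj
        have := h1 j
        have := h2 j
        omega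
      obtain ⟨r₀, hr₀⟩ := hj
      -- The jump times `t + mu (d - 1 - t)` strictly increase with `t`, so the jumps before the one
      -- of `r₀` are those of the larger indices `r`.
      have key : ∀ r : Fin d, ∀ t : ℕ, t + r + 1 = d → (t + mu r < j ↔ r₀ < r) := by
        intro r t ht
        rcases lt_trichotomy r₀ r with h | h | h
        · have h6 : mu r ≤ mu r₀ := hmu.1 h.le
          have h5 : (r₀ : ℕ) < r := h
          simp only [h, iff_true]
          omega
        · subst h
          simp only [lt_irrefl, iff_false]
          omega
        · have h6 : mu r₀ ≤ mu r := hmu.1 h.le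
          have h5 : (r : ℕ) < r₀ := h
          simp only [h.not_gt, iff_false]
          omega
      have h5 : f j = d - 1 - r₀ := by
        apply le_antisymm
        · by_contra h'
          obtain ⟨r, hr, hr'⟩ := (ih (d - 1 - r₀)).1 (by omega)
          have h6 := (key r _ hr).1 hr'
          have h7 : (r₀ : ℕ) < r := h6
          omega
        · by_contra h'
          have h6 := (ih (d - 1 - r₀ - 1)).2 ⟨⟨r₀ + 1, by omega⟩, by simp only; omega, by
            rw [key _ _ (by simp only; omega)]
            exact Fin.mk_lt_mk.2 (Nat.lt_succ_self _)⟩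
          omega
      rw [h4, h5]
      constructor
      · intro ht
        refine ⟨⟨d - 1 - t, by omega⟩, by simp only; omega, ?_⟩
        rcases (Nat.lt_succ_iff.1 ht).eq_or_lt with h | h
        · have : (⟨d - 1 - t, by omega⟩ : Fin d) = r₀ := Fin.ext (by simp only; omega)
          rw [this]
          omega
        · have := (key ⟨d - 1 - t, by omega⟩ t (by simp only; omega)).2 (Fin.lt_def.2 (by
            simp only; omega))
          omega
      · rintro ⟨r, hr, hr'⟩
        by_contra h'
        have h8 : r < r₀ := Fin.lt_def.2 (by omega)
        have h6 : mu r₀ ≤ mu r := hmu.1 h8.le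
        omega
    · have h4 : f (j + 1) = f j := by
        by_contra h
        exact hj ((h3 j).1 h)
      rw [h4, ih]
      refine exists_congr fun r => and_congr_right fun hr => ?_
      have : j ≠ t + mu r := fun h => hj ⟨r, by omega⟩
      omega

theorem IsTriangleLabel.back_ne_eqv {h g b} (H : IsTriangleLabel h g b) : b ≠ .eqv := by
  cases H <;> simp

theorem EdgeLabel.eq_zero_of_ne {l : EdgeLabel} (h1 : l ≠ .one) (h2 : l ≠ .inner)
    (h3 : l ≠ .eqv) : l = .zero := by
  cases l <;> simp_all

theorem labelPieces_congr {n h : ℕ} {l l' : Edge → EdgeLabel}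
    (H : ∀ t : UnitTriangle, t.Inside (puzzleRegion n h) → ∀ e ∈ t.edges, l e = l' e) :
    labelPieces n h l = labelPieces n h l' := by
  ext p
  simp only [mem_labelPieces]
  refine and_congr_right fun hp => ?_
  obtain ⟨k, x, y⟩ := p
  cases k <;> simp only [Piece.cells, Finset.mem_insert, Finset.mem_singleton,
    forall_eq_or_imp, forall_eq] at hp
  case upTri b =>
    simp only [Piece.Fits]
    rw [H _ hp _ (by simp [UnitTriangle.edges]), H _ hp (.slash x y) (by simp [UnitTriangle.edges]),
      H _ hp (.back x y) (by simp [UnitTriangle.edges])]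
  case downTri b =>
    simp only [Piece.Fits]
    rw [H _ hp _ (by simp [UnitTriangle.edges]),
      H _ hp (.slash (x + 1) y) (by simp [UnitTriangle.edges]),
      H _ hp (.back x y) (by simp [UnitTriangle.edges])]
  all_goals
    simp only [Piece.Fits]
    rw [H _ hp.1 _ (by simp [UnitTriangle.edges])]

/-! ### Continuation of a labeling below the region by vertical columns -/

section extend

variable (n h : ℕ) (l : Edge → EdgeLabel) (a : ℤ) (j : ℕ)

/-- The horizontal labels of the extension of a labeling by vertical columns. -/
def extendHor : EdgeLabel :=
  if (n : ℤ) ≤ a then .zero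
  else if (n : ℤ) - 1 - j - a < -h then l (.hor a (-(h : ℤ))) else l (.hor a (n - 1 - j - a))

/-- The slash labels of the extension of a labeling by vertical columns. -/
def extendSlash : EdgeLabel :=
  if (n : ℤ) ≤ a then .zero
  else if (n : ℤ) - 1 - j - a < -h then .zero else l (.slash a (n - 1 - j - a))

/-- The back labels of the extension of a labeling by vertical columns. -/
def extendBack : EdgeLabel :=
  if (n : ℤ) ≤ a then .zero
  else if (n : ℤ) - 1 - j - a < -h then
    if l (.hor a (-(h : ℤ))) = .one then .inner else .zero
  else l (.back a (n - 1 - j - a))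

end extend

/-- The labels on the boundary of the region of height `h`, except for the south side. -/
structure HasBoundaryLabels {d : ℕ} (n h : ℕ) (l : Edge → EdgeLabel) (lam mu : Fin d → ℕ) :
    Prop where
  east : ∀ j < h, l (.slash n (-(j : ℤ) - 1)) = .zero
  west : ∀ j < h, l (.slash 0 (-(j : ℤ) - 1)) = .zero
  north_east : ∀ a : ℕ, a < n → (l (.back (a : ℤ) ((n : ℤ) - 1 - a)) = .one ↔
    ∃ i : Fin d, a + lam i = n - d + i)
  north_west : ∀ a : ℕ, a < n → (l (.slash 0 (a : ℤ)) = .one ↔ ∃ i : Fin d, a + mu i = n - d + i)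

/-- The initial positions of the paths. -/
def startPosition {d : ℕ} (n : ℕ) (lam : Fin d → ℕ) (i : ℕ) : ℤ :=
  if hi : i < d then (n : ℤ) - d + i - lam ⟨i, hi⟩ else 0

/-- Below the south side every column repeats the label of its south edge, giving `horOne` rhombi or
0-triangles. East of the region everything is zero. The glueing is consistent because no rhombus
crosses the boundary and the east labels are zero. -/
theorem IsLabeling.isStripLabeling {d n h : ℕ} {l : Edge → EdgeLabel} (L : IsLabeling n h l)
    {lam mu : Fin d → ℕ} (hlam : IsBoxPartition d n lam)
    (hn : 0 < n) (hdn : d ≤ n) (hb : HasBoundaryLabels n h l lam mu) :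
    IsStripLabeling d n (startPosition n lam) (extendHor n h l) (extendSlash n h l)
      (extendBack n h l) := by
  have hstart : ∀ i (hi : i < d), startPosition n lam i = (n : ℤ) - d + i - lam ⟨i, hi⟩ :=
    fun i hi => by simp [startPosition, hi]
  have hcol : ∀ a : ℤ, 0 ≤ a → a < n → IsTriangleLabel (l (.hor a (-(h : ℤ)))) .zero
      (if l (.hor a (-(h : ℤ))) = .one then .inner else .zero) := by
    intro a ha ha'
    have h1 := L.south_inner a ha ha'
    have h2 := L.south_eqv a ha ha'
    by_cases h3 : l (.hor a (-(h : ℤ))) = .one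
    · rw [h3, if_pos rfl]
      exact .horOne
    · rw [if_neg h3, EdgeLabel.eq_zero_of_ne h3 h1 h2]
      exact .zeros
  refine ⟨?_, ?_, ?_, ?_, ?_, ?_, ?_, ?_, ?_⟩
  · intro a j ha
    simp only [extendHor, extendSlash, extendBack]
    split_ifs with h1 h2 h3
    · exact .zeros
    · simpa only [h3, if_true] using hcol a ha (by omega)
    · simpa only [h3, if_false] using hcol a ha (by omega)
    · exact L.labeled (.up a (n - 1 - j - a)) (inside_up.2 (by omega))
  · intro a j ha
    simp only [extendHor, extendSlash, extendBack]
    by_cases h1 : (n : ℤ) ≤ a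
    · rw [if_pos h1, if_pos (by omega), if_pos h1]
      exact .zeros
    · rw [if_neg h1, if_neg h1]
      by_cases h2 : (n : ℤ) - 1 - j - a ≤ -h
      · have h3 : (n : ℤ) - 1 - (j + 1 : ℕ) - a < -h := by push_cast; omega
        have h4 : (if (n : ℤ) - 1 - j - a < -h then l (.hor a (-(h : ℤ)))
            else l (.hor a (n - 1 - j - a))) = l (.hor a (-(h : ℤ))) := by
          split_ifs with h5
          · rfl
          · congr 2
            omega
        have h5 : (n : ℤ) - 1 - j - (a + 1) < -h := by omega
        rw [if_pos h3, h4, if_pos h5]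
        simpa using hcol a ha (by omega)
      · have h3 := L.labeled (.down a (n - 1 - j - a - 1)) (inside_down.2 (by omega))
        simp only [UnitTriangle.IsLabeled, sub_add_cancel] at h3
        have h4 : ((n : ℤ) - 1 - (j + 1 : ℕ) - a) = n - 1 - j - a - 1 := by push_cast; ring
        rw [if_neg (by omega : ¬ (n : ℤ) - 1 - j - a < -h), h4,
          if_neg (by omega : ¬ (n : ℤ) - 1 - j - a - 1 < -h)]
        convert h3 using 1
        split_ifs with h5 h6
        · have h7 := hb.east j (by omega)
          rw [← h7]
          congr 2 <;> omega
        · omega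
        · congr 2
          ring
  · intro a j ha
    simp [extendSlash, ha]
  · intro j
    simp only [extendSlash]
    split_ifs
    · simp
    · simp
    · exact L.west hn _ (by omega) (by omega)
  · intro i hi
    have h1 := hstart i hi
    have h2 := hlam.2 ⟨i, hi⟩
    have h3 := (hb.north_east (n - d + i - lam ⟨i, hi⟩) (by omega)).2
      ⟨⟨i, hi⟩, by simp only; omega⟩
    have h4 : ((n - d + i - lam ⟨i, hi⟩ : ℕ) : ℤ) = startPosition n lam i := by omega
    rw [h4] at h3
    simp only [extendBack]
    rw [if_neg (by omega), if_neg (by omega), ← h3]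
    congr 2
    simp
  · intro a ha ha'
    simp only [extendBack]
    split_ifs with h1 h2
    · rfl
    · omega
    · rfl
    · have h3 : (n : ℤ) - 1 - (0 : ℕ) - a = n - 1 - a := by simp
      rw [h3]
      have h4 := L.labeled (.up a (n - 1 - a)) (inside_up.2 (by omega))
      refine EdgeLabel.eq_zero_of_ne (fun h5 => ?_) (L.northEast a ha (by omega)) h4.back_ne_eqv
      have h6 := (hb.north_east a.toNat (by omega))
      rw [Int.toNat_of_nonneg ha] at h6
      obtain ⟨i, hi⟩ := h6.1 h5
      exact ha' i i.2 (by rw [hstart i i.2]; simp only [Fin.eta]; omega)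
  · intro i hi
    have h2 := hlam.2 ⟨i, hi⟩
    rw [hstart i hi]
    omega
  · intro i hi
    rw [hstart i hi]
    omega
  · intro i hi
    have h5 : lam ⟨i + 1, hi⟩ ≤ lam ⟨i, by omega⟩ := hlam.1 (by simp)
    rw [hstart i (by omega), hstart (i + 1) hi]
    push_cast
    omega

/-- Every labeling with the given boundary comes from a path system. -/
theorem IsLabeling.exists_isPathSystem {d n h : ℕ} {l : Edge → EdgeLabel} (L : IsLabeling n h l)
    {lam mu : Fin d → ℕ} (hlam : IsBoxPartition d n lam) (hmu : IsBoxPartition d n mu)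
    (hn : 0 < n) (hd : 0 < d) (hdn : d ≤ n) (hb : HasBoundaryLabels n h l lam mu) :
    ∃ u x, IsPathSystem d n u x ∧ IsSettled d n h u x ∧
      (∀ i : Fin d, x i 0 = (n : ℤ) - d + i - lam i) ∧
      (∀ j, u 0 (j + 1) ≠ u 0 j ↔ ∃ r : Fin d, j + r + 1 = d + mu r) ∧
      labelPieces n h l = labelPieces n h (pathLabels d n u x) := by
  have S := L.isStripLabeling hlam hn hdn hb
  set p := startPosition n lam with hp
  set G := extendSlash n h l with hG
  have hu0 : ∀ j, traceU d p G 0 (j + 1) ≠ traceU d p G 0 j ↔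
      ∃ r : Fin d, j + r + 1 = d + mu r := by
    intro j
    have h1 : traceU d p G 0 (j + 1) ≠ traceU d p G 0 j ↔ G 0 j = .one := by
      rw [S.slash_west_iff, IsStripLabeling.traceU_succ hd]
      simp [hd]
    rw [h1]
    simp only [hG, extendSlash]
    rw [if_neg (by omega)]
    split_ifs with h2
    · simp only [false_iff, not_exists]
      intro r hr
      have := hmu.2 r
      omega
    · by_cases h3 : j < n
      · have h4 := hb.north_west (n - 1 - j) (by omega)
        rw [show ((n - 1 - j : ℕ) : ℤ) = n - 1 - j - 0 by omega] at h4
        rw [h4]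
        exact exists_congr fun r => by omega
      · have h4 := hb.west (j - n) (by omega)
        rw [show -((j - n : ℕ) : ℤ) - 1 = n - 1 - j - 0 by omega] at h4
        rw [h4]
        simp only [reduceCtorEq, false_iff, not_exists]
        intro r hr
        have := hmu.2 r
        omega
  have hcount := lt_count_iff hmu (f := traceU d p G 0) rfl (fun j => Nat.le_add_right _ _)
    (fun j => by rw [IsStripLabeling.traceU_succ hd]; split_ifs <;> omega) hu0
  have T : IsPathSystem d n (traceU d p G) (traceX d p G) := by
    refine S.isPathSystem fun j hj => ?_
    apply le_antisymm
    · by_contra h1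
      obtain ⟨r, hr, -⟩ := (hcount d j).1 (by omega)
      omega
    -- The last triangle of path `0` lies in strip `d - 1 + mu 0`, which is less than `n`.
    · have := (hcount (d - 1) j).2 ⟨⟨0, hd⟩, by simp only; omega, by
        have := hmu.2 ⟨0, hd⟩
        omega⟩
      omega
  refine ⟨traceU d p G, traceX d p G, T, ?_, ?_, hu0, ?_⟩
  -- Below the region the continued back labels are inner or zero, never one, which is what being
  -- settled asks for.
  · intro i hi j hij
    by_contra h1
    have h2 := S.back_eq T (T.x_nonneg i j hi) j
    rw [T.backLabel_at hi, if_pos hij] at h2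
    have h3 := T.x_lt_n i j hi
    simp only [extendBack] at h2
    rw [if_neg (by omega), if_pos (by omega)] at h2
    split_ifs at h2
  · intro i
    simp only [traceX, i.2, if_true, hp, startPosition, dif_pos]
  · have hhor : ∀ a b : ℤ, 0 ≤ a → a < n → -(h : ℤ) ≤ b → a + b + 1 ≤ n →
        l (.hor a b) = pathLabels d n (traceU d p G) (traceX d p G) (.hor a b) := by
      intro a b h1 h2 h3 h4
      have h5 := (S.hor_slash_eq T h1 ((n : ℤ) - 1 - a - b).toNat).1 h2
      simp only [pathLabels]
      rw [← h5]
      simp only [extendHor]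
      rw [if_neg (by omega), if_neg (by omega)]
      congr 2
      omega
    have hslash : ∀ a b : ℤ, 0 ≤ a → a ≤ n → -(h : ℤ) ≤ b → a + b + 1 ≤ n →
        l (.slash a b) = pathLabels d n (traceU d p G) (traceX d p G) (.slash a b) := by
      intro a b h1 h2 h3 h4
      simp only [pathLabels]
      rcases h2.eq_or_lt with rfl | h2
      · rw [T.slashLabel_of_le le_rfl, ← hb.east (-b - 1).toNat (by omega)]
        congr 2
        omega
      · rw [← (S.hor_slash_eq T h1 ((n : ℤ) - 1 - a - b).toNat).2]
        simp only [hG, extendSlash]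
        rw [if_neg (by omega), if_neg (by omega)]
        congr 2
        omega
    have hback : ∀ a b : ℤ, 0 ≤ a → a < n → -(h : ℤ) ≤ b → a + b + 1 ≤ n →
        l (.back a b) = pathLabels d n (traceU d p G) (traceX d p G) (.back a b) := by
      intro a b h1 h2 h3 h4
      simp only [pathLabels]
      rw [← S.back_eq T h1]
      simp only [extendBack]
      rw [if_neg (by omega), if_neg (by omega)]
      congr 2
      omega
    refine labelPieces_congr fun t ht e he => ?_
    cases t with
    | up a b =>
      rw [inside_up] at ht
      simp only [UnitTriangle.edges, Finset.mem_insert, Finset.mem_singleton] at he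
      rcases he with rfl | rfl | rfl
      · exact hhor _ _ (by omega) (by omega) (by omega) (by omega)
      · exact hslash _ _ (by omega) (by omega) (by omega) (by omega)
      · exact hback _ _ (by omega) (by omega) (by omega) (by omega)
    | down a b =>
      rw [inside_down] at ht
      simp only [UnitTriangle.edges, Finset.mem_insert, Finset.mem_singleton] at he
      rcases he with rfl | rfl | rfl
      · exact hhor _ _ (by omega) (by omega) (by omega) (by omega)
      · exact hslash _ _ (by omega) (by omega) (by omega) (by omega)
      · exact hback _ _ (by omega) (by omega) (by omega) (by omega)

/-- Every puzzle comes from a path system. -/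
theorem exists_isPathSystem_of_mem {d n h : ℕ} {lam mu nu : Fin d → ℕ}
    (hlam : IsBoxPartition d n lam) (hmu : IsBoxPartition d n mu) (hnu : IsBoxPartition d n nu)
    (hd : 0 < d) (hdn : d ≤ n) {P : Finset Piece} (hP : P ∈ HeightPuzzles n h lam mu nu) :
    ∃ u x, IsPathSystem d n u x ∧ IsSettled d n h u x ∧ HasBoundary n u x lam mu nu ∧
      P = labelPieces n h (pathLabels d n u x) := by
  have hn : 0 < n := by omega
  obtain ⟨hpart, hE, hW, hNE, hNW, hS⟩ := hP
  have L := hpart.isLabeling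
  have hPl := hpart.eq_labelPieces
  set l := pieceLabels P
  rw [word_northEast_iff hdn hlam] at hNE
  rw [word_northWest_iff hdn hmu] at hNW
  rw [word_hor_iff hdn hnu] at hS
  have hb : HasBoundaryLabels n h l lam mu := by
    refine ⟨fun j hj => ?_, fun j hj => ?_, fun a ha => ?_, fun a ha => ?_⟩
    · have := hE j hj
      rwa [hPl, L.hasLabel_iff (t := .down (n - 1) (-j - 1)) (inside_down.2 (by omega))
        (by simp [edge_slash_mem])] at this
    · have := hW j hj
      rwa [hPl, L.hasLabel_iff (t := .up 0 (-j - 1)) (inside_up.2 (by omega))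
        (by simp [edge_slash_mem])] at this
    · have := hNE a ha
      rwa [hPl, L.hasLabel_iff (t := .up a (n - 1 - a)) (inside_up.2 (by omega))
        (by simp [edge_back_mem])] at this
    · have := hNW a ha
      rwa [hPl, L.hasLabel_iff (t := .up 0 a) (inside_up.2 (by omega))
        (by simp [edge_slash_mem])] at this
  obtain ⟨u, x, T, hs, h1, h2, h3⟩ := L.exists_isPathSystem hlam hmu hn hd hdn hb
  refine ⟨u, x, T, hs, ⟨h1, h2, ?_⟩, hPl.trans h3⟩
  have hPl' : P = labelPieces n h (pathLabels d n u x) := hPl.trans h3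
  have hS' : partsOfWord ((List.range n).map fun a : ℕ => decide (∃ i < d, (x i n).toNat = a)) =
      List.ofFn nu := by
    rw [partsOfWord_eq_ofFn_iff hdn hnu]
    intro a ha
    rw [← hS a ha, hPl', (T.isLabeling hs).hasLabel_iff (t := .up a (-h))
      (inside_up.2 (by omega)) (by simp [edge_hor_mem]), decide_eq_true_iff]
    simp only [pathLabels, EdgeLabel.ofBool]
    rw [T.horLabel_of_le hs (by omega)]
    have h4 : (∃ i < d, (x i n).toNat = a) ↔ ∃ i < d, x i n = a :=
      exists_congr fun i => and_congr_right fun hi => by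
        have := T.x_nonneg i n hi
        omega
    rw [h4]
    simp
  have h5 := partsOfWord_positions n 0 d (fun i => (x i n).toNat) (fun i hi => by
    have := T.x_nonneg i n hi
    have := T.x_lt_n i n hi
    omega) (fun i hi => by
      have := T.x_nonneg i n (by omega)
      have := T.x_lt i n hi
      omega)
  rw [← List.range_eq_range', hS'] at h5
  intro i
  have h6 : nu i = 0 + n + i - ((x i n).toNat + d) := by
    have h7 : (List.ofFn nu)[(i : ℕ)]? = some (nu i) := by simp
    rw [h5] at h7
    simpa using h7.symm
  -- The paths to the right of path `i` take up the last columns; this makes the truncated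
  -- subtraction in the formula for `nu i` exact.
  have h8 : ∀ k, k < d → x (d - 1 - k) n + k + 1 ≤ n := by
    intro k hk
    induction k with
    | zero =>
      have := T.x_lt_n (d - 1 - 0) n (by omega)
      push_cast
      omega
    | succ k ih =>
      have h9 := ih (by omega)
      have := T.x_lt (d - 1 - (k + 1)) n (by omega)
      rw [show d - 1 - (k + 1) + 1 = d - 1 - k by omega] at this
      push_cast
      omega
  have h10 := h8 (d - 1 - i) (by omega)
  rw [show d - 1 - (d - 1 - (i : ℕ)) = i by omega] at h10
  have := T.x_nonneg i n i.2
  omega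

/-! ### The path system of a tableau -/

/-- The predicate holds on an initial segment of the range, so its count is the length of that
segment. -/
theorem lt_count_iff_of_antitone {p : ℕ → Prop} [DecidablePred p] {m : ℕ}
    (hp : ∀ k, k + 1 < m → p (k + 1) → p k) (k : ℕ) : k < Nat.count p m ↔ k < m ∧ p k := by
  induction m generalizing k with
  | zero => simp
  | succ m ih =>
    have ih' := ih fun k hk => hp k (by omega)
    rw [Nat.count_succ]
    split_ifs with hm
    · have hall : ∀ e, e ≤ m → p (m - e) := fun e => by
        induction e with
        | zero => simpa using hm
        | succ e ihe =>
          intro he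
          have := ihe (by omega)
          rw [show m - e = m - (e + 1) + 1 by omega] at this
          exact hp _ (by omega) this
      have h1 : m ≤ Nat.count p m := by
        by_contra h
        have h2 := hall (m - Nat.count p m) (by omega)
        rw [show m - (m - Nat.count p m) = Nat.count p m by omega] at h2
        exact absurd ((ih' _).2 ⟨by omega, h2⟩) (lt_irrefl _)
      have h2 : Nat.count p m ≤ m := Nat.count_le _
      constructor
      · intro h
        refine ⟨by omega, ?_⟩
        have := hall (m - k) (by omega)
        rwa [show m - (m - k) = k by omega] at this
      · rintro ⟨h, -⟩
        omega
    · rw [add_zero, ih']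
      constructor
      · rintro ⟨h, h'⟩
        exact ⟨by omega, h'⟩
      · rintro ⟨h, h'⟩
        refine ⟨lt_of_le_of_ne (by omega) ?_, h'⟩
        rintro rfl
        exact hm h'

/-- The values of a tableau whose rows have the lengths `M 0 ≤ M 1 ≤ …` from top to bottom, with
columns numbered from right to left. -/
structure IsTableauArray (d n : ℕ) (M : ℕ → ℕ) (V : ℕ → ℕ → ℕ) : Prop where
  le : d ≤ n
  mono : ∀ t, t + 1 < d → M t ≤ M (t + 1)
  length_le : ∀ t, t < d → M t ≤ n - d
  row : ∀ t c, t < d → c + 1 < M t → V t (c + 1) ≤ V t c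
  col : ∀ t c, t + 1 < d → c < M t → V t c < V (t + 1) c
  lt : ∀ t c, t < d → c < M t → V t c < d

section array

variable (d n : ℕ) (M : ℕ → ℕ) (V : ℕ → ℕ → ℕ) (bar : ℕ → ℕ → Bool)

/-- The `k`-th upward pointing 1-triangle on the path `i` comes before the line `j`. -/
def TrianglePast (i k j : ℕ) : Prop := k < j ∧ ¬ (j - k - 1 < M (i + k) ∧ i ≤ V (i + k) (j - k - 1))

instance (i k j : ℕ) : Decidable (TrianglePast M V i k j) :=
  inferInstanceAs (Decidable (_ ∧ ¬ (_ ∧ _)))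

/-- The number of upward pointing 1-triangles on the path `i` before the line `j`. -/
def arrayU (i j : ℕ) : ℕ := Nat.count (fun k => TrianglePast M V i k j) (d - i)

/-- The path `i` has a rhombus with horizontal edges labelled 0 in the strip `j`. -/
def IsUnbarredStep (u : ℕ → ℕ → ℕ) (i j : ℕ) : Prop :=
  u i (j + 1) = u (i + 1) j ∧ bar (i + u i j) (j - u i j) = false

instance (u : ℕ → ℕ → ℕ) (i j : ℕ) : Decidable (IsUnbarredStep bar u i j) :=
  inferInstanceAs (Decidable (_ ∧ _))

/-- The number of unbarred steps of the path `i` before the line `j`. -/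
def arrayCount (i j : ℕ) : ℕ := Nat.count (IsUnbarredStep bar (arrayU d M V) i) j

/-- The position of the path `i` on the line `j`. -/
def arrayX (lam : Fin d → ℕ) (i j : ℕ) : ℤ :=
  if i < d then startPosition n lam i - arrayCount d M V bar i j else 0

end array

namespace IsTableauArray

variable {d n : ℕ} {M : ℕ → ℕ} {V : ℕ → ℕ → ℕ} (A : IsTableauArray d n M V)
include A

local notation "u" => arrayU d M V

/-- Rows get longer downward, so each column reaches the bottom row `d - 1`, where values are less
than `d`; strict increase along the column gives the bound. It keeps `t - V t c` from being
truncated. -/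
theorem le_row {t c : ℕ} (ht : t < d) (hc : c < M t) : V t c ≤ t := by
  have key : ∀ e t, t + e + 1 = d → ∀ c, c < M t → V t c ≤ t := fun e => by
    induction e with
    | zero =>
      intro t ht c hc
      have := A.lt t c (by omega) hc
      omega
    | succ e ih =>
      intro t ht c hc
      have h1 := A.mono t (by omega)
      have h2 := ih (t + 1) (by omega) c (by omega)
      have h3 := A.col t c (by omega) hc
      omega
  exact key (d - 1 - t) t (by omega) c hc

/-- The triangles of a path are passed in order: if number `k + 1` is past, so is number `k`,
because moving up one row and left one column does not raise the value. Thus `arrayU` counts an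
initial segment, and its inequalities can be tested triangle by triangle. -/
theorem lt_arrayU_iff (i k j : ℕ) : k < u i j ↔ k < d - i ∧ TrianglePast M V i k j := by
  refine lt_count_iff_of_antitone (fun k hk => ?_) k
  rintro ⟨h1, h2⟩
  refine ⟨by omega, fun ⟨h3, h4⟩ => h2 ?_⟩
  have h5 := A.mono (i + k) (by omega)
  have h6 := A.col (i + k) (j - k - 1) (by omega) h3
  have h7 := A.row (i + k + 1) (j - (k + 1) - 1) (by omega) (by omega)
  rw [show j - (k + 1) - 1 + 1 = j - k - 1 by omega] at h7
  rw [show i + (k + 1) = i + k + 1 by omega]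
  exact ⟨by omega, by omega⟩

omit A in
theorem arrayU_le_sub (i j : ℕ) : u i j ≤ d - i := Nat.count_le _

theorem arrayU_mono (i j : ℕ) : u i j ≤ u i (j + 1) := by
  by_contra h
  have h1 := (A.lt_arrayU_iff i (u i (j + 1)) j).1 (by omega)
  refine absurd ((A.lt_arrayU_iff i (u i (j + 1)) (j + 1)).2 ?_) (lt_irrefl _)
  generalize u i (j + 1) = k at h1
  obtain ⟨h1, h2, h3⟩ := h1
  refine ⟨h1, by omega, fun ⟨h4, h5⟩ => h3 ?_⟩
  have h6 := A.row (i + k) (j - k - 1) (by omega) (by omega)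
  rw [show j - k - 1 + 1 = j + 1 - k - 1 by omega] at h6
  exact ⟨by omega, by omega⟩

/-- Column strictness is what is used: an entry `≥ i` in row `i + k` has an entry `≥ i + 1` below
it. -/
theorem arrayU_succ_le (i j : ℕ) : u (i + 1) j ≤ u i j := by
  by_contra h
  have h1 := (A.lt_arrayU_iff (i + 1) (u i j) j).1 (by omega)
  refine absurd ((A.lt_arrayU_iff i (u i j) j).2 ?_) (lt_irrefl _)
  generalize u i j = k at h1
  obtain ⟨h1, h2, h3⟩ := h1
  refine ⟨by omega, by omega, fun ⟨h4, h5⟩ => h3 ?_⟩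
  have h6 := A.mono (i + k) (by omega)
  have h7 := A.col (i + k) (j - k - 1) (by omega) (by omega)
  rw [show i + 1 + k = i + k + 1 by omega]
  exact ⟨by omega, by omega⟩

/-- Triangle `k + 1` of path `i` and triangle `k` of path `i + 1` lie on the beam of the same row `i
+ k + 1`, and the former comes in a strictly later strip, since a row has at least as many entries
`≥ i` as entries `≥ i + 1`. -/
theorem arrayU_le_succ (i j : ℕ) : u i (j + 1) ≤ u (i + 1) j + 1 := by
  by_contra h
  have h1 := (A.lt_arrayU_iff i (u (i + 1) j + 1) (j + 1)).1 (by omega)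
  refine absurd ((A.lt_arrayU_iff (i + 1) (u (i + 1) j) j).2 ?_) (lt_irrefl _)
  generalize u (i + 1) j = k at h1
  obtain ⟨h1, h2, h3⟩ := h1
  refine ⟨by omega, by omega, fun ⟨h4, h5⟩ => h3 ?_⟩
  rw [show i + (k + 1) = i + 1 + k by omega, show j + 1 - (k + 1) - 1 = j - k - 1 by omega]
  exact ⟨h4, by omega⟩

theorem arrayU_final (i j : ℕ) (hj : n ≤ j) : u i j = d - i := by
  apply le_antisymm (arrayU_le_sub i j)
  by_contra h
  refine absurd ((A.lt_arrayU_iff i (u i j) j).2 ⟨by omega, ?_⟩) (lt_irrefl _)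
  have h1 := A.le
  generalize u i j = k at h
  refine ⟨by omega, fun ⟨h4, h5⟩ => ?_⟩
  have := A.length_le (i + k) (by omega)
  omega

theorem length_mono {t t' : ℕ} (h : t ≤ t') (ht' : t' < d) : M t ≤ M t' := by
  induction t', h using Nat.le_induction with
  | base => exact le_rfl
  | succ k hk ih => exact (ih (by omega)).trans (A.mono k ht')

theorem row_le {t c c' : ℕ} (ht : t < d) (h : c ≤ c') (hc' : c' < M t) : V t c' ≤ V t c := by
  induction c', h using Nat.le_induction with
  | base => exact le_rfl
  | succ k hk ih => exact (A.row t k ht hc').trans (ih (by omega))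

theorem col_add {t t' c : ℕ} (h : t ≤ t') (ht' : t' < d) (hc : c < M t) :
    V t c + (t' - t) ≤ V t' c := by
  induction t', h using Nat.le_induction with
  | base => simp
  | succ k hk ih =>
    have h1 := ih (by omega)
    have h2 := A.col k c ht' (hc.trans_le (A.length_mono hk (by omega)))
    omega

/-- Values increase from a box to the boxes below and to the right of it. -/
theorem add_le {t t' c c' : ℕ} (h : t ≤ t') (ht' : t' < d) (hc : c < M t) (h' : c' ≤ c) :
    V t c + (t' - t) ≤ V t' c' :=
  (A.col_add h ht' hc).trans (A.row_le ht' h' (hc.trans_le (A.length_mono h ht')))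

/-- In strip `t - i + c`, with `i` the value of the box, the triangle of path `i` on the beam of row
`t` is still to come since the entry is `≥ i`. That of path `i + 1` has been passed since the entry
is not `≥ i + 1`. Monotonicity in both indices squeezes all three counts to `t - i`. -/
theorem letter_of_box {t c : ℕ} (ht : t < d) (hc : c < M t) :
    u (V t c) (t - V t c + c) = t - V t c ∧ u (V t c) (t - V t c + c + 1) = t - V t c ∧
      u (V t c + 1) (t - V t c + c) = t - V t c := by
  have h0 := A.le_row ht hc
  generalize hi : V t c = i at h0
  have h1 : u i (t - i + c + 1) ≤ t - i := by
    by_contra h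
    have h2 := (A.lt_arrayU_iff i (t - i) (t - i + c + 1)).1 (by omega)
    refine h2.2.2 ?_
    rw [show i + (t - i) = t by omega, show t - i + c + 1 - (t - i) - 1 = c by omega]
    exact ⟨hc, hi.ge⟩
  have h2 : t - i ≤ u (i + 1) (t - i + c) := by
    by_contra h
    refine h ?_
    have h3 := (A.lt_arrayU_iff (i + 1) (t - i - 1) (t - i + c)).2 ⟨by omega, by omega, ?_⟩
    · omega
    · rw [show i + 1 + (t - i - 1) = t by omega, show t - i + c - (t - i - 1) - 1 = c by omega]
      rintro ⟨-, h4⟩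
      omega
  have h3 := A.arrayU_mono i (t - i + c)
  have h4 := A.arrayU_succ_le i (t - i + c)
  omega

/-- The triangle number `u i j` of path `i` is not passed in strip `j`, so the entry exists and is
at least `i`; the preceding triangle of path `i + 1`, on the same beam, is already passed, so the
entry is at most `i`. If there is no preceding triangle, `le_row` gives the upper bound. -/
theorem box_of_letter {i j : ℕ} (hi : i < d) (h : u i (j + 1) = u (i + 1) j) :
    u i j ≤ j ∧ i + u i j < d ∧ j - u i j < M (i + u i j) ∧ V (i + u i j) (j - u i j) = i := by
  have h1 := A.arrayU_mono i j
  have h2 := A.arrayU_succ_le i j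
  have h3 : u (i + 1) j ≤ d - (i + 1) := arrayU_le_sub (i + 1) j
  have h4 : u i j ≤ j := by
    by_contra h4
    have := ((A.lt_arrayU_iff i j j).1 (by omega)).2.1
    omega
  have h5 : j - u i j < M (i + u i j) ∧ i ≤ V (i + u i j) (j - u i j) := by
    by_contra h5
    have h6 := (A.lt_arrayU_iff i (u i j) (j + 1)).2 ⟨by omega, by omega, by
      rwa [show j + 1 - u i j - 1 = j - u i j by omega]⟩
    omega
  refine ⟨h4, by omega, h5.1, le_antisymm ?_ h5.2⟩
  rcases Nat.eq_zero_or_pos (u i j) with h6 | h6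
  · have := A.le_row (t := i + u i j) (c := j - u i j) (by omega) h5.1
    omega
  · have h7 := (A.lt_arrayU_iff (i + 1) (u i j - 1) j).1 (by omega)
    by_contra h8
    refine h7.2.2 ?_
    rw [show i + 1 + (u i j - 1) = i + u i j by omega,
      show j - (u i j - 1) - 1 = j - u i j by omega]
    exact ⟨h5.1, by omega⟩

theorem arrayCount_final (bar : ℕ → ℕ → Bool) {i j : ℕ} (hi : i < d) (hj : n ≤ j) :
    arrayCount d M V bar i j = arrayCount d M V bar i n := by
  induction j, hj using Nat.le_induction with
  | base => rfl
  | succ j hj ih =>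
    rw [← ih, arrayCount, arrayCount, Nat.count_succ, if_neg, add_zero]
    rintro ⟨h, -⟩
    rw [A.arrayU_final i (j + 1) (by omega), A.arrayU_final (i + 1) j hj] at h
    omega

/-- Positions are starting positions minus counts of unbarred steps, so `hcross` is disjointness of
the paths, and `hfinal` keeps the last positions at least `0` as the parts of `nu` are at most `n -
d`. -/
theorem isPathSystem (bar : ℕ → ℕ → Bool) {lam nu : Fin d → ℕ} (hnu : IsBoxPartition d n nu)
    (hcross : ∀ i (hi : i + 1 < d) j, lam ⟨i + 1, hi⟩ + arrayCount d M V bar (i + 1) j ≤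
      lam ⟨i, by omega⟩ + arrayCount d M V bar i j)
    (hfinal : ∀ i : Fin d, lam i + arrayCount d M V bar i n = nu i) :
    IsPathSystem d n u (arrayX d n M V bar lam) where
  u_zero i := by
    by_contra h
    have := ((A.lt_arrayU_iff i 0 0).1 (by omega)).2.1
    omega
  u_last i j hi := by
    have : u i j ≤ d - i := arrayU_le_sub i j
    omega
  u_mono := A.arrayU_mono
  u_le := A.arrayU_succ_le
  u_step := A.arrayU_le_succ
  u_final := A.arrayU_final
  x_off i j hi := by simp [arrayX, not_lt.2 hi]
  x_step i j hi := by
    simp only [arrayX, if_pos hi, arrayCount, Nat.count_succ]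
    split_ifs with h
    · right
      exact ⟨by push_cast; ring, h.1⟩
    · left
      simp
  x_lt i j hi := by
    simp only [arrayX, if_pos hi, if_pos (show i < d by omega), startPosition, dif_pos hi,
      dif_pos (show i < d by omega)]
    have := hcross i hi j
    push_cast
    omega
  x_nonneg i j hi := by
    simp only [arrayX, if_pos hi, startPosition, dif_pos hi]
    have h1 := hfinal ⟨i, hi⟩
    have h2 := hnu.2 ⟨i, hi⟩
    have h3 : arrayCount d M V bar i j ≤ arrayCount d M V bar i n := by
      rcases le_total n j with h | h
      · exact (A.arrayCount_final bar hi h).le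
      · exact Nat.count_monotone _ h
    have h4 := A.le
    simp only at h1
    omega
  x_lt_n i j hi := by
    simp only [arrayX, if_pos hi, startPosition, dif_pos hi]
    omega

theorem hasBoundary (bar : ℕ → ℕ → Bool) {lam mu nu : Fin d → ℕ}
    (hM : ∀ r : Fin d, M (d - 1 - r) = mu r)
    (hfinal : ∀ i : Fin d, lam i + arrayCount d M V bar i n = nu i) :
    HasBoundary n u (arrayX d n M V bar lam) lam mu nu where
  north_east i := by
    simp [arrayX, arrayCount, startPosition]
  north_west j := by
    -- All entries are `≥ 0`, so the beam of row `k` reaches the NW side, past path `0`, in strip `k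
    -- + M k`.
    have h : ∀ k j, k < u 0 j ↔ k < d ∧ k + M k < j := fun k j => by
      rw [A.lt_arrayU_iff, TrianglePast]
      simp only [zero_add, Nat.zero_le, and_true]
      omega
    constructor
    · intro h1
      have h2 := A.arrayU_mono 0 j
      have h3 := (h (u 0 j) (j + 1)).1 (by omega)
      have h4 := (not_congr (h (u 0 j) j)).1 (lt_irrefl _)
      have h5 := hM ⟨d - 1 - u 0 j, by omega⟩
      simp only at h5
      rw [show d - 1 - (d - 1 - u 0 j) = u 0 j by omega] at h5
      exact ⟨⟨d - 1 - u 0 j, by omega⟩, by simp only; omega⟩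
    · rintro ⟨r, hr⟩ h1
      have h2 := h (d - 1 - r) (j + 1)
      have h3 := h (d - 1 - r) j
      rw [hM] at h2 h3
      rw [h1] at h2
      omega
  south i := by
    have := hfinal i
    simp only [arrayX, if_pos i.2, startPosition, dif_pos i.2, Fin.eta]
    omega

end IsTableauArray

/-! ### Littlewood-Richardson tableaux as arrays -/

/-- The length of the `t`-th row from the top of the reverse diagram of `mu`. -/
def rowLength {d : ℕ} (mu : Fin d → ℕ) (t : ℕ) : ℕ :=
  if h : t < d then mu ⟨d - 1 - t, by omega⟩ else 0

theorem rowLength_eq {d : ℕ} (mu : Fin d → ℕ) {t : ℕ} {r : Fin d} (h : t + r + 1 = d) :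
    rowLength mu t = mu r := by
  rw [rowLength, dif_pos (by omega)]
  congr 1
  exact Fin.ext (by simp only; omega)

/-- The boxes of the skew diagram are those of `lam` and those of `mu`. -/
def boxEquiv {d : ℕ} (lam mu : Fin d → ℕ) :
    Box lam mu ≃ ((i : Fin d) × Fin (lam i)) ⊕ ((r : Fin d) × Fin (mu r)) where
  toFun b := match b with
    | .top i j => .inl ⟨i, j⟩
    | .bot r c => .inr ⟨r, c⟩
  invFun b := match b with
    | .inl a => .top a.1 a.2
    | .inr a => .bot a.1 a.2
  left_inv b := by cases b <;> rfl
  right_inv b := by rcases b with a | a <;> rfl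

theorem card_filter_box {d : ℕ} {lam mu : Fin d → ℕ} (p : Box lam mu → Prop) [DecidablePred p] :
    (Finset.univ.filter p).card =
      (Finset.univ.filter fun a : (i : Fin d) × Fin (lam i) => p (.top a.1 a.2)).card +
      (Finset.univ.filter fun a : (r : Fin d) × Fin (mu r) => p (.bot a.1 a.2)).card := by
  rw [Finset.card_filter, Finset.card_filter, Finset.card_filter,
    ← (boxEquiv lam mu).symm.sum_comp, Fintype.sum_sum_type]
  rfl

theorem card_filter_row {d : ℕ} (lam : Fin d → ℕ) (k : Fin d) :
    (Finset.univ.filter fun a : (i : Fin d) × Fin (lam i) => a.1 = k).card = lam k := by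
  rw [Finset.card_filter, Fintype.sum_sigma, Finset.sum_eq_single k]
  · simp
  · intro i _ hi
    simp [hi]
  · simp

namespace SkewBarredTableau

variable {d : ℕ} {lam mu : Fin d → ℕ} (L : SkewBarredTableau lam mu)

/-- The value in row `t` from the top and column `c` from the right of the diagram of `mu`. -/
def val (t c : ℕ) : ℕ :=
  if ht : t < d then
    if hc : c < mu ⟨d - 1 - t, by omega⟩ then (L.bot ⟨d - 1 - t, by omega⟩ ⟨c, hc⟩).1 else 0
  else 0

/-- The bar in row `t` from the top and column `c` from the right of the diagram of `mu`. -/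
def bar (t c : ℕ) : Bool :=
  if ht : t < d then
    if hc : c < mu ⟨d - 1 - t, by omega⟩ then (L.bot ⟨d - 1 - t, by omega⟩ ⟨c, hc⟩).2 else false
  else false

theorem val_eq {t : ℕ} {r : Fin d} (h : t + r + 1 = d) (c : Fin (mu r)) :
    L.val t c = (L.bot r c).1 := by
  obtain ⟨r, hr⟩ := r
  have ht : t < d := by simp only at h; omega
  obtain rfl : r = d - 1 - t := by simp only at h; omega
  simp [val, ht]

theorem bar_eq {t : ℕ} {r : Fin d} (h : t + r + 1 = d) (c : Fin (mu r)) :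
    L.bar t c = (L.bot r c).2 := by
  obtain ⟨r, hr⟩ := r
  have ht : t < d := by simp only at h; omega
  obtain rfl : r = d - 1 - t := by simp only at h; omega
  simp [bar, ht]

theorem isTableauArray {n : ℕ} (hdn : d ≤ n) (hmu : IsBoxPartition d n mu) :
    IsTableauArray d n (rowLength mu) L.val where
  le := hdn
  mono t ht := by
    rw [rowLength_eq mu (r := ⟨d - 1 - t, by omega⟩) (by simp only; omega),
      rowLength_eq mu (r := ⟨d - 1 - (t + 1), by omega⟩) (by simp only; omega)]
    exact hmu.1 (Fin.mk_le_mk.2 (by omega))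
  length_le t ht := by
    rw [rowLength_eq mu (r := ⟨d - 1 - t, by omega⟩) (by simp only; omega)]
    exact hmu.2 _
  row t c ht hc := by
    have h : t + (⟨d - 1 - t, by omega⟩ : Fin d) + 1 = d := by simp only; omega
    rw [rowLength_eq mu h] at hc
    have h1 := L.val_eq h ⟨c, by omega⟩
    have h2 := L.val_eq h ⟨c + 1, hc⟩
    simp only at h1 h2
    rw [h1, h2]
    exact L.bot_row _ _ _ (Fin.mk_le_mk.2 (by omega))
  col t c ht hc := by
    have h : t + (⟨d - 1 - t, by omega⟩ : Fin d) + 1 = d := by simp only; omega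
    have h' : (t + 1) + (⟨d - 1 - (t + 1), by omega⟩ : Fin d) + 1 = d := by simp only; omega
    rw [rowLength_eq mu h] at hc
    have h3 : mu ⟨d - 1 - t, by omega⟩ ≤ mu ⟨d - 1 - (t + 1), by omega⟩ :=
      hmu.1 (Fin.mk_le_mk.2 (by omega))
    have h1 := L.val_eq h ⟨c, hc⟩
    have h2 := L.val_eq h' ⟨c, by omega⟩
    simp only at h1 h2
    rw [h1, h2]
    exact L.bot_col _ _ _ _ rfl (Fin.mk_lt_mk.2 (by omega))
  lt t c ht hc := by
    have h : t + (⟨d - 1 - t, by omega⟩ : Fin d) + 1 = d := by simp only; omega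
    rw [rowLength_eq mu h] at hc
    have h1 := L.val_eq h ⟨c, hc⟩
    simp only at h1
    rw [h1]
    exact (L.bot _ _).1.2

/-- The number of unbarred entries `k` of the part of shape `mu` before the time `j`. -/
theorem card_bot {n : ℕ} (hdn : d ≤ n) (hmu : IsBoxPartition d n mu) (k : Fin d) (j : ℕ) :
    (Finset.univ.filter fun a : (r : Fin d) × Fin (mu r) =>
      L.bot a.1 a.2 = (k, false) ∧ d - 1 - a.1 - k + a.2 < j).card =
      arrayCount d (rowLength mu) L.val L.bar k j := by
  have A := L.isTableauArray hdn hmu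
  rw [arrayCount, Nat.count_eq_card_filter_range]
  -- A box of value `k` in row `t = d - 1 - r` from the top is sent to its strip `t - k + c`.
  refine Finset.card_bij (fun a _ => d - 1 - a.1 - k + a.2) ?_ ?_ ?_
  · rintro ⟨r, c⟩ ha
    simp only [Finset.mem_filter, Finset.mem_univ, true_and] at ha
    obtain ⟨h1, h2⟩ := ha
    simp only [Finset.mem_filter, Finset.mem_range]
    refine ⟨h2, ?_⟩
    have h : d - 1 - r + r + 1 = d := by omega
    have h3 := L.val_eq h c
    rw [h1] at h3
    have hc : (c : ℕ) < rowLength mu (d - 1 - r) := by rw [rowLength_eq mu h]; exact c.2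
    have h4 := A.letter_of_box (by omega) hc
    have h5 := A.le_row (by omega) hc
    rw [h3] at h4 h5
    simp only at h4 h5
    refine ⟨by omega, ?_⟩
    rw [h4.1, show (k : ℕ) + (d - 1 - r - k) = d - 1 - r by omega,
      show d - 1 - (r : ℕ) - k + c - (d - 1 - r - k) = c by omega, L.bar_eq h c, h1]
  · rintro ⟨r, c⟩ ha ⟨r', c'⟩ ha' hrc
    simp only [Finset.mem_filter, Finset.mem_univ, true_and] at ha ha' hrc
    have h : d - 1 - r + r + 1 = d := by omega
    have h' : d - 1 - r' + r' + 1 = d := by omega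
    have h3 := L.val_eq h c
    have h3' := L.val_eq h' c'
    rw [ha.1] at h3
    rw [ha'.1] at h3'
    have hc : (c : ℕ) < rowLength mu (d - 1 - r) := by rw [rowLength_eq mu h]; exact c.2
    have hc' : (c' : ℕ) < rowLength mu (d - 1 - r') := by rw [rowLength_eq mu h']; exact c'.2
    have h4 := A.letter_of_box (by omega) hc
    have h5 := A.le_row (by omega) hc
    have h4' := A.letter_of_box (by omega) hc'
    have h5' := A.le_row (by omega) hc'
    rw [h3] at h4 h5
    rw [h3'] at h4' h5'
    simp only at h4 h5 h4' h5'
    rw [hrc] at h4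
    have hr : r = r' := Fin.ext (by omega)
    subst hr
    have hc : c = c' := Fin.ext (by omega)
    subst hc
    rfl
  · intro j' hj'
    simp only [Finset.mem_filter, Finset.mem_range] at hj'
    obtain ⟨h1, h2, h3⟩ := hj'
    obtain ⟨h4, h5, h6, h7⟩ := A.box_of_letter k.2 h2
    generalize arrayU d (rowLength mu) L.val k j' = m at h3 h4 h5 h6 h7
    have h : k + m + (⟨d - 1 - (k + m), by omega⟩ : Fin d) + 1 = d := by simp only; omega
    rw [rowLength_eq mu h] at h6
    have h8 := L.val_eq h ⟨j' - m, h6⟩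
    have h9 := L.bar_eq h ⟨j' - m, h6⟩
    simp only at h8 h9
    refine ⟨⟨⟨d - 1 - (k + m), by omega⟩, ⟨j' - m, h6⟩⟩, ?_, ?_⟩
    · simp only [Finset.mem_filter, Finset.mem_univ, true_and]
      refine ⟨Prod.ext (Fin.ext ?_) ?_, by omega⟩
      · rw [← h8, h7]
      · rw [← h9, h3]
    · simp only
      omega

end SkewBarredTableau

/-! ### Reading order, strips and the Yamanouchi condition -/

theorem Box.Before.trans {d : ℕ} {lam mu : Fin d → ℕ} {a b c : Box lam mu} (h : a.Before b)
    (h' : b.Before c) : a.Before c := by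
  cases a <;> cases b <;> cases c <;> simp only [Box.Before, Fin.lt_def] at h h' ⊢ <;> omega

namespace SkewBarredTableau

variable {d n : ℕ} {lam mu : Fin d → ℕ} (L : SkewBarredTableau lam mu)

section

variable (hdn : d ≤ n) (hmu : IsBoxPartition d n mu)
include hdn hmu

theorem value_le (r : Fin d) (c : Fin (mu r)) : ((L.bot r c).1 : ℕ) ≤ d - 1 - r := by
  have h : d - 1 - r + r + 1 = d := by omega
  rw [← L.val_eq h c]
  exact (L.isTableauArray hdn hmu).le_row (by omega) (by rw [rowLength_eq mu h]; exact c.2)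

/-- Boxes above and to the left of a box hold smaller values. -/
theorem value_add_le {r r' : Fin d} {c : Fin (mu r)} {c' : Fin (mu r')} (h : r' ≤ r)
    (hc : (c' : ℕ) ≤ c) : ((L.bot r c).1 : ℕ) + (r - r') ≤ (L.bot r' c').1 := by
  have h1 : d - 1 - r + r + 1 = d := by omega
  have h2 : d - 1 - r' + r' + 1 = d := by omega
  have h3 : (r' : ℕ) ≤ r := h
  rw [← L.val_eq h1 c, ← L.val_eq h2 c']
  have := (L.isTableauArray hdn hmu).add_le (t := d - 1 - r) (t' := d - 1 - r') (c := c) (by omega)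
    (by omega) (by rw [rowLength_eq mu h1]; exact c.2) hc
  omega

/-- Of two boxes with equal values in different rows, the lower one lies strictly further left, by
at least the number of rows... in any case strictly, so passing to it raises both the column and the
strip `t - k + c`. Hence reading order and strip order agree on boxes of one value. -/
theorem before_iff {r r' : Fin d} {c : Fin (mu r)} {c' : Fin (mu r')}
    (h : (L.bot r c).1 = (L.bot r' c').1) :
    (Box.bot r c : Box lam mu).Before (.bot r' c') ↔
      d - 1 - r - ((L.bot r' c').1 : ℕ) + c < d - 1 - r' - ((L.bot r' c').1 : ℕ) + c' := by
  have h1 := L.value_le hdn hmu r c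
  have h2 := L.value_le hdn hmu r' c'
  rw [h] at h1
  simp only [Box.Before]
  rcases lt_trichotomy r r' with h3 | rfl | h3
  · have h4 : (c' : ℕ) < c := by
      by_contra h4
      have h5 := L.value_add_le hdn hmu (c := c') (c' := c) h3.le (not_lt.1 h4)
      rw [h] at h5
      have : (r : ℕ) < r' := h3
      omega
    have h5 : (r : ℕ) < r' := h3
    simp only [h3.not_gt, and_false, or_false]
    omega
  · simp only [lt_irrefl, and_false, or_false]
    omega
  · have h4 : (c : ℕ) < c' := by
      by_contra h4
      have h5 := L.value_add_le hdn hmu (c := c) (c' := c') h3.le (not_lt.1 h4)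
      rw [h] at h5
      have : (r' : ℕ) < r := h3
      omega
    have h5 : (r' : ℕ) < r := h3
    simp only [h4, true_or, true_iff]
    omega

end

section

variable (htop : ∀ i j, L.top i j = i)
include htop

open scoped Classical in
theorem contentUpTo_bot (r : Fin d) (c : Fin (mu r)) (k : Fin d) :
    L.contentUpTo (.bot r c) k = lam k +
      (Finset.univ.filter fun a : (r : Fin d) × Fin (mu r) =>
        ((Box.bot a.1 a.2 : Box lam mu).Before (.bot r c) ∨
          (Box.bot a.1 a.2 : Box lam mu) = .bot r c) ∧ L.bot a.1 a.2 = (k, false)).card := by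
  rw [contentUpTo, card_filter_box, ← card_filter_row lam k]
  congr 2
  ext a
  simp [Box.Before, entry, htop]

open scoped Classical in
theorem contentBefore_bot (r : Fin d) (c : Fin (mu r)) (k : Fin d) :
    L.contentBefore (.bot r c) k = lam k +
      (Finset.univ.filter fun a : (r : Fin d) × Fin (mu r) =>
        (Box.bot a.1 a.2 : Box lam mu).Before (.bot r c) ∧ L.bot a.1 a.2 = (k, false)).card := by
  rw [contentBefore, card_filter_box, ← card_filter_row lam k]
  congr 2
  ext a
  simp [Box.Before, entry, htop]

section

variable (hdn : d ≤ n) (hmu : IsBoxPartition d n mu)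
include hdn hmu

theorem content_eq (k : Fin d) :
    L.content k = lam k + arrayCount d (rowLength mu) L.val L.bar k n := by
  classical
  rw [content, card_filter_box, ← L.card_bot hdn hmu, ← card_filter_row lam k]
  congr 2
  · ext a
    simp [entry, htop]
  · ext a
    have := hmu.2 a.1
    have := a.2.2
    rw [Finset.mem_filter, Finset.mem_filter]
    exact ⟨fun h => ⟨h.1, h.2, by omega⟩, fun h => ⟨h.1, h.2.1⟩⟩

theorem contentBefore_eq (r : Fin d) (c : Fin (mu r)) :
    L.contentBefore (.bot r c) (L.bot r c).1 = lam (L.bot r c).1 +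
      arrayCount d (rowLength mu) L.val L.bar (L.bot r c).1
        (d - 1 - r - ((L.bot r c).1 : ℕ) + c) := by
  classical
  rw [L.contentBefore_bot htop, ← L.card_bot hdn hmu]
  congr 2
  ext a
  simp only [Finset.mem_filter, Finset.mem_univ, true_and]
  rw [and_comm]
  refine and_congr_right fun h => ?_
  exact L.before_iff hdn hmu (by rw [h])

/-- In a Yamanouchi tableau the paths do not cross. -/
theorem arrayCount_le_of_isYamanouchi (hlam : IsBoxPartition d n lam) (hY : L.IsYamanouchi)
    (i : ℕ) (hi : i + 1 < d) (j : ℕ) :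
    lam ⟨i + 1, hi⟩ + arrayCount d (rowLength mu) L.val L.bar (i + 1) j ≤
      lam ⟨i, by omega⟩ + arrayCount d (rowLength mu) L.val L.bar i j := by
  classical
  have A := L.isTableauArray hdn hmu
  induction j with
  | zero =>
    simp only [arrayCount, Nat.count_zero, add_zero]
    exact hlam.1 (Fin.mk_le_mk.2 (by omega))
  | succ j ih =>
    -- The inequality can fail only when path `i + 1` makes an unbarred step; the Yamanouchi
    -- condition is applied at the box of that step.
    by_cases hs : IsUnbarredStep L.bar (arrayU d (rowLength mu) L.val) (i + 1) j
    · obtain ⟨h1, h2⟩ := hs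
      obtain ⟨h3, h4, h5, h6⟩ := A.box_of_letter hi h1
      generalize arrayU d (rowLength mu) L.val (i + 1) j = m at h2 h3 h4 h5 h6
      have h : i + 1 + m + (⟨d - 1 - (i + 1 + m), by omega⟩ : Fin d) + 1 = d := by
        simp only; omega
      rw [rowLength_eq mu h] at h5
      have h8 := L.val_eq h ⟨j - m, h5⟩
      have h9 := L.bar_eq h ⟨j - m, h5⟩
      simp only at h8 h9
      rw [h6] at h8
      rw [h2] at h9
      set r : Fin d := ⟨d - 1 - (i + 1 + m), by omega⟩ with hr
      set c : Fin (mu r) := ⟨j - m, h5⟩ with hc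
      have hbot : (L.bot r c).1 = ⟨i + 1, hi⟩ := Fin.ext h8.symm
      have h10 := hY (.bot r c) ⟨i, by omega⟩ ⟨i + 1, hi⟩ rfl
      rw [L.contentUpTo_bot htop, L.contentUpTo_bot htop] at h10
      have h11 : arrayCount d (rowLength mu) L.val L.bar (i + 1) (j + 1) =
          arrayCount d (rowLength mu) L.val L.bar (⟨i + 1, hi⟩ : Fin d) (j + 1) := rfl
      have h12 : arrayCount d (rowLength mu) L.val L.bar i (j + 1) =
          arrayCount d (rowLength mu) L.val L.bar (⟨i, by omega⟩ : Fin d) (j + 1) := rfl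
      rw [h11, h12, ← L.card_bot hdn hmu, ← L.card_bot hdn hmu]
      refine le_trans (Nat.add_le_add_left (Finset.card_le_card ?_) _)
        (h10.trans (Nat.add_le_add_left (Finset.card_le_card ?_) _))
      -- The letters `i + 1` of strips up to `j` are read up to this box: boxes of equal value in
      -- the same strip coincide, and otherwise `before_iff` applies.
      · rintro ⟨r', c'⟩ ha
        simp only [Finset.mem_filter, Finset.mem_univ, true_and] at ha ⊢
        obtain ⟨h13, h14⟩ := ha
        refine ⟨?_, h13⟩
        by_cases h15 : (⟨r', c'⟩ : (r : Fin d) × Fin (mu r)) = ⟨r, c⟩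
        · right
          cases h15
          rfl
        · left
          have h17 := L.value_le hdn hmu r' c'
          have h18 := L.value_le hdn hmu r c
          have hval : (L.bot r' c').1 = (L.bot r c).1 := by rw [h13, hbot]
          rw [L.before_iff hdn hmu hval, hbot]
          rw [h13] at h17
          rw [hbot] at h18
          simp only at h14 h17 h18 ⊢
          have h16 : (r : ℕ) = d - 1 - (i + 1 + m) := rfl
          have h19 : (c : ℕ) = j - m := rfl
          by_contra h20
          have h21 : d - 1 - (r' : ℕ) - (i + 1) + c' = d - 1 - r - (i + 1) + c := by omega
          rcases lt_trichotomy r r' with h22 | h22 | h22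
          · have := L.value_add_le hdn hmu (c := c') (c' := c) h22.le (by
              have : (r : ℕ) < r' := h22
              omega)
            rw [hval] at this
            have : (r : ℕ) < r' := h22
            omega
          · subst h22
            exact h15 (by congr 1; exact Fin.ext (by omega))
          · have := L.value_add_le hdn hmu (c := c) (c' := c') h22.le (by
              have : (r' : ℕ) < r := h22
              omega)
            rw [hval] at this
            have : (r' : ℕ) < r := h22
            omega
      -- A letter `i` read before this box lies weakly to the right, hence strictly above it, since
      -- boxes weakly below and to the right have larger values. Being a row higher offsets the
      -- smaller value, so its strip is at most `j`.
      · rintro ⟨r', c'⟩ ha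
        simp only [Finset.mem_filter, Finset.mem_univ, true_and] at ha ⊢
        obtain ⟨h13, h14⟩ := ha
        refine ⟨h14, ?_⟩
        have h15 : (c' : ℕ) ≤ c := by
          rcases h13 with h13 | h13
          · simp only [Box.Before] at h13
            omega
          · cases h13
            exact le_rfl
        have h17 := L.value_le hdn hmu r' c'
        rw [h14] at h17
        have h16 : (r : ℕ) = d - 1 - (i + 1 + m) := rfl
        have h19 : (c : ℕ) = j - m := rfl
        have h20 : r < r' := by
          by_contra h20
          have := L.value_add_le hdn hmu (c := c) (c' := c') (not_lt.1 h20) h15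
          rw [h14, hbot] at this
          simp only at this
          omega
        have : (r : ℕ) < r' := h20
        simp only at h17
        omega
    · have h1 : arrayCount d (rowLength mu) L.val L.bar (i + 1) (j + 1) =
          arrayCount d (rowLength mu) L.val L.bar (i + 1) j := by
        rw [arrayCount, arrayCount, Nat.count_succ, if_neg hs, add_zero]
      have h2 : arrayCount d (rowLength mu) L.val L.bar i j ≤
          arrayCount d (rowLength mu) L.val L.bar i (j + 1) :=
        Nat.count_monotone _ (Nat.le_succ j)
      omega

end

/-- Sliding a box of row `l` up its column to row `k` is an injection into boxes that are read no
later. -/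
theorem contentUpTo_top_le (hlam : Antitone lam) (i₀ : Fin d) (j₀ : Fin (lam i₀)) {k l : Fin d}
    (hkl : k ≤ l) : L.contentUpTo (.top i₀ j₀) l ≤ L.contentUpTo (.top i₀ j₀) k := by
  classical
  rw [contentUpTo, contentUpTo, card_filter_box, card_filter_box]
  refine Nat.add_le_add ?_ ?_
  · refine Finset.card_le_card_of_injOn
      (fun a => if h : (a.2 : ℕ) < lam k then ⟨k, ⟨a.2, h⟩⟩ else a) ?_ ?_
    · rintro ⟨i, j⟩ ha
      simp only [Finset.coe_filter, Finset.mem_univ, true_and, Set.mem_ofPred_eq, entry, htop,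
        Prod.mk.injEq, and_true] at ha
      obtain ⟨ha, rfl⟩ := ha
      have hj : (j : ℕ) < lam k := j.2.trans_le (hlam hkl)
      simp only [dif_pos hj, Finset.coe_filter, Finset.mem_univ, true_and, Set.mem_ofPred_eq,
        entry, htop, and_true]
      rcases ha with ha | ha
      · simp only [Box.Before] at ha
        left
        rcases ha with ha | ha
        · exact Or.inl ha
        · exact Or.inr ⟨ha.1, hkl.trans_lt ha.2⟩
      · cases ha
        rcases hkl.eq_or_lt with rfl | hlt
        · exact Or.inr rfl
        · exact Or.inl (Or.inr ⟨rfl, hlt⟩)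
    · rintro ⟨i, j⟩ ha ⟨i', j'⟩ ha' h
      simp only [Finset.coe_filter, Finset.mem_univ, true_and, Set.mem_ofPred_eq, entry, htop,
        Prod.mk.injEq, and_true] at ha ha'
      obtain ⟨ha, rfl⟩ := ha
      obtain ⟨ha', rfl⟩ := ha'
      have hj : (j : ℕ) < lam k := j.2.trans_le (hlam hkl)
      have hj' : (j' : ℕ) < lam k := j'.2.trans_le (hlam hkl)
      simp only [dif_pos hj, dif_pos hj', Sigma.mk.injEq, heq_eq_eq, true_and, Fin.mk.injEq] at h
      have : j = j' := Fin.ext h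
      rw [this]
  · rw [Finset.card_eq_zero.2]
    · exact Nat.zero_le _
    · ext a
      simp [Box.Before]

/-- A tableau is Yamanouchi if the paths do not cross. -/
theorem isYamanouchi_of_arrayCount_le (hdn : d ≤ n) (hmu : IsBoxPartition d n mu)
    (hlam : IsBoxPartition d n lam)
    (hcross : ∀ i (hi : i + 1 < d) j,
      lam ⟨i + 1, hi⟩ + arrayCount d (rowLength mu) L.val L.bar (i + 1) j ≤
        lam ⟨i, by omega⟩ + arrayCount d (rowLength mu) L.val L.bar i j) : L.IsYamanouchi := by
  classical
  intro a k l hkl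
  cases a with
  | top i₀ j₀ => exact L.contentUpTo_top_le htop hlam.1 i₀ j₀ (Fin.le_def.2 (by omega))
  | bot r c =>
    rw [L.contentUpTo_bot htop, L.contentUpTo_bot htop]
    set s := Finset.univ.filter fun a : (r : Fin d) × Fin (mu r) =>
        ((Box.bot a.1 a.2 : Box lam mu).Before (.bot r c) ∨
          (Box.bot a.1 a.2 : Box lam mu) = .bot r c) ∧ L.bot a.1 a.2 = (l, false) with hs
    rcases s.eq_empty_or_nonempty with he | hne
    · rw [he, Finset.card_empty, add_zero]
      exact (hlam.1 (Fin.le_def.2 (by omega))).trans (Nat.le_add_right _ _)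
    -- Take the last letter `l` read so far and compare the paths right after its strip. All letters
    -- `l` read so far are counted there, and every letter `k` counted there is read before this
    -- box.
    · obtain ⟨⟨r', c'⟩, ha, hmax⟩ := s.exists_max_image
        (fun a => d - 1 - a.1 - l + a.2) hne
      have h1 : lam l + arrayCount d (rowLength mu) L.val L.bar l (d - 1 - r' - l + c' + 1) ≤
          lam k + arrayCount d (rowLength mu) L.val L.bar k (d - 1 - r' - l + c' + 1) := by
        have h2 : ∀ m (hm : m < d) T, m = (k : ℕ) + 1 →
            lam ⟨m, hm⟩ + arrayCount d (rowLength mu) L.val L.bar m T ≤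
              lam k + arrayCount d (rowLength mu) L.val L.bar k T := by
          rintro _ hm T rfl
          exact hcross k hm T
        exact h2 l l.2 _ hkl
      rw [← L.card_bot hdn hmu, ← L.card_bot hdn hmu] at h1
      refine le_trans (Nat.add_le_add_left (Finset.card_le_card ?_) _)
        (h1.trans (Nat.add_le_add_left (Finset.card_le_card ?_) _))
      · intro a' ha'
        have h3 := hmax a' ha'
        simp only at h3
        simp only [hs, Finset.mem_filter, Finset.mem_univ, true_and] at ha' ⊢
        exact ⟨ha'.2, by omega⟩
      · rintro ⟨r₁, c₁⟩ ha₁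
        simp only [hs, Finset.mem_filter, Finset.mem_univ, true_and] at ha ha₁ ⊢
        obtain ⟨h3, h4⟩ := ha
        obtain ⟨h5, h6⟩ := ha₁
        refine ⟨?_, h5⟩
        have h7 : (Box.bot r₁ c₁ : Box lam mu).Before (.bot r' c') := by
          have h8 := L.value_le hdn hmu r₁ c₁
          have h9 := L.value_le hdn hmu r' c'
          rw [h5] at h8
          rw [h4] at h9
          simp only at h8 h9
          simp only [Box.Before]
          rcases lt_trichotomy (c₁ : ℕ) c' with h10 | h10 | h10
          · exact Or.inl h10
          · right
            refine ⟨h10, ?_⟩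
            by_contra h11
            have h12 := L.value_add_le hdn hmu (c := c') (c' := c₁) (not_lt.1 h11) h10.le
            rw [h4, h5] at h12
            simp only at h12
            omega
          · exfalso
            have h11 : r' ≤ r₁ := Fin.le_def.2 (by omega)
            have h12 := L.value_add_le hdn hmu (c := c₁) (c' := c') h11 h10.le
            rw [h4, h5] at h12
            simp only at h12
            omega
        rcases h3 with h3 | h3
        · exact Or.inl (h7.trans h3)
        · rw [← h3]
          exact Or.inl h7

end

/-- The part of shape `lam` of a Littlewood-Richardson tableau has constant rows. -/
theorem top_eq_of_isYamanouchi (hlam : Antitone lam) (hY : L.IsYamanouchi) (i : Fin d)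
    (j : Fin (lam i)) : L.top i j = i := by
  classical
  have hle : ∀ m : ℕ, ∀ i : Fin d, (i : ℕ) = m → ∀ j : Fin (lam i), m ≤ L.top i j := by
    intro m
    induction m with
    | zero => exact fun _ _ _ => Nat.zero_le _
    | succ m ih =>
      intro i hi j
      let i' : Fin d := ⟨m, by omega⟩
      have hii : i' ≤ i := Fin.le_def.2 (by simp only [i']; omega)
      have h1 := ih i' rfl ⟨j, j.2.trans_le (hlam hii)⟩
      have h2 : L.top i' ⟨j, j.2.trans_le (hlam hii)⟩ < L.top i j :=
        L.top_col i' i ⟨j, j.2.trans_le (hlam hii)⟩ j rfl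
          (Fin.lt_def.2 (by simp only [i']; omega))
      have h3 := Fin.lt_def.1 h2
      omega
  have key : ∀ m : ℕ, ∀ i : Fin d, (i : ℕ) = m → ∀ j : Fin (lam i), L.top i j = i := by
    intro m
    induction m using Nat.strong_induction_on with
    | _ m ih =>
      intro i hi j
      apply le_antisymm _ (Fin.le_def.2 (hi ▸ hle m i hi j))
      by_contra hlt
      have hlt' := Fin.lt_def.1 (not_le.1 hlt)
      -- The rightmost box of the row is the first one of the row to be read, and its entry `v` also
      -- exceeds `i`.
      let j₀ : Fin (lam i) := ⟨lam i - 1, by have := j.2; omega⟩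
      have hj₀ : L.top i j ≤ L.top i j₀ :=
        L.top_row i j j₀ (Fin.le_def.2 (by have := j.2; simp only [j₀]; omega))
      have hj₀' := Fin.le_def.1 hj₀
      have h1 := hY (.top i j₀) ⟨L.top i j₀ - 1, by omega⟩ (L.top i j₀) (by simp only; omega)
      have h2 : 0 < L.contentUpTo (.top i j₀) (L.top i j₀) := by
        rw [contentUpTo, Finset.card_pos]
        exact ⟨.top i j₀, Finset.mem_filter.2 ⟨Finset.mem_univ _, Or.inr rfl, rfl⟩⟩
      -- No `v - 1` has been read yet: every other box read so far lies in a row above, where by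
      -- induction the entries are smaller than `i`. So the `v` violates the Yamanouchi condition.
      have h3 : L.contentUpTo (.top i j₀) ⟨L.top i j₀ - 1, by omega⟩ = 0 := by
        rw [contentUpTo, Finset.card_eq_zero, Finset.filter_eq_empty_iff]
        rintro (⟨i', j'⟩ | ⟨r, c⟩) -
        · rintro ⟨h4, h5⟩
          simp only [entry, Prod.mk.injEq, and_true] at h5
          have h5' := congrArg Fin.val h5
          simp only at h5'
          rcases h4 with h4 | h4
          · have h6 : i' < i := by
              simp only [Box.Before] at h4
              rcases h4 with h4 | h4
              · by_contra h7
                have h8 := hlam (not_lt.1 h7)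
                have h9 : (j₀ : ℕ) = lam i - 1 := rfl
                have := j'.2
                omega
              · exact h4.2
            have h7 := Fin.lt_def.1 h6
            rw [ih i' (by omega) i' rfl j'] at h5'
            omega
          · cases h4
            omega
        · simp [Box.Before]
      omega
  exact key i i rfl j

end SkewBarredTableau

/-! ### The tableau of a path system -/

/-- The triangle on the path `i` that lies on the beam of row `t` does not come after the column `c`
of this row. -/
def BoxPast (u : ℕ → ℕ → ℕ) (t c i : ℕ) : Prop := t < i ∨ t - i < u i (t - i + c + 1)

instance (u : ℕ → ℕ → ℕ) (t c i : ℕ) : Decidable (BoxPast u t c i) :=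
  inferInstanceAs (Decidable (_ ∨ _))

theorem exists_boxPast (u : ℕ → ℕ → ℕ) (t c : ℕ) : ∃ i, BoxPast u t c (i + 1) :=
  ⟨t, Or.inl (Nat.lt_succ_self t)⟩

/-- The value in row `t` and column `c` of the tableau of a path system. -/
def pathValue (u : ℕ → ℕ → ℕ) (t c : ℕ) : ℕ := Nat.find (exists_boxPast u t c)

theorem pathValue_le (u : ℕ → ℕ → ℕ) (t c : ℕ) : pathValue u t c ≤ t :=
  Nat.find_le (h := exists_boxPast u t c) (Or.inl (Nat.lt_succ_self t))

namespace IsPathSystem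

variable {d n : ℕ} {u : ℕ → ℕ → ℕ} {x : ℕ → ℕ → ℤ} (S : IsPathSystem d n u x)
include S

/-- Along the beam of a row the triangles of paths further to the right come in earlier strips; this
is `u_step`. -/
theorem boxPast_succ {t c i : ℕ} (h : BoxPast u t c i) : BoxPast u t c (i + 1) := by
  rcases h with h | h
  · exact Or.inl (by omega)
  · by_cases hi : t < i + 1
    · exact Or.inl hi
    · right
      have h1 := S.u_step i (t - i + c)
      rw [show t - (i + 1) + c + 1 = t - i + c by omega]
      omega

theorem boxPast_mono {t c i i' : ℕ} (hi : i ≤ i') (h : BoxPast u t c i) : BoxPast u t c i' := by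
  induction i', hi using Nat.le_induction with
  | base => exact h
  | succ k hk ih => exact S.boxPast_succ ih

theorem boxPast_column {t c c' i : ℕ} (hc : c ≤ c') (h : BoxPast u t c i) : BoxPast u t c' i :=
  h.imp_right fun h => h.trans_le (S.u_monotone i (by omega))

theorem pathValue_antitone (t : ℕ) {c c' : ℕ} (hc : c ≤ c') : pathValue u t c' ≤ pathValue u t c :=
  Nat.find_mono fun _ h => S.boxPast_column hc h

theorem u_le_sub (i j : ℕ) : u i j ≤ d - i := by
  rw [← S.u_final i (max n j) (le_max_left _ _)]
  exact S.u_monotone i (le_max_right _ _)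

variable {lam mu nu : Fin d → ℕ} (hb : HasBoundary n u x lam mu nu) (hmu : IsBoxPartition d n mu)
include hb hmu

/-- The beam of row `t` leaves through the NW side, and the word of `μ` fixes the strip: `t` plus
the length of the row. -/
theorem boxPast_zero_iff {t : ℕ} (ht : t < d) (c : ℕ) :
    BoxPast u t c 0 ↔ ¬ c < rowLength mu t := by
  have h := lt_count_iff hmu (S.u_zero 0) (S.u_mono 0) (S.u_succ_le 0) hb.north_west t (t + c + 1)
  have h1 : t + (⟨d - 1 - t, by omega⟩ : Fin d) + 1 = d := by simp only; omega
  have h2 : (∃ r : Fin d, t + r + 1 = d ∧ t + mu r < t + c + 1) ↔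
      t + rowLength mu t < t + c + 1 := by
    constructor
    · rintro ⟨r, hr, h3⟩
      rwa [rowLength_eq mu hr]
    · intro h3
      exact ⟨_, h1, by rwa [← rowLength_eq mu h1]⟩
  rw [BoxPast, Nat.sub_zero, h, h2]
  omega

theorem le_pathValue_iff {t c : ℕ} (ht : t < d) (hc : c < rowLength mu t) (i : ℕ) :
    i ≤ pathValue u t c ↔ ¬ BoxPast u t c i := by
  rw [pathValue, Nat.le_find_iff]
  constructor
  · intro h h'
    rcases i with _ | i
    · exact (S.boxPast_zero_iff hb hmu ht c).1 h' hc
    · exact h i (Nat.lt_succ_self i) h'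
  · intro h m hm h'
    exact h (S.boxPast_mono hm h')

theorem not_boxPast_iff {t : ℕ} (ht : t < d) (c i : ℕ) :
    ¬ BoxPast u t c i ↔ c < rowLength mu t ∧ i ≤ pathValue u t c := by
  constructor
  · intro h
    have hc : c < rowLength mu t := by
      by_contra hc
      exact h (S.boxPast_mono (Nat.zero_le i) ((S.boxPast_zero_iff hb hmu ht c).2 hc))
    exact ⟨hc, (S.le_pathValue_iff hb hmu ht hc i).2 h⟩
  · rintro ⟨hc, h⟩
    exact (S.le_pathValue_iff hb hmu ht hc i).1 h

/-- Triangle number `t - i` of path `i` lies on the beam of row `t`, and the same number on path `i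
+ 1` belongs to row `t + 1`. The latter is not passed earlier, by `u_le`. -/
theorem pathValue_lt_succ {t c : ℕ} (ht : t + 1 < d) (hc : c < rowLength mu t) :
    pathValue u t c < pathValue u (t + 1) c := by
  have h1 := (S.le_pathValue_iff hb hmu (by omega) hc _).1 le_rfl
  have h2 := pathValue_le u t c
  refine ((S.not_boxPast_iff hb hmu ht c (pathValue u t c + 1)).1 ?_).2
  rintro (h | h)
  · omega
  · refine h1 (Or.inr ?_)
    rw [show t + 1 - (pathValue u t c + 1) = t - pathValue u t c by omega] at h
    exact h.trans_le (S.u_le _ _)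

theorem pathValue_lt_add {t c : ℕ} (e : ℕ) (ht : t + e + 1 < d) (hc : c < rowLength mu t) :
    pathValue u t c < pathValue u (t + e + 1) c := by
  induction e with
  | zero => exact S.pathValue_lt_succ hb hmu ht hc
  | succ e ih =>
    refine (ih (by omega)).trans (S.pathValue_lt_succ hb hmu ht ?_)
    refine hc.trans_le ?_
    rw [rowLength_eq mu (r := ⟨d - 1 - t, by omega⟩) (by simp only; omega),
      rowLength_eq mu (r := ⟨d - 1 - (t + e + 1), by omega⟩) (by simp only; omega)]
    exact hmu.1 (Fin.mk_le_mk.2 (by omega))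

/-- The tableau of a path system. -/
def tableau : SkewBarredTableau lam mu where
  top i _ := i
  bot r c :=
    (⟨pathValue u (d - 1 - r) c, (pathValue_le u _ _).trans_lt (by omega)⟩,
      decide (x (pathValue u (d - 1 - r) c) (d - 1 - r - pathValue u (d - 1 - r) c + c + 1) =
        x (pathValue u (d - 1 - r) c) (d - 1 - r - pathValue u (d - 1 - r) c + c)))
  top_row _ _ _ _ := le_rfl
  top_col _ _ _ _ _ h := h
  bot_row r c c' h := Fin.mk_le_mk.2 (S.pathValue_antitone _ h)
  bot_col r r' c c' hc hr := by
    have h1 : (r : ℕ) < r' := hr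
    have h2 := S.pathValue_lt_add hb hmu (t := d - 1 - r') (c := c') (r' - r - 1) (by omega)
      (by rw [rowLength_eq mu (r := r') (by omega)]; exact c'.2)
    rw [show d - 1 - (r' : ℕ) + (r' - r - 1) + 1 = d - 1 - r by omega, ← hc] at h2
    rw [← hc]
    exact Fin.mk_lt_mk.2 h2

theorem val_tableau {t c : ℕ} (ht : t < d) (hc : c < rowLength mu t) :
    (S.tableau hb hmu).val t c = pathValue u t c := by
  have h : t + (⟨d - 1 - t, by omega⟩ : Fin d) + 1 = d := by simp only; omega
  rw [rowLength_eq mu h] at hc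
  have h1 := (S.tableau hb hmu).val_eq h ⟨c, hc⟩
  simp only [tableau] at h1
  rw [show d - 1 - (d - 1 - t) = t by omega] at h1
  exact h1

theorem bar_tableau {t c : ℕ} (ht : t < d) (hc : c < rowLength mu t) :
    (S.tableau hb hmu).bar t c = decide (x (pathValue u t c) (t - pathValue u t c + c + 1) =
        x (pathValue u t c) (t - pathValue u t c + c)) := by
  have h : t + (⟨d - 1 - t, by omega⟩ : Fin d) + 1 = d := by simp only; omega
  rw [rowLength_eq mu h] at hc
  have h1 := (S.tableau hb hmu).bar_eq h ⟨c, hc⟩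
  simp only [tableau] at h1
  rw [show d - 1 - (d - 1 - t) = t by omega] at h1
  exact h1

variable (hdn : d ≤ n)
include hdn

/-- `arrayU` asks for each triangle whether the corresponding entry is `≥ i`, and `pathValue` was
defined so that the answer is whether the triangle is still to come. -/
theorem arrayU_tableau : arrayU d (rowLength mu) (S.tableau hb hmu).val = u := by
  have A := (S.tableau hb hmu).isTableauArray hdn hmu
  funext i j
  refine eq_of_forall_lt_iff fun k => ?_
  rw [A.lt_arrayU_iff]
  have h1 := S.u_le_sub i j
  have h2 := S.u_le_time i j
  by_cases hk : k < d - i ∧ k < j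
  · have h3 := S.not_boxPast_iff hb hmu (t := i + k) (by omega) (j - k - 1) i
    have h4 : (j - k - 1 < rowLength mu (i + k) ∧ i ≤ (S.tableau hb hmu).val (i + k) (j - k - 1)) ↔
        (j - k - 1 < rowLength mu (i + k) ∧ i ≤ pathValue u (i + k) (j - k - 1)) :=
      and_congr_right fun h => by rw [S.val_tableau hb hmu (by omega) h]
    rw [TrianglePast, h4, ← h3, not_not, BoxPast, show i + k - i = k by omega,
      show k + (j - k - 1) + 1 = j by omega]
    omega
  · simp only [TrianglePast]
    omega

theorem isUnbarredStep_tableau {i : ℕ} (hi : i < d) (j : ℕ) :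
    IsUnbarredStep (S.tableau hb hmu).bar u i j ↔ x i (j + 1) ≠ x i j := by
  have A := (S.tableau hb hmu).isTableauArray hdn hmu
  have hU := S.arrayU_tableau hb hmu hdn
  rw [IsUnbarredStep]
  by_cases h : u i (j + 1) = u (i + 1) j
  · have h1 := A.box_of_letter hi (j := j) (by rwa [hU])
    rw [hU] at h1
    obtain ⟨h1, h2, h3, h4⟩ := h1
    rw [S.val_tableau hb hmu h2 h3] at h4
    rw [S.bar_tableau hb hmu h2 h3, h4, show i + u i j - i + (j - u i j) = j by omega]
    simp [h]
  · simp only [h, false_and, false_iff, not_not]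
    exact S.x_succ_of_not_letter hi h

/-- Both sides start at the same position and move west exactly at the unbarred letters. -/
theorem arrayX_tableau :
    arrayX d n (rowLength mu) (S.tableau hb hmu).val (S.tableau hb hmu).bar lam = x := by
  funext i j
  rw [arrayX]
  split_ifs with hi
  · rw [arrayCount, S.arrayU_tableau hb hmu hdn, startPosition, dif_pos hi]
    induction j with
    | zero =>
      rw [Nat.count_zero, hb.north_east ⟨i, hi⟩]
      simp
    | succ j ih =>
      rw [Nat.count_succ]
      have h1 := S.isUnbarredStep_tableau hb hmu hdn hi j
      have h2 := S.x_step i j hi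
      split_ifs with h3 <;> rw [h1] at h3 <;> push_cast <;> omega
  · exact (S.x_off i j (by omega)).symm

theorem tableau_mem (hlam : IsBoxPartition d n lam) :
    S.tableau hb hmu ∈ LRTableaux lam mu nu := by
  have hx := S.arrayX_tableau hb hmu hdn
  have h : ∀ i (hi : i < d) j, (n : ℤ) - d + i - lam ⟨i, hi⟩ -
      arrayCount d (rowLength mu) (S.tableau hb hmu).val (S.tableau hb hmu).bar i j = x i j := by
    intro i hi j
    have := congrFun (congrFun hx i) j
    rwa [arrayX, if_pos hi, startPosition, dif_pos hi] at this
  refine ⟨(S.tableau hb hmu).isYamanouchi_of_arrayCount_le (fun _ _ => rfl) hdn hmu hlam ?_, ?_⟩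
  · intro i hi j
    have h1 := h i (by omega) j
    have h2 := h (i + 1) hi j
    have h3 := S.x_lt i j hi
    push_cast at h2
    omega
  · intro k
    rw [(S.tableau hb hmu).content_eq (fun _ _ => rfl) hdn hmu]
    have h1 := h k k.2 n
    have h2 := hb.south k
    have h3 : (⟨k, k.2⟩ : Fin d) = k := rfl
    rw [h3] at h1
    omega

end IsPathSystem

/-! ### The path system of a Littlewood-Richardson tableau -/

namespace SkewBarredTableau

variable {d : ℕ} {lam mu nu : Fin d → ℕ} (L : SkewBarredTableau lam mu)

/-- The number of upward pointing 1-triangles on the path `i` before the line `j`. -/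
def pathU (i j : ℕ) : ℕ := arrayU d (rowLength mu) L.val i j

/-- The position of the path `i` on the line `j`. -/
def pathX (n i j : ℕ) : ℤ := arrayX d n (rowLength mu) L.val L.bar lam i j

variable {n : ℕ} (hdn : d ≤ n) (hlam : IsBoxPartition d n lam) (hmu : IsBoxPartition d n mu)
  (hL : L ∈ LRTableaux lam mu nu)
include hlam hL

theorem top_eq (i : Fin d) (j : Fin (lam i)) : L.top i j = i :=
  L.top_eq_of_isYamanouchi hlam.1 hL.1 i j

include hdn hmu

theorem add_arrayCount (i : Fin d) :
    lam i + arrayCount d (rowLength mu) L.val L.bar i n = nu i := by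
  rw [← L.content_eq (L.top_eq hlam hL) hdn hmu]
  exact hL.2 i

theorem isPathSystem (hnu : IsBoxPartition d n nu) :
    IsPathSystem d n L.pathU (L.pathX n) :=
  (L.isTableauArray hdn hmu).isPathSystem L.bar hnu
    (L.arrayCount_le_of_isYamanouchi (L.top_eq hlam hL) hdn hmu hlam hL.1)
    (L.add_arrayCount hdn hlam hmu hL)

theorem hasBoundary : HasBoundary n L.pathU (L.pathX n) lam mu nu :=
  (L.isTableauArray hdn hmu).hasBoundary L.bar (fun r => rowLength_eq mu (by omega))
    (L.add_arrayCount hdn hlam hmu hL)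

end SkewBarredTableau

/-! ### Puzzles viewed as trapezoid puzzles -/

theorem IsPathSystem.hor_of_neg {d n : ℕ} {u : ℕ → ℕ → ℕ} {x : ℕ → ℕ → ℤ}
    (S : IsPathSystem d n u x) (hs : IsSettled d n 0 u x) {a b : ℤ} (hb : b ≤ 0) :
    (∃ i < d, x i n = a) ∧ pathLabels d n u x (.hor a b) = .one ∨
      (¬ ∃ i < d, x i n = a) ∧ pathLabels d n u x (.hor a b) = .zero := by
  classical
  have h := S.horLabel_of_le hs (a := a) (j := ((n : ℤ) - 1 - a - b).toNat) (by push_cast; omega)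
  simp only [pathLabels, h]
  split_ifs with h1 <;> simp [h1]

theorem IsPathSystem.slash_of_neg {d n : ℕ} {u : ℕ → ℕ → ℕ} {x : ℕ → ℕ → ℤ}
    (S : IsPathSystem d n u x) (hs : IsSettled d n 0 u x) {a b : ℤ} (hb : b < 0) :
    pathLabels d n u x (.slash a b) = .zero :=
  S.slashLabel_of_lt hs (a := a) (j := ((n : ℤ) - 1 - a - b).toNat) (by push_cast; omega)

theorem IsPathSystem.back_of_neg {d n : ℕ} {u : ℕ → ℕ → ℕ} {x : ℕ → ℕ → ℤ}
    (S : IsPathSystem d n u x) (hs : IsSettled d n 0 u x) {a b : ℤ} (hb : b < 0) :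
    (∃ i < d, x i n = a) ∧ pathLabels d n u x (.back a b) = .inner ∨
      (¬ ∃ i < d, x i n = a) ∧ pathLabels d n u x (.back a b) = .zero := by
  classical
  have h := S.backLabel_of_lt hs (a := a) (j := ((n : ℤ) - 1 - a - b).toNat) (by push_cast; omega)
  simp only [pathLabels, h]
  split_ifs with h1 <;> simp [h1]

theorem mem_extendToTrapezoid {n : ℕ} {P : Finset Piece} {p : Piece} :
    p ∈ extendToTrapezoid n P ↔ p ∈ P ∨ (0 ≤ p.x ∧ p.x < n ∧ -(n : ℤ) ≤ p.y ∧ p.y < 0 ∧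
      if HasLabel P (.hor p.x 0) true then p.kind = .horOne
      else p.kind = .upTri false ∨ p.kind = .downTri false) := by
  obtain ⟨k, a, b⟩ := p
  simp only [extendToTrapezoid, Finset.mem_union, Finset.mem_biUnion, Finset.mem_range]
  refine or_congr_right ⟨?_, ?_⟩
  · rintro ⟨x, hx, j, hj, hp⟩
    split_ifs at hp with h1
    · simp only [Finset.mem_singleton, Piece.mk.injEq] at hp
      obtain ⟨rfl, rfl, rfl⟩ := hp
      rw [if_pos h1]
      exact ⟨by omega, by omega, by omega, by omega, rfl⟩
    · simp only [Finset.mem_insert, Finset.mem_singleton, Piece.mk.injEq] at hp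
      rcases hp with ⟨rfl, rfl, rfl⟩ | ⟨rfl, rfl, rfl⟩ <;> rw [if_neg h1]
      · exact ⟨by omega, by omega, by omega, by omega, Or.inl rfl⟩
      · exact ⟨by omega, by omega, by omega, by omega, Or.inr rfl⟩
  · rintro ⟨h1, h2, h3, h4, h5⟩
    refine ⟨a.toNat, by omega, (-b - 1).toNat, by omega, ?_⟩
    have ha : (a.toNat : ℤ) = a := by omega
    have hb : -((-b - 1).toNat : ℤ) - 1 = b := by omega
    rw [ha, hb]
    split_ifs at h5 ⊢ with h6
    · simp [h5]
    · simpa using h5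

/-- Below `D` a system settled at height `0` has constant horizontal labels in each column, zero
slash edges, and back edges labelled inner or zero. The only fitting pieces are `horOne` rhombi in
the columns of the paths and 0-triangles elsewhere. -/
theorem IsPathSystem.extendToTrapezoid_eq {d n : ℕ} {u : ℕ → ℕ → ℕ} {x : ℕ → ℕ → ℤ}
    (S : IsPathSystem d n u x) (hs : IsSettled d n 0 u x) :
    extendToTrapezoid n (labelPieces n 0 (pathLabels d n u x)) =
      labelPieces n n (pathLabels d n u x) := by
  have H := S.isLabeling hs
  ext ⟨k, a, b⟩
  rw [mem_extendToTrapezoid, mem_labelPieces, mem_labelPieces]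
  have hl : 0 ≤ a → a < n → (HasLabel (labelPieces n 0 (pathLabels d n u x)) (.hor a 0) true ↔
      ∃ i < d, x i n = a) := by
    intro h1 h2
    rw [H.hasLabel_iff (t := .up a 0) (inside_up.2 ⟨h1, by omega, by simp, by omega⟩)
      (by simp [UnitTriangle.edges])]
    rcases S.hor_of_neg hs (a := a) le_rfl with ⟨h3, h4⟩ | ⟨h3, h4⟩ <;> simp [h3, h4, EdgeLabel.ofBool]
  constructor
  · rintro (⟨h1, h2⟩ | ⟨h1, h2, h3, h4, h5⟩)
    · refine ⟨fun t ht v hv => ?_, h2⟩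
      obtain ⟨h3, h4, h5, h6⟩ := h1 t ht v hv
      exact ⟨h3, h4, by push_cast at h5; omega, h6⟩
    · simp only at h1 h2 h3 h4 h5
      simp only [hl h1 h2] at h5
      split_ifs at h5 with h6
      · subst h5
        simp only [Piece.cells, Finset.mem_insert, Finset.mem_singleton, forall_eq_or_imp,
          forall_eq, inside_up, inside_down, Piece.Fits]
        refine ⟨by omega, ?_⟩
        rcases S.back_of_neg hs (a := a) h4 with ⟨-, h7⟩ | ⟨h7, -⟩
        · exact h7
        · exact absurd h6 h7
      · have h7 : pathLabels d n u x (.back a b) = .zero :=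
          (S.back_of_neg hs (a := a) h4).elim (fun h => absurd h.1 h6) (fun h => h.2)
        have h8 : ∀ b ≤ 0, pathLabels d n u x (.hor a b) = .zero := fun b hb =>
          (S.hor_of_neg hs hb).elim (fun h => absurd h.1 h6) (fun h => h.2)
        rcases h5 with rfl | rfl
        · simp only [Piece.cells, Finset.mem_singleton, forall_eq, inside_up, Piece.Fits]
          exact ⟨by omega, h8 b h4.le, S.slash_of_neg hs h4, h7⟩
        · simp only [Piece.cells, Finset.mem_singleton, forall_eq, inside_down, Piece.Fits]
          exact ⟨by omega, h8 _ (by omega), S.slash_of_neg hs h4, h7⟩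
  · rintro ⟨h1, h2⟩
    by_cases hb : b < 0
    swap
    · left
      cases k <;> simp only [Piece.cells, Finset.mem_insert, Finset.mem_singleton,
        forall_eq_or_imp, forall_eq, inside_up, inside_down, Piece.Fits] at h1 h2 ⊢ <;>
        exact ⟨by push_cast; omega, h2⟩
    cases k <;> simp only [Piece.cells, Finset.mem_insert, Finset.mem_singleton, forall_eq_or_imp,
      forall_eq, inside_up, inside_down, Piece.Fits] at h1 h2 ⊢
    case upTri c =>
      have h3 := S.slash_of_neg hs (a := a) hb
      rw [h2.2.1] at h3
      cases c <;> simp only [EdgeLabel.ofBool, reduceCtorEq] at h3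
      right
      refine ⟨by omega, by omega, by omega, hb, ?_⟩
      rcases S.hor_of_neg hs (a := a) hb.le with h4 | h4
      · simp [h2.1, EdgeLabel.ofBool] at h4
      · rw [if_neg ((hl (by omega) (by omega)).not.2 h4.1)]
        exact Or.inl rfl
    case downTri c =>
      have h3 := S.slash_of_neg hs (a := a + 1) hb
      rw [h2.2.1] at h3
      cases c <;> simp only [EdgeLabel.ofBool, reduceCtorEq] at h3
      right
      refine ⟨by omega, by omega, by omega, hb, ?_⟩
      rcases S.hor_of_neg hs (a := a) (b := b + 1) (by omega) with h4 | h4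
      · simp [h2.1, EdgeLabel.ofBool] at h4
      · rw [if_neg ((hl (by omega) (by omega)).not.2 h4.1)]
        exact Or.inr rfl
    case horOne =>
      right
      refine ⟨by omega, by omega, by omega, hb, ?_⟩
      rcases S.back_of_neg hs (a := a) hb with h4 | h4
      · rw [if_pos ((hl (by omega) (by omega)).2 h4.1)]
        trivial
      · simp [h2] at h4
    case backOne =>
      rw [S.slash_of_neg hs hb] at h2
      simp at h2
    case slashOne =>
      rcases S.hor_of_neg hs (a := a) (b := b + 1) (by omega) with h4 | h4 <;>
        simp [h2] at h4
    case equivariant =>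
      rcases S.hor_of_neg hs (a := a) (b := b + 1) (by omega) with h4 | h4 <;>
        simp [h2] at h4

/-! ### Positivity -/

/-- It suffices to control equivariant pieces, since only these lower a path between back edges
labelled 1: a `backOne` rhombus keeps the height. When such a run starts anew after a downward
1-triangle, the upward triangle of path `i + 1` at the other end of the beam lies strictly to the
east and bounds the height. The induction goes from the last path, which has no downward triangles,
to the first. -/
theorem IsPathSystem.isSettled_zero {d n : ℕ} {u : ℕ → ℕ → ℕ} {x : ℕ → ℕ → ℤ}
    (S : IsPathSystem d n u x) (hE : ∀ i < d, ∀ j, u i (j + 1) = u (i + 1) j →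
      x i (j + 1) = x i j → (j : ℤ) + 1 < n - x i j) : IsSettled d n 0 u x := by
  have key : ∀ e i, i + e + 1 = d → ∀ j, u i j = u (i + 1) j → 0 ≤ (n : ℤ) - 1 - j - x i j := by
    intro e
    induction e with
    | zero =>
      intro i hi j
      induction j with
      | zero =>
        intro _
        have := S.x_lt_n i 0 (by omega)
        push_cast
        omega
      | succ j ih =>
        intro h
        have h1 := S.u_last (i + 1) (j + 1) (by omega)
        have h2 := S.u_last (i + 1) j (by omega)
        have h3 := S.u_mono i j
        have h4 := ih (by omega)
        have h5 := hE i (by omega) j (by omega)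
        have h6 := S.x_step i j (by omega)
        push_cast
        omega
    | succ e ihe =>
      intro i hi j
      induction j with
      | zero =>
        intro _
        have := S.x_lt_n i 0 (by omega)
        push_cast
        omega
      | succ j ih =>
        intro h
        have h1 := S.u_mono i j
        have h2 := S.u_le i j
        have h3 := S.u_step i j
        have h4 := S.x_step i j (by omega)
        by_cases h5 : u i (j + 1) = u (i + 1) j
        · have h6 := ih (by omega)
          have h7 := hE i (by omega) j h5
          push_cast
          omega
        · have h6 := S.u_step (i + 1) j
          have h7 := S.u_le (i + 1) j
          -- Here path `i + 1` has its upward triangle in strip `j`, so it enters through a back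
          -- edge labelled 1.
          have h8 := ihe (i + 1) (by omega) j (by omega)
          have h9 := S.x_lt i j (by omega)
          push_cast
          omega
  intro i hi j h
  simpa using key (d - i - 1) i (by omega) j h

theorem IsSettled.lt_of_letter {d n : ℕ} {u : ℕ → ℕ → ℕ} {x : ℕ → ℕ → ℤ}
    (hs : IsSettled d n 0 u x) (S : IsPathSystem d n u x) {i j : ℕ} (hi : i < d)
    (h : u i (j + 1) = u (i + 1) j) (hx : x i (j + 1) = x i j) : (j : ℤ) + 1 < n - x i j := by
  have := hs i hi (j + 1) (S.succ_eq_of_letter h)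
  push_cast at this
  omega

namespace SkewBarredTableau

variable {d n : ℕ} {lam mu nu : Fin d → ℕ} (L : SkewBarredTableau lam mu)

theorem pathX_succ_eq_iff {i : ℕ} (hi : i < d) (j : ℕ) :
    L.pathX n i (j + 1) = L.pathX n i j ↔ ¬ IsUnbarredStep L.bar L.pathU i j := by
  have h : IsUnbarredStep L.bar (arrayU d (rowLength mu) L.val) i j ↔
    IsUnbarredStep L.bar L.pathU i j := Iff.rfl
  simp only [pathX, arrayX, if_pos hi, arrayCount, Nat.count_succ, h]
  split_ifs with h1 <;> simp [h1]

/-- The strip in which the path meets the box in row `r` and column `c`. -/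
def boxTime (r : Fin d) (c : Fin (mu r)) : ℕ := d - 1 - r - ((L.bot r c).1 : ℕ) + c

variable (hdn : d ≤ n) (hmu : IsBoxPartition d n mu)
include hdn hmu

theorem pathU_boxTime (r : Fin d) (c : Fin (mu r)) :
    L.pathU (L.bot r c).1 (L.boxTime r c) = d - 1 - r - ((L.bot r c).1 : ℕ) ∧
      L.pathU (L.bot r c).1 (L.boxTime r c + 1) = d - 1 - r - ((L.bot r c).1 : ℕ) ∧
      L.pathU ((L.bot r c).1 + 1) (L.boxTime r c) = d - 1 - r - ((L.bot r c).1 : ℕ) := by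
  have h : d - 1 - r + r + 1 = d := by omega
  have h1 := (L.isTableauArray hdn hmu).letter_of_box (t := d - 1 - r) (c := c) (by omega)
    (by rw [rowLength_eq mu h]; exact c.2)
  rwa [L.val_eq h] at h1

theorem pathX_boxTime_iff (r : Fin d) (c : Fin (mu r)) :
    L.pathX n (L.bot r c).1 (L.boxTime r c + 1) = L.pathX n (L.bot r c).1 (L.boxTime r c) ↔
      (L.bot r c).2 = true := by
  have h : d - 1 - r + r + 1 = d := by omega
  have h1 := L.value_le hdn hmu r c
  obtain ⟨h2, h3, h4⟩ := L.pathU_boxTime hdn hmu r c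
  rw [L.pathX_succ_eq_iff (L.bot r c).1.2, IsUnbarredStep, h2, h3, h4, boxTime,
    show ((L.bot r c).1 : ℕ) + (d - 1 - r - ((L.bot r c).1 : ℕ)) = d - 1 - r by omega,
    show d - 1 - r - ((L.bot r c).1 : ℕ) + c - (d - 1 - r - ((L.bot r c).1 : ℕ)) = c by omega,
    L.bar_eq h]
  simp

theorem exists_box_of_letter {i j : ℕ} (hi : i < d) (h : L.pathU i (j + 1) = L.pathU (i + 1) j) :
    ∃ (r : Fin d) (c : Fin (mu r)), ((L.bot r c).1 : ℕ) = i ∧ L.boxTime r c = j := by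
  obtain ⟨h1, h2, h3, h4⟩ := (L.isTableauArray hdn hmu).box_of_letter hi h
  generalize arrayU d (rowLength mu) L.val i j = m at h1 h2 h3 h4
  have h5 : i + m + (⟨d - 1 - (i + m), by omega⟩ : Fin d) + 1 = d := by simp only; omega
  rw [rowLength_eq mu h5] at h3
  have h6 := L.val_eq h5 ⟨j - m, h3⟩
  simp only at h6
  rw [h4] at h6
  refine ⟨_, ⟨j - m, h3⟩, h6.symm, ?_⟩
  rw [boxTime, ← h6]
  simp only
  omega

/-- Value and strip determine the row through `u = t - i`, and then the column. -/
theorem box_injective {r r' : Fin d} {c : Fin (mu r)} {c' : Fin (mu r')}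
    (hv : (L.bot r c).1 = (L.bot r' c').1) (hj : L.boxTime r c = L.boxTime r' c') :
    (⟨r, c⟩ : (r : Fin d) × Fin (mu r)) = ⟨r', c'⟩ := by
  have h1 := L.value_le hdn hmu r c
  have h2 := L.value_le hdn hmu r' c'
  have h3 := (L.pathU_boxTime hdn hmu r c).1
  have h4 := (L.pathU_boxTime hdn hmu r' c').1
  rw [hv] at h1 h3
  rw [hj] at h3
  obtain rfl : r = r' := Fin.ext (by omega)
  rw [boxTime, boxTime, hv] at hj
  obtain rfl : c = c' := Fin.ext (by omega)
  rfl

/-- The index `f` of a box is one more than the number of its strip. -/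
theorem boxTime_succ (r : Fin d) (c : Fin (mu r)) :
    (d : ℤ) - ((L.bot r c).1 : ℕ) + (c : ℕ) - (r : ℕ) = L.boxTime r c + 1 := by
  have := L.value_le hdn hmu r c
  rw [boxTime]
  omega

variable (hlam : IsBoxPartition d n lam) (hL : L ∈ LRTableaux lam mu nu)
include hlam hL

/-- The letters of value `i` read before the box are the `lam i` from the top part and the unbarred
steps of path `i` before this strip, so `e` is the distance of the path from position `n`. -/
theorem contentBefore_eq_sub (r : Fin d) (c : Fin (mu r)) :
    (d : ℤ) - ((L.bot r c).1 : ℕ) + L.contentBefore (.bot r c) (L.bot r c).1 =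
      n - L.pathX n (L.bot r c).1 (L.boxTime r c) := by
  rw [L.contentBefore_eq (L.top_eq hlam hL) hdn hmu, pathX, arrayX, if_pos (L.bot r c).1.2,
    startPosition, dif_pos (L.bot r c).1.2, boxTime]
  push_cast
  ring

/-- With `e = n - x` and `f = j + 1`, positivity says that each equivariant piece lies above `D`;
`isSettled_zero` extends this to the whole path. -/
theorem mem_LRTableauxPos_iff (hnu : IsBoxPartition d n nu) :
    L ∈ LRTableauxPos lam mu nu ↔ IsSettled d n 0 L.pathU (L.pathX n) := by
  have S := L.isPathSystem hdn hlam hmu hL hnu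
  have h1 : (∀ p ∈ L.factorialFactors, p.2 < p.1) ↔ ∀ (r : Fin d) (c : Fin (mu r)),
      (L.bot r c).2 = true →
        (L.boxTime r c : ℤ) + 1 < n - L.pathX n (L.bot r c).1 (L.boxTime r c) := by
    simp only [factorialFactors, Multiset.mem_map, barredBoxes, Finset.filter_val,
      Multiset.mem_filter, Finset.mem_val, Finset.mem_univ, true_and, forall_exists_index,
      and_imp, Sigma.forall]
    constructor
    · intro h r c hb
      have h2 := h _ r c hb rfl
      simp only at h2
      rwa [L.contentBefore_eq_sub hdn hmu hlam hL, L.boxTime_succ hdn hmu] at h2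
    · rintro h _ r c hb rfl
      simp only
      rw [L.contentBefore_eq_sub hdn hmu hlam hL, L.boxTime_succ hdn hmu]
      exact h r c hb
  rw [LRTableauxPos, Set.mem_ofPred_eq, and_iff_right hL, h1]
  constructor
  · intro h
    refine S.isSettled_zero fun i hi j hij hx => ?_
    obtain ⟨r, c, rfl, rfl⟩ := L.exists_box_of_letter hdn hmu hi hij
    exact h r c ((L.pathX_boxTime_iff hdn hmu r c).1 hx)
  · intro hs r c hb
    have h2 := L.pathU_boxTime hdn hmu r c
    exact hs.lt_of_letter S (L.bot r c).1.2 (by omega) ((L.pathX_boxTime_iff hdn hmu r c).2 hb)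

end SkewBarredTableau

/-! ### Weights -/

theorem IsPathSystem.horLabel_eq_eqv_iff {d n : ℕ} {u : ℕ → ℕ → ℕ} {x : ℕ → ℕ → ℤ}
    (S : IsPathSystem d n u x) {a : ℤ} {j : ℕ} : horLabel d u x a j = .eqv ↔
      ∃ i < d, x i j = a ∧ x i (j + 1) = x i j ∧ u i (j + 1) = u (i + 1) j := by
  constructor
  · intro h
    by_cases ha : ∃ i < d, x i j = a
    · obtain ⟨i, hi, rfl⟩ := ha
      rw [S.horLabel_at hi] at h
      split_ifs at h with h1 h2
      exact ⟨i, hi, rfl, h2, not_not.1 h1⟩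
    · classical
      rw [horLabel_none fun i hi h' => ha ⟨i, hi, h'⟩] at h
      split_ifs at h
  · rintro ⟨i, hi, rfl, h1, h2⟩
    rw [S.horLabel_at hi, if_neg (not_not.2 h2), if_pos h1]

theorem IsPathSystem.equivariant_mem_iff {d n h : ℕ} {u : ℕ → ℕ → ℕ} {x : ℕ → ℕ → ℤ}
    (S : IsPathSystem d n u x) (hs : IsSettled d n h u x) {a b : ℤ} :
    (⟨.equivariant, a, b⟩ : Piece) ∈ labelPieces n h (pathLabels d n u x) ↔
      ∃ i < d, ∃ j : ℕ, x i j = a ∧ (n : ℤ) - 1 - j - a - 1 = b ∧ x i (j + 1) = x i j ∧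
        u i (j + 1) = u (i + 1) j := by
  rw [mem_labelPieces]
  simp only [Piece.cells, Finset.mem_insert, Finset.mem_singleton, forall_eq_or_imp,
    forall_eq, inside_up, inside_down, Piece.Fits, pathLabels, S.horLabel_eq_eqv_iff]
  constructor
  · rintro ⟨h1, i, hi, h2⟩
    exact ⟨i, hi, _, h2.1, by omega, h2.2⟩
  · rintro ⟨i, hi, j, rfl, rfl, h1, h2⟩
    have h3 := hs i hi (j + 1) (S.succ_eq_of_letter h2)
    have h4 := S.x_nonneg i j hi
    have h5 := S.x_lt_n i j hi
    push_cast at h3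
    refine ⟨by omega, i, hi, ?_⟩
    have h6 : ((n : ℤ) - 1 - x i j - ((n : ℤ) - 1 - j - x i j - 1 + 1)).toNat = j := by omega
    rw [h6]
    exact ⟨rfl, h1, h2⟩

namespace SkewBarredTableau

variable {d n : ℕ} {lam mu nu : Fin d → ℕ} (L : SkewBarredTableau lam mu)

/-- The puzzle of height `h` of a Littlewood-Richardson tableau. -/
noncomputable def puzzle (n h : ℕ) : Finset Piece :=
  labelPieces n h (pathLabels d n L.pathU (L.pathX n))

variable (hdn : d ≤ n) (hlam : IsBoxPartition d n lam) (hmu : IsBoxPartition d n mu)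
  (hnu : IsBoxPartition d n nu) (hL : L ∈ LRTableaux lam mu nu) {h : ℕ}
  (hs : IsSettled d n h L.pathU (L.pathX n))
include hdn hlam hmu hnu hL hs

/-- Barred boxes, letters where `x` does not move, and equivariant pieces correspond bijectively,
and the center of such a piece gives the same pair `(n - x i j, j + 1)` as the box. -/
theorem puzzleFactorialFactors_eq :
    puzzleFactorialFactors n (L.puzzle n h) = L.factorialFactors := by
  have S := L.isPathSystem hdn hlam hmu hL hnu
  symm
  rw [puzzleFactorialFactors, factorialFactors]
  refine Multiset.map_eq_map_of_bij_of_nodup _ _ L.barredBoxes.nodup (Finset.nodup _)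
    (fun a _ => ⟨.equivariant, L.pathX n (L.bot a.1 a.2).1 (L.boxTime a.1 a.2),
      (n : ℤ) - 1 - L.boxTime a.1 a.2 - L.pathX n (L.bot a.1 a.2).1 (L.boxTime a.1 a.2) - 1⟩)
    ?_ ?_ ?_ ?_
  · rintro ⟨r, c⟩ ha
    simp only [barredBoxes, Finset.mem_val, Finset.mem_filter, Finset.mem_univ, true_and] at ha
    rw [Finset.mem_val, Finset.mem_filter]
    refine ⟨(S.equivariant_mem_iff hs).2 ?_, rfl⟩
    have h1 := L.pathU_boxTime hdn hmu r c
    exact ⟨_, (L.bot r c).1.2, L.boxTime r c, rfl, rfl, (L.pathX_boxTime_iff hdn hmu r c).2 ha,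
      h1.2.1.trans h1.2.2.symm⟩
  · rintro ⟨r, c⟩ ha ⟨r', c'⟩ ha' h1
    simp only [Piece.mk.injEq, true_and] at h1
    obtain ⟨h1, h2⟩ := h1
    have h3 : L.boxTime r c = L.boxTime r' c' := by omega
    rw [h3] at h1
    exact L.box_injective hdn hmu (Fin.ext (S.x_inj (L.bot r c).1.2 (L.bot r' c').1.2 h1)) h3
  · rintro ⟨k, a, b⟩ hp
    rw [Finset.mem_val, Finset.mem_filter] at hp
    obtain ⟨hp, rfl⟩ := hp
    obtain ⟨i, hi, j, rfl, rfl, h1, h2⟩ := (S.equivariant_mem_iff hs).1 hp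
    obtain ⟨r, c, rfl, rfl⟩ := L.exists_box_of_letter hdn hmu hi h2
    refine ⟨⟨r, c⟩, ?_, rfl⟩
    simpa only [barredBoxes, Finset.mem_val, Finset.mem_filter, Finset.mem_univ, true_and] using
      (L.pathX_boxTime_iff hdn hmu r c).1 h1
  · rintro ⟨r, c⟩ -
    simp only
    rw [L.contentBefore_eq_sub hdn hmu hlam hL, L.boxTime_succ hdn hmu]
    refine Prod.ext rfl ?_
    simp only
    ring

omit hdn hlam hmu hnu hL hs in
theorem equivariantFactors_eq : L.equivariantFactors n =
    L.factorialFactors.map fun q => ((n : ℤ) + 1 - q.2, (n : ℤ) + 1 - q.1) := by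
  rw [factorialFactors, equivariantFactors, Multiset.map_map]
  refine Multiset.map_congr rfl fun a _ => Prod.ext ?_ ?_ <;> simp only [Function.comp_apply] <;>
    ring

theorem sameWeights : SameWeights n (L.puzzle n h) L := by
  have h1 := L.puzzleFactorialFactors_eq hdn hlam hmu hnu hL hs
  have h2 : puzzleEquivariantFactors n (L.puzzle n h) = L.equivariantFactors n := by
    rw [puzzleEquivariantFactors, h1, L.equivariantFactors_eq]
  refine ⟨h1, h2, by rw [h1], by rw [h2], ?_⟩
  intro q hq
  have S := L.isPathSystem hdn hlam hmu hL hnu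
  simp only [puzzleFactorialFactors, Multiset.mem_map, Finset.mem_val, Finset.mem_filter] at hq
  obtain ⟨⟨k, a, b⟩, ⟨hp, rfl⟩, rfl⟩ := hq
  obtain ⟨i, hi, j, rfl, rfl, h3, h4⟩ := (S.equivariant_mem_iff hs).1 hp
  have h5 := S.x_nonneg i j hi
  have h6 := S.x_lt_n i j hi
  have h7 := S.lt_of_eq hi (S.eq_of_letter h4)
  simp only
  omega

end SkewBarredTableau

/-! ### Following paths -/

/-- A potential that decreases along paths. -/
def Piece.potential (p : Piece) : ℤ :=
  match p.kind with
  | .upTri _ => 2 * (p.x + p.y) + 1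
  | .downTri _ => 2 * (p.x + p.y) + 2
  | .horOne => 2 * (p.x + p.y) + 2
  | _ => 2 * (p.x + p.y) + 3

/-- The potential at the start of a path. -/
def Edge.potential : Edge → ℤ
  | .hor x y => 2 * (x + y)
  | .slash x y => 2 * (x + y)
  | .back x y => 2 * (x + y) + 1

/-- Each piece has the potential of the edge through which it is entered, and the exit edge has a
smaller one; so no piece is repeated. -/
theorem followPath_aux (P : Finset Piece) (m : ℕ) (e : Edge) :
    (followPath P m e).Nodup ∧ ∀ p ∈ followPath P m e, p ∈ P ∧ p.potential ≤ e.potential := by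
  have cons : ∀ (p : Piece) (l : List Piece) (e e' : Edge), p ∈ P → p.potential = e.potential →
      e'.potential < e.potential →
      (l.Nodup ∧ ∀ q ∈ l, q ∈ P ∧ q.potential ≤ e'.potential) →
      (p :: l).Nodup ∧ ∀ q ∈ p :: l, q ∈ P ∧ q.potential ≤ e.potential := by
    rintro p l e e' h1 h2 h3 ⟨h4, h5⟩
    refine ⟨List.nodup_cons.2 ⟨fun h => ?_, h4⟩, ?_⟩
    · have := (h5 p h).2
      omega
    · intro q hq
      rcases List.mem_cons.1 hq with rfl | hq
      · exact ⟨h1, h2.le⟩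
      · exact ⟨(h5 q hq).1, (h5 q hq).2.trans h3.le⟩
  induction m generalizing e with
  | zero => simp [followPath]
  | succ m ih =>
    cases e with
    | slash x y => simp [followPath]
    | back x y =>
      rw [followPath]
      split_ifs with h1 h2 h3
      · exact cons _ _ _ _ h1 (by simp only [Piece.potential, Edge.potential])
          (by simp only [Edge.potential]; omega) (ih _)
      · exact cons _ _ _ _ h2 (by simp only [Piece.potential, Edge.potential]; omega)
          (by simp only [Edge.potential]; omega) (ih _)
      · exact cons _ _ _ _ h3 (by simp only [Piece.potential, Edge.potential]; omega)
          (by simp only [Edge.potential]; omega) (ih _)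
      · simp
    | hor x y =>
      rw [followPath]
      split_ifs with h1 h2
      · exact cons _ _ _ _ h1 (by simp only [Piece.potential, Edge.potential]; omega)
          (by simp only [Edge.potential]; omega) (ih _)
      · exact cons _ _ _ _ h2 (by simp only [Piece.potential, Edge.potential]; omega)
          (by simp only [Edge.potential]; omega) (ih _)
      · simp

theorem followPath_eq_take (P : Finset Piece) (m : ℕ) (e : Edge) :
    followPath P m e = (followPath P (m + 1) e).take m := by
  induction m generalizing e with
  | zero => simp [followPath]
  | succ m ih =>
    cases e with
    | slash x y => simp [followPath]
    | back x y =>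
      rw [followPath, followPath]
      split_ifs <;> simp [← ih]
    | hor x y =>
      rw [followPath, followPath]
      split_ifs <;> simp [← ih]

/-- A path without repetitions has at most `P.card` pieces, so extra fuel changes nothing. The
segments can therefore be computed with as much fuel as is convenient. -/
theorem followPath_add_card (P : Finset Piece) (m : ℕ) (e : Edge) :
    followPath P (P.card + m) e = followPath P P.card e := by
  have hlen : ∀ m, (followPath P m e).length ≤ P.card := fun m => by
    obtain ⟨h1, h2⟩ := followPath_aux P m e
    rw [← List.toFinset_card_of_nodup h1]
    exact Finset.card_le_card fun p hp => (h2 p (List.mem_toFinset.1 hp)).1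
  induction m with
  | zero => rfl
  | succ m ih =>
    rw [← ih, followPath_eq_take P (P.card + m), List.take_of_length_le, add_assoc]
    exact (hlen _).trans (Nat.le_add_right _ _)

/-- The `k`-th segment of a path. -/
def pathSegment (l : List Piece) (k : ℕ) : List Piece :=
  ((l.splitOnP fun p => decide (p.kind = .upTri true)).getD k []).filter
    fun p => decide (p.kind = .backOne ∨ p.kind = .equivariant)

theorem pathSegment_nil (k : ℕ) : pathSegment [] k = [] := by
  cases k <;> simp [pathSegment]

theorem pathSegment_upTri_zero {p : Piece} (hp : p.kind = .upTri true) (l : List Piece) :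
    pathSegment (p :: l) 0 = [] := by
  simp [pathSegment, List.splitOnP_cons_eq_if_modifyHead, hp]

theorem pathSegment_upTri_succ {p : Piece} (hp : p.kind = .upTri true) (l : List Piece) (k : ℕ) :
    pathSegment (p :: l) (k + 1) = pathSegment l k := by
  simp [pathSegment, List.splitOnP_cons_eq_if_modifyHead, hp]

theorem pathSegment_cons {p : Piece} (hp : p.kind ≠ .upTri true) (l : List Piece) (k : ℕ) :
    pathSegment (p :: l) k =
      if k = 0 ∧ (p.kind = .backOne ∨ p.kind = .equivariant) then p :: pathSegment l k
      else pathSegment l k := by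
  simp only [pathSegment, List.splitOnP_cons_eq_if_modifyHead, hp, decide_false, Bool.false_eq_true,
    if_false]
  obtain ⟨a, t, h⟩ := List.exists_cons_of_ne_nil
    (List.splitOnP_ne_nil (fun p : Piece => decide (p.kind = .upTri true)) l)
  rw [h]
  rcases k with _ | k
  · by_cases h2 : p.kind = .backOne ∨ p.kind = .equivariant <;> simp [h2]
  · simp

/-- The piece in the strip `j` of a path, if the path enters and leaves this strip through back
edges labelled 1. -/
def stepPiece (n : ℕ) (x : ℕ → ℕ → ℤ) (i j : ℕ) : Piece :=
  if x i (j + 1) = x i j then ⟨.equivariant, x i j, (n : ℤ) - 1 - j - x i j - 1⟩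
  else ⟨.backOne, x i j - 1, (n : ℤ) - 1 - j - x i j⟩

/-- The strips `j, …, j + e - 1` in which the path `i` has a piece of its `c`-th segment. -/
def segmentTimes (u : ℕ → ℕ → ℕ) (i j e c : ℕ) : List ℕ :=
  (List.range' j e).filter fun j => u i (j + 1) = u (i + 1) j ∧ u i j = c

theorem segmentTimes_succ_of_ne {u : ℕ → ℕ → ℕ} {i j : ℕ} (h : u i (j + 1) ≠ u (i + 1) j)
    (e c : ℕ) : segmentTimes u i j (e + 1) c = segmentTimes u i (j + 1) e c := by
  simp [segmentTimes, List.range'_succ, h]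

theorem segmentTimes_succ_of_eq {u : ℕ → ℕ → ℕ} {i j : ℕ} (h : u i (j + 1) = u (i + 1) j)
    (e c : ℕ) : segmentTimes u i j (e + 1) c =
      if u i j = c then j :: segmentTimes u i (j + 1) e c else segmentTimes u i (j + 1) e c := by
  split_ifs with hc <;> simp [segmentTimes, List.range'_succ, h, hc]

namespace IsPathSystem

variable {d n h : ℕ} {u : ℕ → ℕ → ℕ} {x : ℕ → ℕ → ℤ} (S : IsPathSystem d n u x)
  (hs : IsSettled d n h u x)
include S

theorem pathLabels_at {i : ℕ} (hi : i < d) (j : ℕ) :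
    pathLabels d n u x (.back (x i j) ((n : ℤ) - 1 - j - x i j)) =
      (if u i j = u (i + 1) j then .one else .inner) ∧
    pathLabels d n u x (.slash (x i j) ((n : ℤ) - 1 - j - x i j)) =
      (if x i (j + 1) ≠ x i j then .inner else if u i (j + 1) ≠ u i j then .one else .zero) ∧
    pathLabels d n u x (.hor (x i j) ((n : ℤ) - 1 - j - x i j)) =
      (if u i (j + 1) ≠ u (i + 1) j then .one else
        if x i (j + 1) = x i j then .eqv else .zero) := by
  have h1 : ((n : ℤ) - 1 - x i j - ((n : ℤ) - 1 - j - x i j)).toNat = j := by omega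
  simp only [pathLabels, h1]
  exact ⟨S.backLabel_at hi, S.slashLabel_at hi, S.horLabel_at hi⟩

include hs

theorem followPath_back {i j : ℕ} (hi : i < d) (hu : u i j = u (i + 1) j) (m : ℕ) :
    followPath (labelPieces n h (pathLabels d n u x)) (m + 1)
        (.back (x i j) ((n : ℤ) - 1 - j - x i j)) =
      if u i (j + 1) = u (i + 1) j then
        stepPiece n x i j :: followPath (labelPieces n h (pathLabels d n u x)) m
          (.back (x i (j + 1)) ((n : ℤ) - 1 - (j + 1 : ℕ) - x i (j + 1)))
      else ⟨.upTri true, x i j, (n : ℤ) - 1 - j - x i j⟩ ::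
        followPath (labelPieces n h (pathLabels d n u x)) m
          (.hor (x i (j + 1)) ((n : ℤ) - (j + 1 : ℕ) - x i (j + 1))) := by
  obtain ⟨h1, h2, h3⟩ := S.pathLabels_at hi j
  have h4 := hs i hi j hu
  have h5 := S.x_nonneg i j hi
  have h6 := S.x_lt_n i j hi
  have h7 := S.x_step i j hi
  have h8 := S.x_nonneg i (j + 1) hi
  rw [followPath]
  -- A path that enters through a back edge labelled 1 meets an upward 1-triangle exactly when it
  -- has no letter in this strip.
  have ht : (⟨.upTri true, x i j, (n : ℤ) - 1 - j - x i j⟩ : Piece) ∈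
      labelPieces n h (pathLabels d n u x) ↔ u i (j + 1) ≠ u (i + 1) j := by
    have hu1 := S.u_mono i j
    rw [mem_labelPieces]
    simp only [Piece.cells, Finset.mem_singleton, forall_eq, inside_up, Piece.Fits, h1, h2, h3]
    constructor
    · rintro ⟨-, h9, -⟩ hl
      rw [if_neg (not_not.2 hl)] at h9
      split_ifs at h9 <;> cases h9
    · intro hl
      rw [if_pos hl, if_neg (by omega), if_pos (by omega), if_pos hu]
      exact ⟨by omega, rfl, rfl, rfl⟩
  by_cases hl : u i (j + 1) = u (i + 1) j
  · rw [if_neg (ht.not.2 (not_not.2 hl)), if_pos hl]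
    by_cases hx : x i (j + 1) = x i j
    · have hb : (⟨.backOne, x i j - 1, (n : ℤ) - 1 - j - x i j⟩ : Piece) ∉
          labelPieces n h (pathLabels d n u x) := by
        rw [mem_labelPieces]
        rintro ⟨-, h9⟩
        simp only [Piece.Fits, sub_add_cancel, h2, hx, ne_eq, not_true_eq_false, if_false] at h9
        split_ifs at h9
      have he : (⟨.equivariant, x i j, (n : ℤ) - 1 - j - x i j - 1⟩ : Piece) ∈
          labelPieces n h (pathLabels d n u x) :=
        (S.equivariant_mem_iff hs).2 ⟨i, hi, j, rfl, rfl, hx, hl⟩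
      rw [if_neg hb, if_pos he, stepPiece, if_pos hx, hx]
      congr 3
      push_cast
      ring
    · have hb : (⟨.backOne, x i j - 1, (n : ℤ) - 1 - j - x i j⟩ : Piece) ∈
          labelPieces n h (pathLabels d n u x) := by
        rw [mem_labelPieces]
        simp only [Piece.cells, Finset.mem_insert, Finset.mem_singleton, forall_eq_or_imp,
          forall_eq, inside_up, inside_down, Piece.Fits, sub_add_cancel, h2, hx, ne_eq,
          not_false_eq_true, if_true, and_true]
        omega
      rw [if_pos hb, stepPiece, if_neg hx]
      congr 3 <;> omega
  · rw [if_pos (ht.2 hl), if_neg hl]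
    congr 3 <;> omega

/-- The horizontal edge here belongs to strip `j - 1`, whose lower half ends on line `j`; hence the
need for `0 < j`. State `0` on line `j` means that the vertical run has just ended in a downward
1-triangle. -/
theorem followPath_hor_eq {i j : ℕ} (hi : i < d) (hu : u i j = u (i + 1) j)
    (hl : pathLabels d n u x (.hor (x i j) ((n : ℤ) - j - x i j)) = .one) (hj : 0 < j) (m : ℕ) :
    followPath (labelPieces n h (pathLabels d n u x)) (m + 1)
        (.hor (x i j) ((n : ℤ) - j - x i j)) =
      ⟨.downTri true, x i j, (n : ℤ) - 1 - j - x i j⟩ ::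
        followPath (labelPieces n h (pathLabels d n u x)) m
          (.back (x i j) ((n : ℤ) - 1 - j - x i j)) := by
  obtain ⟨h1, -, -⟩ := S.pathLabels_at hi j
  have h4 := hs i hi j hu
  have h5 := S.x_nonneg i j hi
  have h6 := S.x_lt_n i j hi
  have h7 : (n : ℤ) - j - x i j - 1 = n - 1 - j - x i j := by ring
  have h8 : (n : ℤ) - 1 - j - x i j + 1 = n - j - x i j := by ring
  rw [followPath, h7, if_pos]
  rw [mem_labelPieces]
  have h9 := S.isLabeled_down (a := x i j) (b := (n : ℤ) - 1 - j - x i j) (by omega)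
  simp only [UnitTriangle.IsLabeled, h8, hl, h1, hu, if_true] at h9
  simp only [Piece.cells, Finset.mem_singleton, forall_eq, inside_down, Piece.Fits, h8, hl, h1, hu,
    if_true]
  refine ⟨by omega, rfl, ?_, rfl⟩
  generalize pathLabels d n u x (.slash (x i j + 1) ((n : ℤ) - 1 - j - x i j)) = g at h9 ⊢
  cases h9
  rfl

omit hs in
theorem followPath_hor_ne {i j : ℕ} (hi : i < d) (hu : u i j ≠ u (i + 1) j) (hj : 0 < j) (m : ℕ) :
    followPath (labelPieces n h (pathLabels d n u x)) (m + 1)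
        (.hor (x i j) ((n : ℤ) - j - x i j)) =
      if -(h : ℤ) ≤ (n : ℤ) - 1 - j - x i j then
        ⟨.horOne, x i j, (n : ℤ) - 1 - j - x i j⟩ ::
          followPath (labelPieces n h (pathLabels d n u x)) m
            (.hor (x i (j + 1)) ((n : ℤ) - (j + 1 : ℕ) - x i (j + 1)))
      else [] := by
  obtain ⟨h1, -, -⟩ := S.pathLabels_at hi j
  have h5 := S.x_nonneg i j hi
  have h6 := S.x_lt_n i j hi
  have h7 : (n : ℤ) - j - x i j - 1 = n - 1 - j - x i j := by ring
  have h8 : x i (j + 1) = x i j :=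
    S.x_succ_of_not_letter hi fun h' => hu (S.eq_of_letter h')
  rw [followPath, h7, if_neg]
  · have h9 : (⟨.horOne, x i j, (n : ℤ) - 1 - j - x i j⟩ : Piece) ∈
        labelPieces n h (pathLabels d n u x) ↔ -(h : ℤ) ≤ (n : ℤ) - 1 - j - x i j := by
      rw [mem_labelPieces]
      simp only [Piece.cells, Finset.mem_insert, Finset.mem_singleton, forall_eq_or_imp,
        forall_eq, inside_up, inside_down, Piece.Fits, h1, hu, if_false, and_true]
      omega
    simp only [h9, h8]
    congr 4
    push_cast
    ring
  · rw [mem_labelPieces]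
    rintro ⟨-, -, -, h9⟩
    rw [h1, if_neg hu] at h9
    cases h9

/-- The segments of the path `i`, followed from the line `j`. -/
theorem pathSegment_followPath {i : ℕ} (hi : i < d) (e : ℕ) : ∀ j, j + e = n + h →
    (u i j = u (i + 1) j → ∀ m, 2 * e ≤ m → ∀ k,
      pathSegment (followPath (labelPieces n h (pathLabels d n u x)) m
        (.back (x i j) ((n : ℤ) - 1 - j - x i j))) k =
          (segmentTimes u i j e (u i j + k)).map (stepPiece n x i)) ∧
    (0 < j → pathLabels d n u x (.hor (x i j) ((n : ℤ) - j - x i j)) = .one →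
      ∀ m, 2 * e + 1 ≤ m → ∀ k,
      pathSegment (followPath (labelPieces n h (pathLabels d n u x)) m
        (.hor (x i j) ((n : ℤ) - j - x i j))) k =
          (segmentTimes u i j e (u i j + k)).map (stepPiece n x i)) := by
  -- Here `e` is the number of remaining strips. A strip costs at most two pieces, and an initial
  -- horizontal edge one more, which explains the fuel bounds `2 * e` and `2 * e + 1`.
  induction e with
  | zero =>
    intro j hj
    have h1 : u i j ≠ u (i + 1) j := fun h' => by
      have := S.lt_of_eq hi h'
      omega
    refine ⟨fun h' => absurd h' h1, ?_⟩
    intro hj0 _ m hm k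
    obtain ⟨m, rfl⟩ := Nat.exists_eq_add_of_le' (show 1 ≤ m by omega)
    have := S.x_nonneg i j hi
    rw [S.followPath_hor_ne hi h1 hj0, if_neg (by omega), pathSegment_nil]
    simp [segmentTimes]
  | succ e ih =>
    intro j hj
    obtain ⟨ih1, ih2⟩ := ih (j + 1) (by omega)
    have hback : u i j = u (i + 1) j → ∀ m, 2 * (e + 1) ≤ m → ∀ k,
      pathSegment (followPath (labelPieces n h (pathLabels d n u x)) m
        (.back (x i j) ((n : ℤ) - 1 - j - x i j))) k =
          (segmentTimes u i j (e + 1) (u i j + k)).map (stepPiece n x i) := by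
      intro hu m hm k
      obtain ⟨m, rfl⟩ := Nat.exists_eq_add_of_le' (show 1 ≤ m by omega)
      rw [S.followPath_back hs hi hu]
      split_ifs with hl
      · have h1 : u i (j + 1) = u i j := by omega
        have h2 : (stepPiece n x i j).kind ≠ .upTri true ∧
            ((stepPiece n x i j).kind = .backOne ∨ (stepPiece n x i j).kind = .equivariant) := by
          rw [stepPiece]
          split_ifs <;> simp
        rw [pathSegment_cons h2.1, ih1 (S.succ_eq_of_letter hl) m (by omega),
          segmentTimes_succ_of_eq hl, h1]
        rcases k with _ | k
        · simp [h2.2]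
        · simp
      · have h1 : u i (j + 1) = u i j + 1 := by
          have := S.u_step i j
          have := S.u_mono i j
          omega
        have h2 := (S.pathLabels_at hi j).2.2
        rw [if_pos hl, ← S.x_succ_of_not_letter hi hl] at h2
        rw [segmentTimes_succ_of_ne hl]
        rcases k with _ | k
        -- After the upward triangle the count exceeds `u i j` for good, so the current segment gets
        -- no further pieces.
        · rw [pathSegment_upTri_zero rfl, segmentTimes, List.filter_eq_nil_iff.2, List.map_nil]
          intro j' hj'
          have h3 := S.u_monotone i (List.mem_range'_1.1 hj').1
          simp only [decide_eq_true_eq]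
          omega
        · rw [pathSegment_upTri_succ rfl, ih2 (Nat.succ_pos j) ?_ m (by omega), h1]
          · congr 2
            omega
          · rw [← h2]
            congr 2
            push_cast
            ring
    refine ⟨hback, fun hj0 hl m hm k => ?_⟩
    obtain ⟨m, rfl⟩ := Nat.exists_eq_add_of_le' (show 1 ≤ m by omega)
    by_cases hu : u i j = u (i + 1) j
    · rw [S.followPath_hor_eq hs hi hu hl hj0, pathSegment_cons (by simp), if_neg (by simp)]
      exact hback hu m (by omega) k
    · rw [S.followPath_hor_ne hi hu hj0]
      have hl' : u i (j + 1) ≠ u (i + 1) j := fun h' => hu (S.eq_of_letter h')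
      split_ifs with hy
      · have h1 : u i (j + 1) = u i j := by
          have := S.u_step i j
          have := S.u_mono i j
          have := S.u_le i j
          omega
        have h2 := (S.pathLabels_at hi j).2.2
        rw [if_pos hl', ← S.x_succ_of_not_letter hi hl'] at h2
        rw [pathSegment_cons (by simp), if_neg (by simp), ih2 (Nat.succ_pos j) ?_ m (by omega), h1,
          segmentTimes_succ_of_ne hl']
        rw [← h2]
        congr 2
        push_cast
        ring
      -- The path has left the region; from here on it is vertical and has no letters.
      · rw [pathSegment_nil, segmentTimes, List.filter_eq_nil_iff.2, List.map_nil]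
        intro j' hj'
        have h3 := (List.mem_range'_1.1 hj').1
        have h4 := S.x_eq_of_lt hs hi (by omega) h3
        have h5 := hs.ne hi (j := j') (by rw [h4]; omega)
        simp only [decide_eq_true_eq]
        exact fun h6 => h5 (S.eq_of_letter h6.1)

/-- Both lists are strictly increasing in position and have the same members. -/
theorem northEast_filter :
    ((edgesNE n).filter fun e => decide (HasLabel (labelPieces n h (pathLabels d n u x)) e true)) =
      (List.range d).map fun i => Edge.back (x i 0) ((n : ℤ) - 1 - x i 0) := by
  have H := S.isLabeling hs
  have h1 : ∀ a < n, HasLabel (labelPieces n h (pathLabels d n u x))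
      (.back (a : ℤ) ((n : ℤ) - 1 - a)) true ↔ ∃ i < d, x i 0 = a := by
    intro a ha
    rw [H.hasLabel_iff (t := .up a ((n : ℤ) - 1 - a)) (inside_up.2 (by omega))
      (by simp [UnitTriangle.edges])]
    have h2 : ((n : ℤ) - 1 - a - (n - 1 - a)).toNat = 0 := by omega
    simp only [pathLabels, h2]
    by_cases h3 : ∃ i < d, x i 0 = a
    · simp only [h3, iff_true]
      obtain ⟨i, hi, h3⟩ := h3
      rw [← h3, S.backLabel_at hi, if_pos (by rw [S.u_zero, S.u_zero])]
      rfl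
    · simp only [h3, iff_false]
      rw [backLabel_none fun i hi h => h3 ⟨i, hi, h⟩]
      simp [EdgeLabel.ofBool]
  have h2 : ((List.range n).filter fun a : ℕ => decide (∃ i < d, x i 0 = a)) =
      (List.range d).map fun i => (x i 0).toNat := by
    refine List.Pairwise.eq_of_mem_iff (r := (· < ·)) (List.pairwise_lt_range.filter _) ?_ ?_
    · rw [List.pairwise_map]
      refine List.pairwise_lt_range.imp_of_mem fun {i i'} hi hi' hii => ?_
      rw [List.mem_range] at hi hi'
      have := S.x_strictMono 0 hii hi'
      have := S.x_nonneg i 0 hi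
      omega
    · intro a
      simp only [List.mem_filter, List.mem_range, decide_eq_true_eq, List.mem_map]
      constructor
      · rintro ⟨-, i, hi, h⟩
        exact ⟨i, hi, by omega⟩
      · rintro ⟨i, hi, h⟩
        have := S.x_nonneg i 0 hi
        have := S.x_lt_n i 0 hi
        exact ⟨by omega, i, hi, by omega⟩
  rw [edgesNE_eq, List.filter_map]
  have h3 : (List.range n).filter ((fun e => decide (HasLabel
      (labelPieces n h (pathLabels d n u x)) e true)) ∘
        fun a : ℕ => Edge.back (a : ℤ) ((n : ℤ) - 1 - a)) =
      (List.range n).filter fun a : ℕ => decide (∃ i < d, x i 0 = a) := by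
    refine List.filter_congr fun a ha => ?_
    simp only [Function.comp_apply, h1 a (List.mem_range.1 ha)]
  rw [h3, h2, List.map_map]
  refine List.map_congr_left fun i hi => ?_
  have h4 : ((x i 0).toNat : ℤ) = x i 0 := Int.toNat_of_nonneg (S.x_nonneg i 0 (List.mem_range.1 hi))
  simp only [Function.comp_apply, h4]

theorem puzzleSegment_eq {i : ℕ} (hi : i < d) (k : ℕ) :
    puzzleSegment n (labelPieces n h (pathLabels d n u x)) i k =
      (segmentTimes u i 0 (n + h) k).map (stepPiece n x i) := by
  have h1 : puzzlePath n (labelPieces n h (pathLabels d n u x)) i =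
      followPath (labelPieces n h (pathLabels d n u x))
        ((labelPieces n h (pathLabels d n u x)).card + 2 * (n + h))
        (.back (x i 0) ((n : ℤ) - 1 - (0 : ℕ) - x i 0)) := by
    rw [followPath_add_card, puzzlePath, S.northEast_filter hs]
    simp [hi]
  have h2 := (S.pathSegment_followPath hs hi (n + h) 0 (zero_add _)).1
    (by rw [S.u_zero, S.u_zero])
    ((labelPieces n h (pathLabels d n u x)).card + 2 * (n + h)) (Nat.le_add_left _ _) k
  rw [← h1, S.u_zero, zero_add] at h2
  exact h2

end IsPathSystem

/-! ### The correspondence -/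

theorem mem_segmentTimes {u : ℕ → ℕ → ℕ} {i j e c k : ℕ} : k ∈ segmentTimes u i j e c ↔
    (j ≤ k ∧ k < j + e) ∧ u i (k + 1) = u (i + 1) k ∧ u i k = c := by
  simp [segmentTimes, List.mem_range'_1]

/-- The boxes of a row of a tableau, grouped by their values. -/
theorem IsTableauArray.flatMap_segmentTimes {d n h : ℕ} {M : ℕ → ℕ} {V : ℕ → ℕ → ℕ}
    (A : IsTableauArray d n M V) {t : ℕ} (ht : t < d) :
    ((List.range (t + 1)).flatMap fun k =>
      (segmentTimes (arrayU d M V) (t - k) 0 (n + h) k).map fun j => j - k) =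
      List.range (M t) := by
  have hbox : ∀ k ≤ t, ∀ j ∈ segmentTimes (arrayU d M V) (t - k) 0 (n + h) k,
      k ≤ j ∧ j - k < M t ∧ V t (j - k) = t - k := by
    intro k hk j hj
    obtain ⟨-, h1, h2⟩ := mem_segmentTimes.1 hj
    have h3 := A.box_of_letter (by omega) h1
    rw [h2, Nat.sub_add_cancel hk] at h3
    exact ⟨h3.1, h3.2.2⟩
  -- Both lists are strictly increasing with the same members. Columns are numbered from the right,
  -- where values are largest, so the segments of value `t - k` appear with increasing `k`.
  refine List.Pairwise.eq_of_mem_iff (r := (· < ·)) ?_ List.pairwise_lt_range ?_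
  · rw [List.pairwise_flatMap]
    constructor
    · intro k hk
      rw [List.mem_range] at hk
      rw [List.pairwise_map]
      refine ((List.pairwise_lt_range' (n := n + h)).filter _).imp_of_mem fun {j j'} hj hj' hjj => ?_
      have h1 := hbox k (by omega) j hj
      omega
    · refine List.pairwise_lt_range.imp_of_mem fun {k k'} hk hk' hkk c hc c' hc' => ?_
      rw [List.mem_range] at hk hk'
      obtain ⟨j, hj, rfl⟩ := List.mem_map.1 hc
      obtain ⟨j', hj', rfl⟩ := List.mem_map.1 hc'
      have h1 := hbox k (by omega) j hj
      have h2 := hbox k' (by omega) j' hj'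
      by_contra h3
      have := A.row_le ht (not_lt.1 h3) h1.2.1
      omega
  · intro c
    rw [List.mem_flatMap, List.mem_range]
    constructor
    · rintro ⟨k, hk, hc⟩
      rw [List.mem_range] at hk
      obtain ⟨j, hj, rfl⟩ := List.mem_map.1 hc
      exact (hbox k (by omega) j hj).2.1
    · intro hc
      have h1 := A.letter_of_box ht hc
      have h2 := A.le_row ht hc
      have h3 := A.length_le t ht
      refine ⟨t - V t c, List.mem_range.2 (by omega), List.mem_map.2 ⟨t - V t c + c, ?_, by omega⟩⟩
      rw [mem_segmentTimes, show t - (t - V t c) = V t c by omega]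
      have := A.le
      exact ⟨by omega, by omega, h1.1⟩

namespace SkewBarredTableau

variable {d n : ℕ} {lam mu nu : Fin d → ℕ} (L : SkewBarredTableau lam mu)
variable (hdn : d ≤ n) (hlam : IsBoxPartition d n lam) (hmu : IsBoxPartition d n mu)
  (hnu : IsBoxPartition d n nu) (hL : L ∈ LRTableaux lam mu nu) {h : ℕ}
  (hs : IsSettled d n h L.pathU (L.pathX n))
include hdn hlam hmu hnu hL hs

theorem puzzleRow_eq {t : ℕ} (ht : t < d) : puzzleRow n (L.puzzle n h) t =
    (List.range (rowLength mu t)).map fun c => (L.val t c, L.bar t c) := by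
  have A := L.isTableauArray hdn hmu
  have S := L.isPathSystem hdn hlam hmu hL hnu
  rw [← A.flatMap_segmentTimes (h := h) ht, List.map_flatMap, puzzleRow]
  refine List.flatMap_congr fun k hk => ?_
  rw [List.mem_range] at hk
  rw [puzzle, S.puzzleSegment_eq hs (by omega), List.map_map, List.map_map]
  refine List.map_congr_left fun j hj => ?_
  obtain ⟨-, h1, h2⟩ := mem_segmentTimes.1 hj
  have h3 := A.box_of_letter (i := t - k) (j := j) (by omega) h1
  have h4 : arrayU d (rowLength mu) L.val (t - k) j = k := h2
  rw [h4, Nat.sub_add_cancel (by omega)] at h3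
  have h5 := L.pathX_succ_eq_iff (n := n) (i := t - k) (by omega) j
  rw [IsUnbarredStep, h2, Nat.sub_add_cancel (by omega), and_iff_right h1] at h5
  simp only [Function.comp_apply]
  refine Prod.ext h3.2.2.2.symm ?_
  simp only [stepPiece]
  split_ifs with h6
  · simpa using h5.1 h6
  · simpa using fun h7 => h6 (h5.2 h7)

theorem isPhi : IsPhi n (L.puzzle n h) L := by
  refine ⟨L.top_eq hlam hL, fun r => ?_⟩
  have h1 : d - 1 - r + r + 1 = d := by omega
  rw [L.puzzleRow_eq hdn hlam hmu hnu hL hs (by omega), rowLength_eq mu h1]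
  refine List.ext_getElem (by simp) fun c hc hc' => ?_
  rw [List.length_ofFn] at hc
  have h2 := L.val_eq h1 ⟨c, hc⟩
  have h3 := L.bar_eq h1 ⟨c, hc⟩
  simp only at h2 h3
  simp [h2, h3]

theorem puzzle_mem (hd : 0 < d) : L.puzzle n h ∈ HeightPuzzles n h lam mu nu :=
  (L.isPathSystem hdn hlam hmu hL hnu).mem_heightPuzzles hs (by omega) hdn hlam hmu hnu
    (L.hasBoundary hdn hlam hmu hL)

end SkewBarredTableau

/-- A puzzle corresponds to at most one tableau. -/
theorem IsPhi.unique {d n : ℕ} {lam mu : Fin d → ℕ} {P : Finset Piece}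
    {L L' : SkewBarredTableau lam mu} (hL : IsPhi n P L) (hL' : IsPhi n P L') : L = L' := by
  refine SkewBarredTableau.ext ?_ ?_
  · funext i j
    rw [hL.1, hL'.1]
  · funext r c
    have h := congrFun (List.ofFn_injective ((hL.2 r).trans (hL'.2 r).symm)) c
    rw [Prod.mk.injEq] at h
    exact Prod.ext (Fin.ext h.1) h.2

/-! ### The bijections -/

section bijections

variable {d n : ℕ} {lam mu nu : Fin d → ℕ} (hd : 0 < d) (hdn : d ≤ n)
  (hlam : IsBoxPartition d n lam) (hmu : IsBoxPartition d n mu) (hnu : IsBoxPartition d n nu)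
include hd hdn hlam hmu hnu

theorem exists_puzzle_eq {h : ℕ} {P : Finset Piece} (hP : P ∈ HeightPuzzles n h lam mu nu) :
    ∃ L : SkewBarredTableau lam mu, L ∈ LRTableaux lam mu nu ∧
      IsSettled d n h L.pathU (L.pathX n) ∧ L.puzzle n h = P := by
  obtain ⟨u, x, S, hs, hb, rfl⟩ := exists_isPathSystem_of_mem hlam hmu hnu hd hdn hP
  have h1 : (S.tableau hb hmu).pathU = u := S.arrayU_tableau hb hmu hdn
  have h2 : (S.tableau hb hmu).pathX n = x := S.arrayX_tableau hb hmu hdn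
  refine ⟨S.tableau hb hmu, S.tableau_mem hb hmu hdn hlam, ?_, ?_⟩
  · rwa [h1, h2]
  · rw [SkewBarredTableau.puzzle, h1, h2]

/-- Injectivity holds because `Φ` of the puzzle of `L` is `L` and a puzzle has at most one image;
surjectivity because every puzzle comes from a path system and hence from a tableau. -/
theorem bijective_puzzle {h : ℕ} {T : Set (SkewBarredTableau lam mu)}
    (hT : ∀ L, L ∈ T ↔ L ∈ LRTableaux lam mu nu ∧ IsSettled d n h L.pathU (L.pathX n)) :
    Function.Bijective fun L : T => (⟨L.1.puzzle n h, L.1.puzzle_mem hdn hlam hmu hnu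
      ((hT L).1 L.2).1 ((hT L).1 L.2).2 hd⟩ : HeightPuzzles n h lam mu nu) := by
  constructor
  · intro L L' hLL
    have h1 := L.1.isPhi hdn hlam hmu hnu ((hT L).1 L.2).1 ((hT L).1 L.2).2
    have h2 := L'.1.isPhi hdn hlam hmu hnu ((hT L').1 L'.2).1 ((hT L').1 L'.2).2
    rw [Subtype.mk.injEq] at hLL
    rw [hLL] at h1
    exact Subtype.ext (h1.unique h2)
  · intro P
    obtain ⟨L, hL, hs, hP⟩ := exists_puzzle_eq hd hdn hlam hmu hnu P.2
    exact ⟨⟨L, (hT L).2 ⟨hL, hs⟩⟩, Subtype.ext hP⟩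

/-- The correspondence between the puzzles of height `h` and tableaux. -/
theorem exists_equiv {h : ℕ} {T : Set (SkewBarredTableau lam mu)}
    (hT : ∀ L, L ∈ T ↔ L ∈ LRTableaux lam mu nu ∧ IsSettled d n h L.pathU (L.pathX n)) :
    ∃ e : HeightPuzzles n h lam mu nu ≃ T, ∀ P, (e P).1.puzzle n h = P.1 :=
  ⟨(Equiv.ofBijective _ (bijective_puzzle hd hdn hlam hmu hnu hT)).symm, fun P =>
    congrArg Subtype.val
      ((Equiv.ofBijective _ (bijective_puzzle hd hdn hlam hmu hnu hT)).apply_symm_apply P)⟩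

end bijections

/-- The bijection `Φ` from puzzles to positive equivariant Littlewood-Richardson skew tableaux
extends to a weight preserving bijection `Φ` from trapezoid puzzles to all equivariant
Littlewood-Richardson skew tableaux. -/
theorem proposition8p3 (d n : ℕ) (hd : 0 < d) (hdn : d ≤ n) (lam mu nu : Fin d → ℕ)
    (hlam : IsBoxPartition d n lam) (hmu : IsBoxPartition d n mu) (hnu : IsBoxPartition d n nu) :
    ∃ (PhiPos : Puzzles n lam mu nu ≃ LRTableauxPos lam mu nu)
      (Phi : TrapezoidPuzzles n lam mu nu ≃ LRTableaux lam mu nu),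
      (∀ P, IsPhi n P.1 (PhiPos P).1 ∧ SameWeights n P.1 (PhiPos P).1) ∧
      (∀ P, IsPhi n P.1 (Phi P).1 ∧ SameWeights n P.1 (Phi P).1) ∧
      (∀ P : Puzzles n lam mu nu,
        ∃ h : extendToTrapezoid n P.1 ∈ TrapezoidPuzzles n lam mu nu,
          (Phi ⟨extendToTrapezoid n P.1, h⟩).1 = (PhiPos P).1) := by
  rw [puzzles_eq, trapezoidPuzzles_eq]
  have hpos : ∀ L, L ∈ LRTableauxPos lam mu nu ↔
      L ∈ LRTableaux lam mu nu ∧ IsSettled d n 0 L.pathU (L.pathX n) := fun L =>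
    ⟨fun h => ⟨h.1, (L.mem_LRTableauxPos_iff hdn hmu hlam h.1 hnu).1 h⟩,
      fun h => (L.mem_LRTableauxPos_iff hdn hmu hlam h.1 hnu).2 h.2⟩
  have hall : ∀ L, L ∈ LRTableaux lam mu nu ↔
      L ∈ LRTableaux lam mu nu ∧ IsSettled d n n L.pathU (L.pathX n) := fun L =>
    ⟨fun h => ⟨h, (L.isPathSystem hdn hlam hmu h hnu).isSettled_self⟩, fun h => h.1⟩
  obtain ⟨PhiPos, hPhiPos⟩ := exists_equiv hd hdn hlam hmu hnu hpos
  obtain ⟨Phi, hPhi⟩ := exists_equiv hd hdn hlam hmu hnu hall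
  refine ⟨PhiPos, Phi, fun P => ?_, fun P => ?_, fun P => ?_⟩
  · obtain ⟨h1, h2⟩ := (hpos _).1 (PhiPos P).2
    rw [← hPhiPos P]
    exact ⟨(PhiPos P).1.isPhi hdn hlam hmu hnu h1 h2,
      (PhiPos P).1.sameWeights hdn hlam hmu hnu h1 h2⟩
  · obtain ⟨h1, h2⟩ := (hall _).1 (Phi P).2
    rw [← hPhi P]
    exact ⟨(Phi P).1.isPhi hdn hlam hmu hnu h1 h2,
      (Phi P).1.sameWeights hdn hlam hmu hnu h1 h2⟩
  · obtain ⟨h1, h2⟩ := (hpos _).1 (PhiPos P).2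
    have h3 := ((hall _).1 h1).2
    -- The puzzle and its extension belong to the same tableau, with heights `0` and `n`.
    have h4 : extendToTrapezoid n P.1 = (PhiPos P).1.puzzle n n := by
      rw [← hPhiPos P]
      exact (SkewBarredTableau.isPathSystem _ hdn hlam hmu h1 hnu).extendToTrapezoid_eq h2
    have h5 : extendToTrapezoid n P.1 ∈ HeightPuzzles n n lam mu nu := by
      rw [h4]
      exact (PhiPos P).1.puzzle_mem hdn hlam hmu hnu h1 h3 hd
    refine ⟨h5, ?_⟩
    have h6 := (hall _).1 (Phi ⟨_, h5⟩).2
    have h7 := (Phi ⟨_, h5⟩).1.isPhi hdn hlam hmu hnu h6.1 h6.2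
    have h8 := (PhiPos P).1.isPhi hdn hlam hmu hnu h1 h3
    rw [hPhi] at h7
    rw [← h4] at h8
    -- Both tableaux are images under `Φ` of the same trapezoid puzzle.
    exact h7.unique h8
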